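/- Fix integers $m,n\ge 1$. An incidence structure is a structure $(M;P,L,I)$ in which the unary predicates $P$ (points) and $L$ (lines) partition the domain and $I\subseteq P\times L$; it is $K_{m,n}$-free if no $m$ distinct points are all incident to each of $n$ distinct lines. Let $T^p_{m,n}$ be the theory of $K_{m,n}$-free incidence structures, and $T^c_{m,n}$ the theory of those in which, moreover, any $m$ distinct points lie simultaneously on exactly $n-1$ lines and any $n$ distinct lines meet in exactly $m-1$ points. Let $T_{m,n}$ be the theory consisting of $T^c_{m,n}$ and all axioms $\forall\bar x\,(\widehat\Delta(\bar x)\to\exists\bar y\,\Delta(\bar x,\bar y))$, where $\Delta(\bar x,\bar y)$ is the diagram (all true atomic and negated atomic formulas) of a finite model of $T^p_{m,n}$ whose elements are enumerated without repetition by $\bar x\bar y$, where each point in $\bar y$ is incident to at most $n-1$ lines in $\bar x$ and each line in $\bar y$ is incident to at most $m-1$ points in $\bar x$, and where $\widehat\Delta(\bar x)$ is the part of $\Delta$ that only mentions $\bar x$. Let $\mathbb M\models T_{m,n}$ be a monster model: $\mathbb M$ is $\kappa$-saturated and strongly $\kappa$-homogeneous for an uncountable strong limit cardinal $\kappa$,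 and sets and tuples are called small if they have size $<\kappa$. In such a structure define, for small $A,B,C$ (sets are identified with tuples enumerating them): - $A\perp^d_C B$ (dividing independence) iff for every $C$-indiscernible sequence $(B_i)_{i<\omega}$ in $\operatorname{tp}(B/C)$ there is $A'$ with $A'B_i\equiv_C AB$ for all $i$; - $A\perp^f_C B$ (forking independence) iff for every small tuple $\widehat B$ there is $A'\equiv_{BC}A$ with $A'\perp^d_C B\widehat B$; - $A\perp^a_C B$ (algebraic independence) iff $\operatorname{acl}(AC)\cap\operatorname{acl}(BC)=\operatorname{acl}(C)$; - $A\perp^M_C B$ iff $A\perp^a_D B$ for all $D$ with $C\subseteq D\subseteq\operatorname{acl}(BC)$; - $A\perp^{\text{þ}}_C B$ (thorn independence) iff for every small $\widehat B\supseteq B$ there is $A'\equiv_{BC}A$ with $A'\perp^M_C\widehat B$. Then, for all small $A,B,C\subset\mathbb M$, $$A\perp^f_C B\iff A\perp^{\text{þ}}_C B,$$ where both relations are computed in $\mathbb M$ itself. Moreover, if $m,n\ge 2$, then $T_{m,n}$ is not rosy: thorn independence, computed in the expansion $\mathbb M^{\mathrm{eq}}$ of $\mathbb M$ by imaginaries,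 is not a symmetric relation on small subsets $A,B$ over small $C$. -/

import Mathlib

open FirstOrder Cardinal

universe u v w

/-! ### Model-theoretic notions for an arbitrary structure

`N` is an `L`-structure, thought of as a universal domain; sets and tuples of size `< κ` are
the small ones. Tuples may be infinite: a tuple indexed by `ι` is a function `ι → N`, and a set
is enumerated by itself through `Subtype.val`. -/

namespace IndepRel

section General

variable (L : FirstOrder.Language.{u, v}) {N : Type w} [L.Structure N]

/-- `a ≡_C a'`: the two tuples have the same complete type over `C`. -/
def SameType (C : Set N) {ι : Type*} (a a' : ι → N) : Prop :=
  ∀ φ : L[[C]].Formula ι, φ.Realize a ↔ φ.Realize a'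

/-- Model-theoretic algebraic closure: the union of the finite `C`-definable sets. -/
def acl (C : Set N) : Set N :=
  {b | ∃ s : Set N, s.Finite ∧ C.Definable₁ L s ∧ b ∈ s}

/-- `(b_i)` is an indiscernible sequence of tuples over `C`. -/
def Indiscernible (C : Set N) {ι : Type*} (b : ℕ → ι → N) : Prop :=
  ∀ (k : ℕ) (f g : Fin k → ℕ), StrictMono f → StrictMono g →
    SameType L C (fun p : Fin k × ι => b (f p.1) p.2) (fun p : Fin k × ι => b (g p.1) p.2)

/-- Dividing independence of the tuples `a` and `b` over `C`: for every `C`-indiscernible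
sequence `(b_i)` in `tp(b/C)` there is `a'` with `a' b_i ≡_C a b` for all `i`. -/
def DividingIndep (C : Set N) {ι ι' : Type*} (a : ι → N) (b : ι' → N) : Prop :=
  ∀ bs : ℕ → ι' → N, Indiscernible L C bs → (∀ i, SameType L C (bs i) b) →
    ∃ a' : ι → N, ∀ i, SameType L C (Sum.elim a' (bs i)) (Sum.elim a b)

/-- Forking independence of the tuples `a` and `b` over `C`: for every small tuple `d` (given
as an enumerated set `D`) there is `a' ≡_{Cb} a` with `a'` dividing independent from `b d`
over `C`. -/
def ForkingIndepTuple (κ : Cardinal.{w}) (C : Set N) {ι ι' : Type*} (a : ι → N) (b : ι' → N) :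
    Prop :=
  ∀ D : Set N, #D < κ → ∃ a' : ι → N, SameType L (C ∪ Set.range b) a' a ∧
    DividingIndep L C a' (Sum.elim b (Subtype.val : D → N))

/-- Forking independence of the sets `A` and `B` over `C`. -/
def ForkingIndep (κ : Cardinal.{w}) (C A B : Set N) : Prop :=
  ForkingIndepTuple L κ C (Subtype.val : A → N) (Subtype.val : B → N)

/-- Algebraic independence: `acl(CA) ∩ acl(CB) = acl(C)`. -/
def AlgIndep (C A B : Set N) : Prop :=
  acl L (C ∪ A) ∩ acl L (C ∪ B) = acl L C

/-- M-independence: base monotonicity is forced on algebraic independence. -/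
def MIndep (C A B : Set N) : Prop :=
  ∀ D : Set N, C ⊆ D → D ⊆ acl L (B ∪ C) → AlgIndep L D A B

/-- Thorn independence: extension is forced on M-independence. That is, for every small
`B' ⊇ B` there is `A' ≡_{BC} A` which is M-independent from `B'` over `C`. -/
def ThornIndep (κ : Cardinal.{w}) (C A B : Set N) : Prop :=
  ∀ B' : Set N, #B' < κ → B ⊆ B' → ∃ a' : A → N,
    SameType L (B ∪ C) a' (Subtype.val : A → N) ∧ MIndep L C (Set.range a') B'

variable (N) in
/-- Symmetry of thorn independence on the small subsets of `N`. -/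
def ThornSymmetric (κ : Cardinal.{w}) : Prop :=
  ∀ A B C : Set N, #A < κ → #B < κ → #C < κ → ThornIndep L κ C A B → ThornIndep L κ C B A

variable (N) in
/-- `N` is a monster model whose small sets are those of size `< κ`: it is `κ`-saturated and
strongly `κ`-homogeneous, where `κ` is an uncountable strong limit cardinal above the size of
the language. -/
structure IsMonster (κ : Cardinal.{w}) : Prop where
  strongLimit : κ.IsStrongLimit
  uncountable : ℵ₀ < κ
  card_language_lt : Cardinal.lift.{w} L.card < Cardinal.lift.{max u v} κ
  saturated : ∀ A : Set N, #A < κ → ∀ p : Set (L[[A]].Formula Unit),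
    (∀ q : Finset (L[[A]].Formula Unit), ↑q ⊆ p →
      ∃ x : N, ∀ φ ∈ q, φ.Realize fun _ => x) →
    ∃ x : N, ∀ φ ∈ p, φ.Realize fun _ => x
  homogeneous : ∀ (A : Set N) (f : A → N), #A < κ →
    SameType L (∅ : Set N) f (Subtype.val : A → N) →
    ∃ σ : N ≃[L] N, ∀ a : A, σ (a : N) = f a

end General

/-! ### The expansion by imaginaries

`M^eq` is presented as a one-sorted structure in which the sorts are named by unary
predicates. -/

section Imaginaries

variable (L : FirstOrder.Language.{u, v}) (M : Type w) [L.Structure M]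

/-- The relation on `k`-tuples defined by a formula in two `k`-tuples of variables. -/
def formulaRel {k : ℕ} (φ : L.Formula (Fin k ⊕ Fin k)) (x y : Fin k → M) : Prop :=
  φ.Realize (Sum.elim x y)

/-- An index for an imaginary sort: a parameter-free formula that defines an equivalence
relation on the `k`-tuples. -/
structure ImagSort : Type (max u v) where
  arity : ℕ
  formula : L.Formula (Fin arity ⊕ Fin arity)
  equiv : Equivalence (formulaRel L M formula)

variable {L M} in
/-- The definable equivalence relation belonging to an imaginary sort. -/
def ImagSort.setoid (E : ImagSort L M) : Setoid (Fin E.arity → M) :=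
  ⟨formulaRel L M E.formula, E.equiv⟩

/-- The elements of `M^eq`: the home sort `M` and, for each imaginary sort, the classes. -/
def EqCarrier : Type (max u v w) :=
  M ⊕ (Σ E : ImagSort L M, Quotient E.setoid)

/-- The symbols of the language of `M^eq`: predicates for the sorts, the symbols of `L` on the
home sort (function symbols through their graphs), and the graphs of the projections
`M^k → M^k / E`. -/
inductive EqRelSymb : ℕ → Type (max u v)
  | home : EqRelSymb 1
  | imag (E : ImagSort L M) : EqRelSymb 1
  | rel {k : ℕ} (R : L.Relations k) : EqRelSymb k
  | graph {k : ℕ} (f : L.Functions k) : EqRelSymb (k + 1)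
  | proj (E : ImagSort L M) : EqRelSymb (E.arity + 1)

/-- The language of `M^eq`. -/
def eqLanguage : FirstOrder.Language.{0, max u v} := ⟨fun _ => Empty, EqRelSymb L M⟩

/-- The interpretation of the relation symbols in `M^eq`. In `graph` and `proj` the last
argument is the value. -/
def eqRelMap : ∀ {k : ℕ}, EqRelSymb L M k → (Fin k → EqCarrier L M) → Prop
  | _, .home, z => ∃ x : M, z 0 = Sum.inl x
  | _, .imag E, z => ∃ c : Quotient E.setoid, z 0 = Sum.inr ⟨E, c⟩
  | _, .rel R, z => ∃ x, FirstOrder.Language.Structure.RelMap (M := M) R x ∧ z = fun i => Sum.inl (x i)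
  | _, .graph f, z => ∃ x : Fin _ → M, z =
      Fin.snoc (α := fun _ => EqCarrier L M) (fun i => Sum.inl (x i))
        (Sum.inl (FirstOrder.Language.Structure.funMap f x))
  | _, .proj E, z => ∃ x : Fin E.arity → M, z =
      Fin.snoc (α := fun _ => EqCarrier L M) (fun i => Sum.inl (x i))
        (Sum.inr ⟨E, Quotient.mk E.setoid x⟩)

instance eqStructure : (eqLanguage L M).Structure (EqCarrier L M) where
  funMap f := nomatch f
  RelMap r := eqRelMap L M r

end Imaginaries

end IndepRel

/-! ### Incidence structures and the theory `T_{m,n}` -/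

namespace Incidence

open FirstOrder.Language

/-- Symbols for points, lines and incidence. -/
inductive Symb : ℕ → Type
  | point : Symb 1
  | line : Symb 1
  | inc : Symb 2

/-- The language of incidence structures. -/
def lang : FirstOrder.Language.{0, 0} := ⟨fun _ => Empty, Symb⟩

abbrev pointSymb : lang.Relations 1 := Symb.point

abbrev lineSymb : lang.Relations 1 := Symb.line

abbrev incSymb : lang.Relations 2 := Symb.inc

section Semantics

variable {V : Type*} [lang.Structure V]

def IsPoint (x : V) : Prop := Structure.RelMap pointSymb ![x]

def IsLine (x : V) : Prop := Structure.RelMap lineSymb ![x]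

def Inc (x y : V) : Prop := Structure.RelMap incSymb ![x, y]

end Semantics

section Formulas

variable {α : Type*}

def pointF (a : α) : lang.Formula α :=
  Relations.formula₁ pointSymb (Term.var a)

def lineF (a : α) : lang.Formula α :=
  Relations.formula₁ lineSymb (Term.var a)

def incF (a b : α) : lang.Formula α :=
  Relations.formula₂ incSymb (Term.var a) (Term.var b)

def eqF (a b : α) : lang.Formula α := Term.equal (Term.var a) (Term.var b)

open Classical in
/-- The formula `φ` if `p` holds, and its negation otherwise. -/
noncomputable def literal (p : Prop) (φ : lang.Formula α) : lang.Formula α :=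
  if p then φ else ∼φ

/-- The universal closure of a formula in finitely many variables. -/
noncomputable def forAll {β : Type} [Finite β] (φ : lang.Formula β) : lang.Sentence :=
  Formula.iAlls β (φ.relabel (Sum.inr : β → Empty ⊕ β))

/-- The variables `f i` have pairwise distinct values. -/
noncomputable def distinctF {ι : Type} [Finite ι] (f : ι → α) : lang.Formula α :=
  Formula.iInf fun p : {p : ι × ι // p.1 ≠ p.2} => ∼(eqF (f p.1.1) (f p.1.2))

/-- The conjunction of all atomic and negated atomic formulas, in variables from `W`, that hold
in the structure `V` when each variable `x` is interpreted as `e x`. -/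
noncomputable def diagram {W V : Type} [Finite W] [lang.Structure V] (e : W → V) :
    lang.Formula W :=
  (Formula.iInf fun x : W =>
    literal (IsPoint (e x)) (pointF x) ⊓ literal (IsLine (e x)) (lineF x)) ⊓
  (Formula.iInf fun p : W × W =>
    literal (Inc (e p.1) (e p.2)) (incF p.1 p.2) ⊓ literal (e p.1 = e p.2) (eqF p.1 p.2))

end Formulas

/-- The complete incidence structure `K_{m,n}`: `m` points, `n` lines, all incident. -/
def completeRel (m n : ℕ) : ∀ {k : ℕ}, Symb k → (Fin k → Fin m ⊕ Fin n) → Prop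
  | _, .point, z => ∃ i, z 0 = Sum.inl i
  | _, .line, z => ∃ j, z 0 = Sum.inr j
  | _, .inc, z => ∃ i j, z 0 = Sum.inl i ∧ z 1 = Sum.inr j

@[reducible] def completeStructure (m n : ℕ) : lang.Structure (Fin m ⊕ Fin n) where
  funMap f := nomatch f
  RelMap r := completeRel m n r

/-- Points and lines partition the domain. -/
noncomputable def partitionAxiom : lang.Sentence :=
  forAll ((pointF ()).iff ∼(lineF ()))

/-- Incidence only holds between a point and a line, in this order. -/
noncomputable def incAxiom : lang.Sentence :=
  forAll ((incF (0 : Fin 2) 1).imp (pointF 0 ⊓ lineF 1))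

/-- No substructure is isomorphic to `K_{m,n}`. -/
noncomputable def freeAxiom (m n : ℕ) : lang.Sentence :=
  forAll ∼(@diagram (Fin m ⊕ Fin n) (Fin m ⊕ Fin n) _ (completeStructure m n) id)

/-- `T^p_{m,n}`: the theory of `K_{m,n}`-free incidence structures. -/
def Tp (m n : ℕ) : lang.Theory := {partitionAxiom, incAxiom, freeAxiom m n}

/-- Every `m` distinct points simultaneously lie on exactly `n - 1` lines. -/
noncomputable def pointsAxiom (m n : ℕ) : lang.Sentence :=
  forAll ((distinctF (id : Fin m → Fin m) ⊓ Formula.iInf fun i : Fin m => pointF i).imp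
    (Formula.iExs (Fin (n - 1))
      (distinctF (Sum.inr : Fin (n - 1) → Fin m ⊕ Fin (n - 1)) ⊓
        Formula.iAlls Unit
          ((lineF (Sum.inr ()) ⊓
              Formula.iInf fun i : Fin m => incF (Sum.inl (Sum.inl i)) (Sum.inr ())).iff
            (Formula.iSup fun j : Fin (n - 1) =>
              eqF (Sum.inr ()) (Sum.inl (Sum.inr j)))))))

/-- Every `n` distinct lines intersect in exactly `m - 1` points. -/
noncomputable def linesAxiom (m n : ℕ) : lang.Sentence :=
  forAll ((distinctF (id : Fin n → Fin n) ⊓ Formula.iInf fun i : Fin n => lineF i).imp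
    (Formula.iExs (Fin (m - 1))
      (distinctF (Sum.inr : Fin (m - 1) → Fin n ⊕ Fin (m - 1)) ⊓
        Formula.iAlls Unit
          ((pointF (Sum.inr ()) ⊓
              Formula.iInf fun i : Fin n => incF (Sum.inr ()) (Sum.inl (Sum.inl i))).iff
            (Formula.iSup fun j : Fin (m - 1) =>
              eqF (Sum.inr ()) (Sum.inl (Sum.inr j)))))))

/-- `T^c_{m,n}`: the theory of complete `K_{m,n}`-free incidence structures. -/
def Tc (m n : ℕ) : lang.Theory := Tp m n ∪ {pointsAxiom m n, linesAxiom m n}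

/-- The finite structure `A` with elements labelled by `x_1, …, x_k` (left) and `y_1, …, y_l`
(right) has a safe diagram: `A` is a model of `T^p_{m,n}`, each point among the `y`'s lies on at
most `n - 1` lines among the `x`'s, and each line among the `y`'s contains at most `m - 1` points
among the `x`'s. -/
def IsSafe (m n k l : ℕ) (S : lang.Structure (Fin k ⊕ Fin l)) : Prop :=
  (Fin k ⊕ Fin l) ⊨ Tp m n ∧
  (∀ y : Fin l, IsPoint (Sum.inr y : Fin k ⊕ Fin l) →
    {x : Fin k | IsLine (Sum.inl x : Fin k ⊕ Fin l) ∧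
      Inc (Sum.inr y : Fin k ⊕ Fin l) (Sum.inl x)}.ncard ≤ n - 1) ∧
  (∀ y : Fin l, IsLine (Sum.inr y : Fin k ⊕ Fin l) →
    {x : Fin k | IsPoint (Sum.inl x : Fin k ⊕ Fin l) ∧
      Inc (Sum.inl x : Fin k ⊕ Fin l) (Sum.inr y)}.ncard ≤ m - 1)

/-- The axiom `∀ x (Δ̂(x) → ∃ y Δ(x;y))`, where `Δ` is the diagram of the given structure on
`x y` and `Δ̂` is its restriction to the variables `x`. -/
noncomputable def extensionAxiom (k l : ℕ) (S : lang.Structure (Fin k ⊕ Fin l)) :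
    lang.Sentence :=
  forAll ((diagram (Sum.inl : Fin k → Fin k ⊕ Fin l)).imp
    (Formula.iExs (Fin l) (diagram (id : Fin k ⊕ Fin l → Fin k ⊕ Fin l))))

/-- `T_{m,n}`: the theory of generic `K_{m,n}`-free incidence structures. -/
def T (m n : ℕ) : lang.Theory :=
  Tc m n ∪ {σ | ∃ (k l : ℕ) (S : lang.Structure (Fin k ⊕ Fin l)),
    IsSafe m n k l S ∧ σ = extensionAxiom k l S}

end Incidence

/-! ### Types, automorphisms and realization of small types in a monster model. -/

namespace IndepRel

open FirstOrder.Language Filter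

section Automorphisms

variable {L : FirstOrder.Language.{u, v}} {N : Type w} [L.Structure N]

/-! A model is viewed as a bipartite graph coloured by points and lines. With N = `threshold m n`,
N(c) neighbours pin down a vertex of colour c up to finitely many choices. A set is closed if it
contains every vertex x with at least N(col x) neighbours in it. The extension axioms and saturation
embed every small K_{m,n}-free extension of a closed set, provided the set stays closed in it, over
this set into the model (`exists_emb`). A back-and-forth argument then shows that isomorphisms
between small closed sets extend to automorphisms (`exists_aut_of_emb`), and algebraic closure turns
out to be the closure just described (`acl_eq_closure`).

The main tool is amalgamation. Copies of a closed set Z are glued along a closed part A, while the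
copies of a closed B ⊆ Z sit at prescribed places. The result is again K_{m,n}-free if no edge joins
A ∖ B to B ∖ A (`AmalgamData.free`, `exists_amalgam`). This suggests the notion `Separated`: over K,
the closure of AK meets Z only in K, and no edge joins cl(AK) ∖ K to Z ∖ K. Suppose that A is
separated from Z over every closed K with C ⊆ K ⊆ Z, and take automorphisms that agree on C and
whose pairs all act alike on Z. With K the set of elements of Z on which they agree, cl(AK) can be
kept constant while Z moves as prescribed (`exists_aut_fixing`). In particular A is then dividing
independent from Z over C.

That forking independence implies thorn independence is a general argument: an element of acl(FA) ∩
acl(FB) outside acl(F) has infinitely many conjugates over F, and an indiscernible sequence that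
moves it, but not F, contradicts dividing independence. For the converse, separation must be derived
from M-independence (`exists_separating`). Its first clause is algebraic independence over K. For
the second, let x in cl(AK) ∖ K be adjacent to y in Z ∖ K. Enlarge the base K by new neighbours of y
until y has N(col y) - 1 neighbours in the base, without becoming algebraic over it. The extra
neighbour x then makes y algebraic over the new base and A, against M-independence. There are few
pairs (K, y), since κ is a strong limit, so one small set Z' contains all the neighbours needed.

For the failure of symmetry, the same amalgamation shows that separation from a small elementary
substructure E gives M-independence from imaginaries represented in E (`mIndep_imaginary`). If b is
neither in cl(A) nor adjacent to it, then A can be moved over b to be separated from any small E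
containing b, by amalgamating over {b} (`exists_separated`); hence A is thorn independent from b
over ∅ in M^eq. A hexagon with pendant vertices provides such A = De and b for which moreover e lies
in acl(Db) but not in acl(D) (`exists_configuration`). So b is not thorn independent from A: for
every b' of the same type over A, the base D and the element e refute M-independence. -/

theorem realize_constantsVarsEquiv_coe {C : Set N} {ι : Type*} (φ : L[[C]].Formula ι) (a : ι → N) :
    Formula.Realize (L := L) (BoundedFormula.constantsVarsEquiv φ)
      (Sum.elim (Subtype.val : C → N) a) ↔ φ.Realize a :=
  BoundedFormula.realize_constantsVarsEquiv (φ := φ) (v := a) (xs := default)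

theorem sameType_iff {C : Set N} {ι : Type*} {a a' : ι → N} :
    SameType L C a a' ↔ ∀ φ : L.Formula (C ⊕ ι),
      φ.Realize (Sum.elim Subtype.val a) ↔ φ.Realize (Sum.elim Subtype.val a') := by
  constructor
  · intro h φ
    have := h (BoundedFormula.constantsVarsEquiv.symm φ)
    rw [← realize_constantsVarsEquiv_coe, ← realize_constantsVarsEquiv_coe,
      Equiv.apply_symm_apply] at this
    exact this
  · intro h φ
    rw [← realize_constantsVarsEquiv_coe, ← realize_constantsVarsEquiv_coe]
    exact h _

theorem realize_aut (σ : N ≃[L] N) {ι : Type*} (φ : L.Formula ι) (a : ι → N) :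
    φ.Realize (fun i => σ (a i)) ↔ φ.Realize a :=
  StrongHomClass.realize_formula σ φ

theorem sameType_of_aut {C : Set N} {ι : Type*} {a a' : ι → N} (σ : N ≃[L] N)
    (hC : ∀ c ∈ C, σ c = c) (h : ∀ i, σ (a i) = a' i) : SameType L C a a' := by
  rw [sameType_iff]
  intro φ
  rw [← realize_aut σ φ (Sum.elim Subtype.val a)]
  have : (fun i => σ (Sum.elim (Subtype.val : C → N) a i)) = Sum.elim Subtype.val a' := by
    funext i
    rcases i with c | i
    · exact hC c c.2
    · exact h i
  rw [this]

theorem SameType.symm {C : Set N} {ι : Type*} {a a' : ι → N} (h : SameType L C a a') :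
    SameType L C a' a := fun φ => (h φ).symm

/-- Over the empty set it suffices to check that formulas are preserved. -/
theorem sameType_empty_of_imp {ι : Type*} {a a' : ι → N}
    (h : ∀ φ : L.Formula ι, φ.Realize a → φ.Realize a') : SameType L (∅ : Set N) a a' := by
  rw [sameType_iff]
  intro φ
  let φ' : L.Formula ι := φ.relabel (Sum.elim (fun x => x.2.elim) id)
  have h1 : ∀ f : ι → N, φ.Realize (Sum.elim Subtype.val f) ↔ φ'.Realize f := by
    intro f
    rw [Formula.realize_relabel]
    have : (Sum.elim (Subtype.val : (∅ : Set N) → N) f) =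
        f ∘ Sum.elim (fun x => x.2.elim) id := by
      funext x
      rcases x with x | x
      · exact x.2.elim
      · rfl
    rw [this]
  rw [h1, h1]
  refine ⟨h φ', fun h2 => ?_⟩
  by_contra h3
  have := h (∼φ') (by rwa [Formula.realize_not])
  rw [Formula.realize_not] at this
  exact this h2

/-- Realization only depends on the values of the free variables. -/
theorem realize_congr_freeVar {ι : Type*} [DecidableEq ι] (φ : L.Formula ι) {a a' : ι → N}
    (h : ∀ i ∈ φ.freeVarFinset, a i = a' i) : φ.Realize a ↔ φ.Realize a' := by
  have h1 : Formula.Realize (φ.restrictFreeVar (id : φ.freeVarFinset → φ.freeVarFinset))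
      (fun i => a i) ↔ φ.Realize a := BoundedFormula.realize_restrictFreeVar _ (fun _ => rfl)
  have h2 : Formula.Realize (φ.restrictFreeVar (id : φ.freeVarFinset → φ.freeVarFinset))
      (fun i => a' i) ↔ φ.Realize a' := BoundedFormula.realize_restrictFreeVar _ (fun _ => rfl)
  rw [← h1, ← h2]
  have : (fun i : φ.freeVarFinset => a i) = fun i : φ.freeVarFinset => a' i :=
    funext fun i => h i i.2
  rw [this]

variable {κ : Cardinal.{w}}

theorem IsMonster.add_lt (hM : IsMonster L N κ) {a b : Cardinal.{w}} (ha : a < κ) (hb : b < κ) :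
    a + b < κ := Cardinal.add_lt_of_lt hM.uncountable.le ha hb

theorem IsMonster.mul_lt (hM : IsMonster L N κ) {a b : Cardinal.{w}} (ha : a < κ) (hb : b < κ) :
    a * b < κ := Cardinal.mul_lt_of_lt hM.uncountable.le ha hb

theorem IsMonster.union_lt (hM : IsMonster L N κ) {A B : Set N} (ha : #A < κ) (hb : #B < κ) :
    #(A ∪ B : Set N) < κ := (mk_union_le A B).trans_lt (hM.add_lt ha hb)

theorem IsMonster.countable_lt (hM : IsMonster L N κ) {α : Type w} [Countable α] : #α < κ :=
  mk_le_aleph0.trans_lt hM.uncountable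

/-- Tuples of the same type over a small set are conjugate. -/
theorem IsMonster.exists_aut (hM : IsMonster L N κ) {C : Set N} {ι : Type w} (hC : #C < κ)
    (hι : #ι < κ) {a a' : ι → N} (h : SameType L C a a') :
    ∃ σ : N ≃[L] N, (∀ c ∈ C, σ c = c) ∧ ∀ i, σ (a i) = a' i := by
  classical
  rw [sameType_iff] at h
  let s : C ⊕ ι → N := Sum.elim Subtype.val a
  let t : C ⊕ ι → N := Sum.elim Subtype.val a'
  have hst : ∀ i j, s i = s j → t i = t j := by
    intro i j hij
    have := h (Term.equal (Term.var i) (Term.var j))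
    simp only [Formula.realize_equal, Term.realize_var] at this
    exact this.1 hij
  let A : Set N := Set.range s
  let r : A → C ⊕ ι := fun x => x.2.choose
  have hr : ∀ x : A, s (r x) = x := fun x => x.2.choose_spec
  obtain ⟨σ, hσ⟩ := hM.homogeneous A (fun x => t (r x)) (mk_range_le.trans_lt
    (by rw [mk_sum, lift_id, lift_id]; exact hM.add_lt hC hι)) (by
      rw [sameType_iff]
      intro φ
      let g : (∅ : Set N) ⊕ A → C ⊕ ι := Sum.elim (fun x => x.2.elim) r
      have h1 : ∀ f : C ⊕ ι → N, Sum.elim (Subtype.val : (∅ : Set N) → N) (fun x => f (r x)) =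
          f ∘ g := by
        intro f
        funext x
        rcases x with x | x
        · exact x.2.elim
        · rfl
      have h2 : (Subtype.val : A → N) = fun x => s (r x) := funext fun x => (hr x).symm
      rw [h1, h2, h1, ← Formula.realize_relabel, ← Formula.realize_relabel]
      exact (h _).symm)
  have key : ∀ i, σ (s i) = t i := fun i => by
    have := hσ ⟨s i, i, rfl⟩
    rw [this]
    exact hst _ _ (hr ⟨s i, i, rfl⟩)
  exact ⟨σ, fun c hc => key (Sum.inl ⟨c, hc⟩), fun i => key (Sum.inr i)⟩

/-- The partial realizations used in the proof of `IsMonster.realize_net`. -/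
def PartialRealizes {J : Type*} (l : Filter J) {I : Type*} (v : J → I → N) (S : Set I)
    (b : I → N) : Prop :=
  ∀ φ : L.Formula S, (∀ᶠ j in l, φ.Realize fun s => v j s) → φ.Realize fun s => b s

/-- The conditions on the new coordinate form a type over the values already chosen. A finite part
of it is satisfiable, because its existential closure holds eventually along the net and so is one
of the formulas that `b` already satisfies. Saturation in one variable then provides the value. -/
theorem IsMonster.extend_partialRealizes (hM : IsMonster L N κ) {J : Type*} (l : Filter J)
    {I : Type w} (hI : #I < κ) (v : J → I → N) (S : Set I) (b : I → N)
    (h : PartialRealizes (L := L) l v S b) (i : I) (hi : i ∉ S) :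
    ∃ b', PartialRealizes (L := L) l v (insert i S) b' ∧ ∀ k ∈ S, b' k = b k := by
  classical
  let A : Set N := b '' S
  have hA : #A < κ := mk_image_le.trans_lt ((mk_set_le S).trans_lt hI)
  let g : ↥(insert i S) → A ⊕ Unit := fun s =>
    if hs : (s : I) ∈ S then Sum.inl ⟨b s, Set.mem_image_of_mem b hs⟩ else Sum.inr ()
  have hg : ∀ (x : N) (s : ↥(insert i S)),
      Sum.elim (Subtype.val : A → N) (fun _ => x) (g s) = if (s : I) = i then x else b s := by
    rintro x ⟨s, hs⟩
    by_cases h1 : s = i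
    · subst h1; simp [g, hi]
    · have h2 : s ∈ S := hs.resolve_left h1
      simp [g, h1, h2]
  let p : Set (L[[A]].Formula Unit) := {ψ | ∃ φ : L.Formula ↥(insert i S),
    (∀ᶠ j in l, φ.Realize fun s => v j s) ∧
      ψ = BoundedFormula.constantsVarsEquiv.symm (φ.relabel g)}
  have hp : ∀ (φ : L.Formula ↥(insert i S)) (x : N),
      Formula.Realize (L := L[[A]]) (BoundedFormula.constantsVarsEquiv.symm (φ.relabel g))
        (fun _ => x) ↔ φ.Realize fun s => if (s : I) = i then x else b s := by
    intro φ x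
    have := realize_constantsVarsEquiv_coe (L := L) (C := A) (ι := Unit)
      (BoundedFormula.constantsVarsEquiv.symm (φ.relabel g)) (fun _ => x)
    rw [Equiv.apply_symm_apply] at this
    rw [← this, Formula.realize_relabel]
    have h3 : (Sum.elim (Subtype.val : A → N) (fun _ => x)) ∘ g =
      fun s : ↥(insert i S) => if (s : I) = i then x else b s := funext (hg x)
    rw [h3]
  obtain ⟨x, hx⟩ := hM.saturated A hA p (by
    intro Q hQ
    have hQ' : ∀ q : Q, ∃ φ : L.Formula ↥(insert i S), (∀ᶠ j in l, φ.Realize fun s => v j s) ∧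
        q.1 = BoundedFormula.constantsVarsEquiv.symm (φ.relabel g) := fun q => hQ q.2
    choose F hF hF' using hQ'
    let t : ↥(insert i S) → S ⊕ Unit := fun s =>
      if hs : (s : I) ∈ S then Sum.inl ⟨s, hs⟩ else Sum.inr ()
    let χ : L.Formula S := Formula.iExs Unit
      (Formula.iInf fun q : Q => (F q).relabel t)
    have hχ : χ.Realize fun s => b s := by
      refine h χ ?_
      have : ∀ᶠ j in l, ∀ q : Q, (F q).Realize fun s => v j s :=
        eventually_all.2 hF
      filter_upwards [this] with j hj
      simp only [χ, Formula.realize_iExs, Formula.realize_iInf, Formula.realize_relabel]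
      refine ⟨fun _ => v j i, fun q => ?_⟩
      have : (Sum.elim (fun s : S => v j s) fun _ => v j i) ∘ t = fun s : ↥(insert i S) => v j s := by
        funext ⟨s, hs⟩
        by_cases h2 : s ∈ S
        · simp [t, h2]
        · have h1 : s = i := hs.resolve_right h2
          subst h1
          simp [t, h2]
      rw [this]
      exact hj q
    simp only [χ, Formula.realize_iExs, Formula.realize_iInf, Formula.realize_relabel] at hχ
    obtain ⟨x, hx⟩ := hχ
    refine ⟨x (), fun φ hφ => ?_⟩
    rw [show φ = _ from hF' ⟨φ, hφ⟩, hp]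
    convert hx ⟨φ, hφ⟩ using 1
    funext ⟨s, hs⟩
    by_cases h2 : s ∈ S
    · have h1 : s ≠ i := fun h1 => hi (h1 ▸ h2)
      simp [t, h2, h1]
    · have h1 : s = i := hs.resolve_right h2
      subst h1
      simp [t, h2])
  refine ⟨fun k => if k = i then x else b k, fun φ hφ => ?_, fun k hk =>
    if_neg fun h : k = i => hi (h ▸ hk)⟩
  have := hx _ ⟨φ, hφ, rfl⟩
  rw [hp] at this
  exact this

/-- A monster model realizes every small type in small many variables: along a net of tuples, all
formulas that hold eventually can be realized together. -/
theorem IsMonster.realize_net (hM : IsMonster L N κ) {J : Type*} (l : Filter J) [NeBot l]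
    {I : Type w} (hI : #I < κ) (v : J → I → N) :
    ∃ b : I → N, ∀ φ : L.Formula I, (∀ᶠ j in l, φ.Realize (v j)) → φ.Realize b := by
  classical
  obtain ⟨j₀⟩ := l.nonempty_of_neBot
  let P := {q : Set I × (I → N) // PartialRealizes (L := L) l v q.1 q.2}
  let r : P → P → Prop := fun p q => p.1.1 ⊆ q.1.1 ∧ ∀ i ∈ p.1.1, p.1.2 i = q.1.2 i
  have hbase : PartialRealizes (L := L) l v ∅ (v j₀) := by
    intro φ hφ
    obtain ⟨j, hj⟩ := hφ.exists
    have : (fun s : (∅ : Set I) => v j s) = fun s : (∅ : Set I) => v j₀ s :=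
      funext fun s => s.2.elim
    rwa [this] at hj
  have : ∃ m : P, ∀ a, r m a → r a m := by
    refine exists_maximal_of_chains_bounded (r := r) ?_ ?_
    · intro c hc
      rcases c.eq_empty_or_nonempty with rfl | hne
      · exact ⟨⟨(∅, v j₀), hbase⟩, by simp⟩
      let U : Set I := ⋃ p ∈ c, p.1.1
      let b : I → N := fun i => if h : ∃ p ∈ c, i ∈ p.1.1 then h.choose.1.2 i else v j₀ i
      have hb : ∀ p ∈ c, ∀ i ∈ p.1.1, b i = p.1.2 i := by
        intro p hp i hi
        have h : ∃ p ∈ c, i ∈ p.1.1 := ⟨p, hp, hi⟩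
        simp only [b, dif_pos h]
        obtain ⟨h1, h2⟩ := h.choose_spec
        by_cases heq : h.choose = p
        · rw [heq]
        · rcases hc h1 hp heq with h3 | h3
          · exact h3.2 i h2
          · exact (h3.2 i hi).symm
      have hU : PartialRealizes (L := L) l v U b := by
        intro φ hφ
        have hdir : DirectedOn (fun p q : P => p.1.1 ⊆ q.1.1) c := by
          intro p hp q hq
          by_cases heq : p = q
          · exact ⟨p, hp, subset_rfl, heq ▸ subset_rfl⟩
          · rcases hc hp hq heq with h3 | h3
            · exact ⟨q, hq, h3.1, subset_rfl⟩
            · exact ⟨p, hp, subset_rfl, h3.1⟩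
        -- A formula has finitely many free variables, so they all lie in the domain of a single
        -- member of the chain.
        obtain ⟨p, hp, hps⟩ := DirectedOn.exists_mem_subset_of_finset_subset_biUnion hne hdir
          (s := φ.freeVarFinset.image Subtype.val) (by
            intro i hi
            simp only [Finset.coe_image, Set.mem_image] at hi
            obtain ⟨s, -, rfl⟩ := hi
            exact s.2)
        let f : φ.freeVarFinset → p.1.1 := fun s => ⟨s.1.1, hps (by
          simp only [Finset.coe_image, Set.mem_image]
          exact ⟨s.1, s.2, rfl⟩)⟩
        have hψ : ∀ e : I → N, Formula.Realize (φ.restrictFreeVar f) (fun s => e s) ↔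
            φ.Realize fun s => e s := fun e =>
          BoundedFormula.realize_restrictFreeVar _ (fun _ => rfl)
        rw [← hψ]
        have h1 : (fun s : p.1.1 => b s) = fun s : p.1.1 => p.1.2 s :=
          funext fun s => hb p hp s s.2
        rw [h1]
        refine p.2 _ (hφ.mono fun j hj => ?_)
        exact (hψ (v j)).2 hj
      exact ⟨⟨(U, b), hU⟩, fun p hp =>
        ⟨Set.subset_biUnion_of_mem (u := fun p : P => p.1.1) hp,
          fun i hi => (hb p hp i hi).symm⟩⟩
    · intro a b c h1 h2
      exact ⟨h1.1.trans h2.1, fun i hi => (h1.2 i hi).trans (h2.2 i (h1.1 hi))⟩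
  obtain ⟨m, hm⟩ := this
  have htop : ∀ i, i ∈ m.1.1 := by
    intro i
    by_contra hi
    obtain ⟨b', hb', hb⟩ := hM.extend_partialRealizes l hI v m.1.1 m.1.2 m.2 i hi
    exact hi ((hm ⟨(insert i m.1.1, b'), hb'⟩ ⟨Set.subset_insert _ _, fun k hk =>
      (hb k hk).symm⟩).1 (Set.mem_insert _ _))
  refine ⟨m.1.2, fun φ hφ => ?_⟩
  have h1 : ∀ e : I → N, (φ.relabel fun i => (⟨i, htop i⟩ : m.1.1)).Realize (fun s => e s) ↔
      φ.Realize e := fun e => by rw [Formula.realize_relabel]; rfl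
  rw [← h1]
  exact m.2 _ (hφ.mono fun j hj => (h1 _).2 hj)

end Automorphisms

end IndepRel

/-! ### Sequences of conjugates and algebraic closure. -/

namespace IndepRel

open FirstOrder.Language Filter

section Sequences

variable {L : FirstOrder.Language.{u, v}} {N : Type w} [L.Structure N] {κ : Cardinal.{w}}

/-- `IsMonster.realize_net` for sequences of tuples. -/
theorem IsMonster.realize_seq (hM : IsMonster L N κ) {J : Type*} (l : Filter J) [NeBot l]
    {S : Type w} (hS : #S < κ) (v : J → ℕ → S → N) :
    ∃ b : ℕ → S → N, ∀ φ : L.Formula (ℕ × S),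
      (∀ᶠ j in l, φ.Realize fun p => v j p.1 p.2) → φ.Realize fun p => b p.1 p.2 := by
  have hI : #(ULift.{w} ℕ × S) < κ := by
    rw [mk_prod, lift_id, lift_id]
    exact hM.mul_lt hM.countable_lt hS
  obtain ⟨b, hb⟩ := hM.realize_net l hI fun j p => v j p.1.down p.2
  refine ⟨fun n s => b (⟨n⟩, s), fun φ hφ => ?_⟩
  have := hb (φ.relabel fun p => (⟨p.1⟩, p.2)) (by
    filter_upwards [hφ] with j hj
    rw [Formula.realize_relabel]
    exact hj)
  rw [Formula.realize_relabel] at this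
  exact this

/-- The type of `a` together with conditions `Ψ` on pairs, if finitely satisfiable along
sequences, is realized by a sequence of conjugates of `a`. -/
theorem IsMonster.exists_conjugates (hM : IsMonster L N κ) {S : Type w} (hS : #S < κ) (a : S → N)
    (Ψ : Set (L.Formula (S ⊕ S)))
    (h : ∀ (φ : L.Formula S) (Ψ₀ : Finset (L.Formula (S ⊕ S))), φ.Realize a → ↑Ψ₀ ⊆ Ψ →
      ∃ z : ℕ → S → N, (∀ i, φ.Realize (z i)) ∧
        ∀ i j, i < j → ∀ ψ ∈ Ψ₀, ψ.Realize (Sum.elim (z i) (z j))) :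
    ∃ σ : ℕ → (N ≃[L] N), ∀ i j, i < j → ∀ ψ ∈ Ψ,
      ψ.Realize (Sum.elim (fun s => σ i (a s)) fun s => σ j (a s)) := by
  classical
  -- Pairs of finite sets of conditions, directed by inclusion: along `atTop` every single condition
  -- holds eventually, so a limit of the approximations satisfies all of them.
  let J := Finset {φ : L.Formula S // φ.Realize a} × Finset Ψ
  have h' : ∀ j : J, ∃ z : ℕ → S → N, (∀ φ ∈ j.1, ∀ i, φ.1.Realize (z i)) ∧
      ∀ i k, i < k → ∀ ψ ∈ j.2, ψ.1.Realize (Sum.elim (z i) (z k)) := by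
    intro j
    obtain ⟨z, h1, h2⟩ := h (Formula.iInf fun φ : j.1 => φ.1.1) (j.2.map ⟨_, Subtype.val_injective⟩)
      (by rw [Formula.realize_iInf]; exact fun φ => φ.1.2) (by
        intro ψ hψ
        simp only [Finset.coe_map, Set.mem_image] at hψ
        obtain ⟨ψ, -, rfl⟩ := hψ
        exact ψ.2)
    refine ⟨z, fun φ hφ i => ?_, fun i k hik ψ hψ => h2 i k hik _ (Finset.mem_map_of_mem _ hψ)⟩
    have := h1 i
    rw [Formula.realize_iInf] at this
    exact this ⟨φ, hφ⟩
  choose z hz1 hz2 using h'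
  obtain ⟨b, hb⟩ := hM.realize_seq (atTop : Filter J) hS z
  have hσ : ∀ i, ∃ σ : N ≃[L] N, ∀ s, σ (a s) = b i s := by
    intro i
    have hpos : ∀ φ : L.Formula S, φ.Realize a → φ.Realize (b i) := by
      intro φ hφ
      have := hb (φ.relabel fun s => (i, s)) (by
        filter_upwards [eventually_ge_atTop (({⟨φ, hφ⟩}, ∅) : J)] with j hj
        rw [Formula.realize_relabel]
        exact hz1 j _ (Finset.singleton_subset_iff.1 hj.1) i)
      rw [Formula.realize_relabel] at this
      exact this
    have hst : SameType L (∅ : Set N) a (b i) := sameType_empty_of_imp hpos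
    obtain ⟨σ, -, hσ⟩ := hM.exists_aut (by
      rw [mk_eq_zero]; exact aleph0_pos.trans hM.uncountable) hS hst
    exact ⟨σ, hσ⟩
  choose σ hσ using hσ
  refine ⟨σ, fun i j hij ψ hψ => ?_⟩
  have := hb (ψ.relabel (Sum.elim (fun s => (i, s)) fun s => (j, s))) (by
    filter_upwards [eventually_ge_atTop ((∅, {⟨ψ, hψ⟩}) : J)] with k hk
    rw [Formula.realize_relabel]
    have := hz2 k i j hij _ (Finset.singleton_subset_iff.1 hk.2)
    convert this using 1
    funext x
    rcases x with x | x <;> rfl)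
  rw [Formula.realize_relabel] at this
  convert this using 1
  funext x
  rcases x with x | x <;> simp [hσ]

theorem aut_mem_of_definable {C : Set N} {s : Set N} (hs : C.Definable₁ L s) (σ : N ≃[L] N)
    (hσ : ∀ c ∈ C, σ c = c) {x : N} (hx : x ∈ s) : σ x ∈ s := by
  obtain ⟨φ, hφ⟩ := Set.definable_iff_exists_formula_sum.1 hs
  have h : ∀ y, y ∈ s ↔ φ.Realize (Sum.elim Subtype.val fun _ : Fin 1 => y) := fun y => by
    have := Set.ext_iff.1 hφ fun _ => y
    exact this
  rw [h] at hx ⊢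
  rw [← realize_aut σ] at hx
  convert hx using 1
  funext y
  rcases y with y | y
  · exact (hσ y y.2).symm
  · rfl

/-- An algebraic element has a finite orbit. -/
theorem finite_orbit_of_mem_acl {C : Set N} {b : N} (hb : b ∈ acl L C) :
    {x | ∃ σ : N ≃[L] N, (∀ c ∈ C, σ c = c) ∧ σ b = x}.Finite := by
  obtain ⟨s, hs, hd, hbs⟩ := hb
  refine hs.subset ?_
  rintro x ⟨σ, hσ, rfl⟩
  exact aut_mem_of_definable hd σ hσ hbs

theorem not_mem_acl_of_injective {C : Set N} {b : N} (σ : ℕ → (N ≃[L] N))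
    (hσ : ∀ i, ∀ c ∈ C, σ i c = c) (hinj : Function.Injective fun i => σ i b) : b ∉ acl L C :=
  fun hb => Set.infinite_range_of_injective hinj
    ((finite_orbit_of_mem_acl hb).subset (by rintro _ ⟨i, rfl⟩; exact ⟨σ i, hσ i, rfl⟩))

theorem injective_of_lt {α : Type*} {f : ℕ → α} (h : ∀ i j, i < j → f i ≠ f j) :
    Function.Injective f := by
  intro i j hij
  rcases lt_trichotomy i j with h' | h' | h'
  · exact (h i j h' hij).elim
  · exact h'
  · exact (h j i h' hij.symm).elim

/-- A non-algebraic element has infinitely many conjugates. -/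
theorem IsMonster.exists_aut_of_not_mem_acl (hM : IsMonster L N κ) {C : Set N} (hC : #C < κ)
    {b : N} (hb : b ∉ acl L C) : ∃ σ : ℕ → (N ≃[L] N), (∀ i, ∀ c ∈ C, σ i c = c) ∧
      Function.Injective fun i => σ i b := by
  classical
  let S := C ⊕ PUnit.{w + 1}
  have hS : #S < κ := by
    rw [mk_sum, lift_id, lift_id]; exact hM.add_lt hC hM.countable_lt
  let a : S → N := Sum.elim Subtype.val fun _ => b
  let eqn : S → L.Formula (S ⊕ S) := fun s => Term.equal (Term.var (Sum.inl s)) (Term.var (Sum.inr s))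
  -- The tuple enumerates `C` together with `b`. The conditions force its copies to agree on `C` and
  -- to differ pairwise in the last coordinate.
  let Ψ : Set (L.Formula (S ⊕ S)) :=
    insert (∼(eqn (Sum.inr ⟨⟩))) (Set.range fun c : C => eqn (Sum.inl c))
  obtain ⟨σ, hσ⟩ := hM.exists_conjugates hS a Ψ (by
    intro φ Ψ₀ hφ hΨ
    let s : Set N := {x | φ.Realize (Sum.elim Subtype.val fun _ => x : S → N)}
    have hs : s.Infinite := by
      intro hfin
      refine hb ⟨s, hfin, ?_, hφ⟩
      refine Set.definable_iff_exists_formula_sum.2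
        ⟨φ.relabel (Sum.map id fun _ => 0), ?_⟩
      ext x
      simp only [Set.mem_ofPred_eq, Formula.realize_relabel]
      have : (Sum.elim (Subtype.val : C → N) x) ∘ (Sum.map id fun _ => 0) =
          (Sum.elim Subtype.val fun _ => x 0 : S → N) := by
        funext y
        rcases y with y | y <;> rfl
      rw [this]
      rfl
    have := hs.to_subtype
    let f : ℕ ↪ s := Infinite.natEmbedding s
    refine ⟨fun i => Sum.elim Subtype.val fun _ => f i, fun i => (f i).2, ?_⟩
    intro i j hij ψ hψ
    rcases hΨ hψ with rfl | ⟨c, rfl⟩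
    · simp only [eqn, Formula.realize_not, Formula.realize_equal, Term.realize_var]
      exact fun h => hij.ne (f.injective (Subtype.ext h))
    · simp only [eqn, Formula.realize_equal, Term.realize_var]
      rfl)
  have h1 : ∀ i, ∀ c ∈ C, σ 0 c = σ i c := by
    intro i c hc
    rcases Nat.eq_zero_or_pos i with rfl | hi
    · rfl
    · have := hσ 0 i hi _ (Or.inr ⟨⟨c, hc⟩, rfl⟩)
      simp only [eqn, Formula.realize_equal, Term.realize_var] at this
      exact this
  -- The conjugating automorphisms only agree with each other on `C`; composing with the inverse of
  -- one of them makes them fix `C`.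
  refine ⟨fun i => (σ 0).symm.comp (σ i), fun i c hc => ?_, injective_of_lt fun i j hij h => ?_⟩
  · simp only [Equiv.comp_apply]
    rw [← h1 i c hc]
    exact (σ 0).symm_apply_apply c
  · have := hσ i j hij _ (Or.inl rfl)
    simp only [eqn, Formula.realize_not, Formula.realize_equal, Term.realize_var] at this
    exact this ((σ 0).symm.injective h)

theorem subset_acl (C : Set N) : C ⊆ acl L C := by
  intro c hc
  refine ⟨{c}, Set.finite_singleton c, ?_, rfl⟩
  refine Set.definable_iff_exists_formula_sum.2
    ⟨Term.equal (Term.var (Sum.inl ⟨c, hc⟩)) (Term.var (Sum.inr 0)), ?_⟩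
  ext x
  simp only [Set.mem_ofPred_eq, Formula.realize_equal, Term.realize_var]
  exact eq_comm

theorem acl_mono {C D : Set N} (h : C ⊆ D) : acl L C ⊆ acl L D := by
  rintro b ⟨s, hs, hd, hb⟩
  exact ⟨s, hs, hd.mono h, hb⟩

end Sequences

end IndepRel

/-! ### Indiscernible sequences from ultrafilter limits, and homogeneity for pairs. -/

namespace IndepRel

open FirstOrder.Language Filter

section Indiscernibles

variable {L : FirstOrder.Language.{u, v}} {N : Type w} [L.Structure N] {κ : Cardinal.{w}}

/-- `b` realizes, over the parameters `Q`, all formulas that hold for almost all of the tuples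
`z i`. -/
def RealizesLimit (U : Filter ℕ) {S : Type w} (z : ℕ → S → N) (Q : Set N) (b : S → N) : Prop :=
  ∀ φ : L.Formula (Q ⊕ S), (∀ᶠ i in U, φ.Realize (Sum.elim Subtype.val (z i))) →
    φ.Realize (Sum.elim Subtype.val b)

theorem IsMonster.exists_realizesLimit (hM : IsMonster L N κ) (U : Filter ℕ) [NeBot U]
    {S : Type w} (hS : #S < κ) (z : ℕ → S → N) {Q : Set N} (hQ : #Q < κ) :
    ∃ b : S → N, RealizesLimit (L := L) U z Q b := by
  obtain ⟨b, hb⟩ := hM.realize_net U (I := Q ⊕ S)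
    (by rw [mk_sum, lift_id, lift_id]; exact hM.add_lt hQ hS) fun i => Sum.elim Subtype.val (z i)
  have hst : SameType L (∅ : Set N) (fun q => b (Sum.inl q)) (Subtype.val : Q → N) := by
    refine SameType.symm (sameType_empty_of_imp fun φ hφ => ?_)
    have := hb (φ.relabel Sum.inl) (Eventually.of_forall fun i => by
      rw [Formula.realize_relabel]
      exact hφ)
    rw [Formula.realize_relabel] at this
    exact this
  obtain ⟨σ, -, hσ⟩ := hM.exists_aut (by
      rw [mk_eq_zero]; exact aleph0_pos.trans hM.uncountable) hQ hst
  refine ⟨fun s => σ (b (Sum.inr s)), fun φ hφ => ?_⟩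
  have := (realize_aut σ φ b).2 (hb φ hφ)
  convert this using 1
  funext x
  rcases x with x | x
  · exact (hσ x).symm
  · rfl

/-- Limits of a sequence of tuples give an indiscernible sequence. -/
theorem IsMonster.exists_indiscernible (hM : IsMonster L N κ) {S : Type w} (hS : #S < κ)
    (P : Set N) (hP : #P < κ) (z : ℕ → S → N) (hz : ∀ i s, z i s ∈ P) :
    ∃ b : ℕ → S → N, Indiscernible L P b ∧
      (∀ φ : L.Formula (P ⊕ S), (∀ᶠ i in atTop, φ.Realize (Sum.elim Subtype.val (z i))) →
        ∀ n, φ.Realize (Sum.elim Subtype.val (b n))) ∧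
      ∀ φ : L.Formula (S ⊕ S), (∀ a : S → N, ∀ᶠ i in atTop, φ.Realize (Sum.elim a (z i))) →
        ∀ i j, i < j → φ.Realize (Sum.elim (b i) (b j)) := by
  classical
  let U : Ultrafilter ℕ := hyperfilter ℕ
  have hU : (U : Filter ℕ) ≤ atTop := Nat.hyperfilter_le_atTop
  have : Nonempty (S → N) := ⟨z 0⟩
  choose! g hg using fun (Q : Set N) (hQ : #Q < κ) =>
    hM.exists_realizesLimit (U : Filter ℕ) hS z hQ
  -- A coheir sequence: each new tuple realizes the ultrafilter limit of `z` over `P` and all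
  -- earlier tuples.
  let Q : ℕ → Set N := fun n => Nat.rec (motive := fun _ => Set N) P (fun _ A => A ∪ Set.range (g A)) n
  have hQs : ∀ n, Q (n + 1) = Q n ∪ Set.range (g (Q n)) := fun n => rfl
  have hQ : ∀ n, #↥(Q n) < κ := by
    intro n
    induction n with
    | zero => exact hP
    | succ n ih => rw [hQs]; exact hM.union_lt ih (mk_range_le.trans_lt hS)
  have hmono : Monotone Q := monotone_nat_of_le_succ fun n => by
    rw [hQs]; exact Set.subset_union_left
  let b : ℕ → S → N := fun n => g (Q n)
  have hb : ∀ n, RealizesLimit (L := L) (U : Filter ℕ) z (Q n) (b n) := fun n => hg _ (hQ n)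
  have hbQ : ∀ i j, i < j → ∀ s, b i s ∈ Q j := fun i j hij s =>
    hmono (Nat.succ_le_of_lt hij) (by rw [hQs]; exact Or.inr ⟨s, rfl⟩)
  have hlim : ∀ {T : Type w} (n : ℕ) (φ : L.Formula (T ⊕ S)) (t : T → N),
      (∀ i, t i ∈ Q n) → ((φ.Realize (Sum.elim t (b n))) ↔
        ∀ᶠ i in (U : Filter ℕ), φ.Realize (Sum.elim t (z i))) := by
    intro T n φ t ht
    have h1 : ∀ (φ : L.Formula (T ⊕ S)), (∀ᶠ i in (U : Filter ℕ), φ.Realize (Sum.elim t (z i))) →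
        φ.Realize (Sum.elim t (b n)) := by
      intro φ hφ
      let r : T ⊕ S → Q n ⊕ S := Sum.map (fun i => ⟨t i, ht i⟩) id
      have hr : ∀ f : S → N, (Sum.elim Subtype.val f) ∘ r = Sum.elim t f := by
        intro f
        funext x
        rcases x with x | x <;> rfl
      have := hb n (φ.relabel r) (by
        filter_upwards [hφ] with i hi
        rw [Formula.realize_relabel, hr]
        exact hi)
      rwa [Formula.realize_relabel, hr] at this
    refine ⟨fun h => ?_, h1 φ⟩
    by_contra h2
    have h3 := h1 (∼φ) (by
      rw [← Ultrafilter.eventually_not] at h2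
      filter_upwards [h2] with i hi
      rwa [Formula.realize_not])
    rw [Formula.realize_not] at h3
    exact h3 h
  refine ⟨b, ?_, ?_, ?_⟩
  · intro k
    induction k with
    | zero =>
      intro f g _ _
      have : (fun p : Fin 0 × S => b (f p.1) p.2) = fun p : Fin 0 × S => b (g p.1) p.2 :=
        funext fun p => p.1.elim0
      rw [this]
      exact fun φ => Iff.rfl
    | succ k ih =>
      intro f g hf hg
      rw [sameType_iff]
      intro φ
      let r : P ⊕ (Fin (k + 1) × S) → (P ⊕ (Fin k × S)) ⊕ S :=
        Sum.elim (fun x => Sum.inl (Sum.inl x)) fun p =>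
          Fin.lastCases (motive := fun _ => (P ⊕ (Fin k × S)) ⊕ S) (Sum.inr p.2)
            (fun i => Sum.inl (Sum.inr (i, p.2))) p.1
      let φ' := φ.relabel r
      let t : (Fin (k + 1) → ℕ) → P ⊕ (Fin k × S) → N := fun f =>
        Sum.elim Subtype.val fun p => b (f p.1.castSucc) p.2
      have h1 : ∀ f : Fin (k + 1) → ℕ,
          φ.Realize (Sum.elim Subtype.val fun p : Fin (k + 1) × S => b (f p.1) p.2) ↔
            φ'.Realize (Sum.elim (t f) (b (f (Fin.last k)))) := by
        intro f
        rw [Formula.realize_relabel]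
        have : (Sum.elim Subtype.val fun p : Fin (k + 1) × S => b (f p.1) p.2) =
            (Sum.elim (t f) (b (f (Fin.last k)))) ∘ r := by
          funext x
          rcases x with x | ⟨i, s⟩
          · rfl
          · refine Fin.lastCases ?_ (fun i => ?_) i
            · simp [r]
            · simp [r, t]
        rw [this]
      have h2 : ∀ f : Fin (k + 1) → ℕ, StrictMono f →
          ((φ'.Realize (Sum.elim (t f) (b (f (Fin.last k))))) ↔
            ∀ᶠ i in (U : Filter ℕ), φ'.Realize (Sum.elim (t f) (z i))) := by
        intro f hf
        refine hlim _ φ' _ ?_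
        rintro (x | ⟨i, s⟩)
        · exact hmono (Nat.zero_le _) x.2
        · exact hbQ _ _ (hf i.castSucc_lt_last) s
      rw [h1, h1, h2 f hf, h2 g hg]
      refine eventually_congr (Eventually.of_forall fun i => ?_)
      -- The tuple `z i` lies in `P`. Once the last tuple is replaced by `z i`, it may be absorbed
      -- into the parameters, which leaves `k` tuples and the induction hypothesis.
      let q : (P ⊕ (Fin k × S)) ⊕ S → P ⊕ (Fin k × S) :=
        Sum.elim id fun s => Sum.inl ⟨z i s, hz i s⟩
      have h3 : ∀ f : Fin (k + 1) → ℕ, (φ'.relabel q).Realize (t f) ↔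
          φ'.Realize (Sum.elim (t f) (z i)) := by
        intro f
        refine Formula.realize_relabel.trans ?_
        have : t f ∘ q = Sum.elim (t f) (z i) := by
          funext x
          rcases x with (x | x) | x <;> rfl
        rw [this]
      rw [← h3, ← h3]
      exact sameType_iff.1 (ih (fun i => f i.castSucc) (fun i => g i.castSucc)
        (fun i j h => hf (Fin.castSucc_lt_castSucc_iff.2 h))
        (fun i j h => hg (Fin.castSucc_lt_castSucc_iff.2 h))) (φ'.relabel q)
  · intro φ hφ n
    rw [hlim n φ _ fun i => hmono (Nat.zero_le n) i.2]
    exact hU hφ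
  · intro φ hφ i j hij
    rw [hlim j φ _ fun s => hbQ i j hij s]
    exact hU (hφ _)

/-- Ramsey's theorem for pairs, for finitely many colours at once and with prescribed limit
colours. -/
theorem exists_homogeneous {α : Type*} (c : α → ℕ → ℕ → Prop) (Δ : Finset α) :
    ∃ f : ℕ → ℕ, StrictMono f ∧ ∀ φ ∈ Δ, ∀ i j, i < j →
      (c φ (f i) (f j) ↔
        ∀ᶠ a in (hyperfilter ℕ : Filter ℕ), ∀ᶠ b in (hyperfilter ℕ : Filter ℕ), c φ a b) := by
  classical
  let U : Ultrafilter ℕ := hyperfilter ℕ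
  let lim : α → Prop := fun φ => ∀ᶠ a in (U : Filter ℕ), ∀ᶠ b in (U : Filter ℕ), c φ a b
  -- An ultrafilter decides each colour, so almost all `a` give the limit colour with almost all
  -- `b`. The sequence is then picked greedily, keeping this true for every element chosen.
  have key : ∀ φ, ∀ᶠ a in (U : Filter ℕ), ∀ᶠ b in (U : Filter ℕ), (c φ a b ↔ lim φ) := by
    intro φ
    by_cases h : lim φ
    · filter_upwards [h] with a ha
      filter_upwards [ha] with b hb
      simp [hb, h]
    · have h' := h
      simp only [lim] at h'
      rw [← Ultrafilter.eventually_not] at h'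
      filter_upwards [h'] with a ha
      rw [← Ultrafilter.eventually_not] at ha
      filter_upwards [ha] with b hb
      simp [hb, h]
  obtain ⟨f, -, hf⟩ := exists_seq_of_forall_finset_exists
    (fun a => ∀ φ ∈ Δ, ∀ᶠ b in (U : Filter ℕ), (c φ a b ↔ lim φ))
    (fun a b => a < b ∧ ∀ φ ∈ Δ, (c φ a b ↔ lim φ)) (by
      intro s hs
      have h1 : ∀ᶠ y in (U : Filter ℕ), ∀ φ ∈ Δ, ∀ᶠ b in (U : Filter ℕ), (c φ y b ↔ lim φ) :=
        (eventually_all_finset Δ).2 fun φ _ => key φ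
      have h2 : ∀ᶠ y in (U : Filter ℕ), ∀ x ∈ s, x < y ∧ ∀ φ ∈ Δ, (c φ x y ↔ lim φ) := by
        refine (eventually_all_finset s).2 fun x hx => ?_
        have h3 : ∀ᶠ y in (U : Filter ℕ), x < y :=
          Nat.hyperfilter_le_atTop (eventually_gt_atTop x)
        exact h3.and ((eventually_all_finset Δ).2 fun φ hφ => hs x hx φ hφ)
      exact (h1.and h2).exists)
  exact ⟨f, fun i j hij => (hf i j hij).1, fun φ hφ i j hij => (hf i j hij).2 φ hφ⟩

/-- A sequence of tuples may be replaced by one that is homogeneous for pairs and keeps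
all properties that are common to the subsequences. -/
theorem IsMonster.exists_pair_homogeneous (hM : IsMonster L N κ) {S : Type w} (hS : #S < κ)
    (z : ℕ → S → N) : ∃ w : ℕ → S → N,
      (∀ φ : L.Formula (S ⊕ S), ∀ i j k l, i < j → k < l →
        (φ.Realize (Sum.elim (w i) (w j)) ↔ φ.Realize (Sum.elim (w k) (w l)))) ∧
      ∀ φ : L.Formula (ℕ × S), (∀ f : ℕ → ℕ, StrictMono f → φ.Realize fun p => z (f p.1) p.2) →
        φ.Realize fun p => w p.1 p.2 := by
  classical
  choose f hf hc using exists_homogeneous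
    (fun (φ : L.Formula (S ⊕ S)) i j => φ.Realize (Sum.elim (z i) (z j)))
  obtain ⟨w, hw⟩ := hM.realize_seq (atTop : Filter (Finset (L.Formula (S ⊕ S)))) hS
    fun Δ n => z (f Δ n)
  refine ⟨w, fun φ => ?_, fun φ hφ => hw φ (Eventually.of_forall fun Δ => hφ _ (hf Δ))⟩
  have h1 : ∀ φ : L.Formula (S ⊕ S), (∀ᶠ a in (hyperfilter ℕ : Filter ℕ),
      ∀ᶠ b in (hyperfilter ℕ : Filter ℕ), φ.Realize (Sum.elim (z a) (z b))) →
      ∀ i j, i < j → φ.Realize (Sum.elim (w i) (w j)) := by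
    intro φ hφ i j hij
    have := hw (φ.relabel (Sum.elim (fun s => (i, s)) fun s => (j, s))) (by
      filter_upwards [eventually_ge_atTop {φ}] with Δ hΔ
      rw [Formula.realize_relabel]
      have := (hc Δ φ (Finset.singleton_subset_iff.1 hΔ) i j hij).2 hφ
      convert this using 1
      funext x
      rcases x with x | x <;> rfl)
    rw [Formula.realize_relabel] at this
    convert this using 1
    funext x
    rcases x with x | x <;> rfl
  by_cases h : ∀ᶠ a in (hyperfilter ℕ : Filter ℕ), ∀ᶠ b in (hyperfilter ℕ : Filter ℕ),
      φ.Realize (Sum.elim (z a) (z b))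
  · exact fun i j k l hij hkl => iff_of_true (h1 φ h i j hij) (h1 φ h k l hkl)
  · have h2 : ∀ i j, i < j → ¬ φ.Realize (Sum.elim (w i) (w j)) := by
      intro i j hij
      have := h1 (∼φ) (by
        rw [← Ultrafilter.eventually_not] at h
        filter_upwards [h] with a ha
        rw [← Ultrafilter.eventually_not] at ha
        filter_upwards [ha] with b hb
        rwa [Formula.realize_not]) i j hij
      rwa [Formula.realize_not] at this
    exact fun i j k l hij hkl => iff_of_false (h2 i j hij) (h2 k l hkl)

/-- Strictly increasing subsequences of an indiscernible sequence satisfy the same formulas. -/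
theorem Indiscernible.realize_subsequence {C : Set N} {ι : Type*} {b : ℕ → ι → N}
    (hb : Indiscernible L C b) (φ : L.Formula (C ⊕ (ℕ × ι))) {f : ℕ → ℕ} (hf : StrictMono f) :
    φ.Realize (Sum.elim Subtype.val fun p : ℕ × ι => b (f p.1) p.2) ↔
      φ.Realize (Sum.elim Subtype.val fun p : ℕ × ι => b p.1 p.2) := by
  classical
  -- Only finitely many positions of the sequence occur in `φ`, all at most `K`. Reducing indices
  -- modulo `K + 1` therefore does not change the ones that matter.
  let K := φ.freeVarFinset.sup (Sum.elim (fun _ => 0) Prod.fst)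
  have hK : ∀ i x, (Sum.inr (i, x) : C ⊕ (ℕ × ι)) ∈ φ.freeVarFinset → i < K + 1 := fun i x h =>
    Nat.lt_succ_of_le (Finset.le_sup (f := Sum.elim (fun _ => 0) Prod.fst) h)
  let r : C ⊕ (ℕ × ι) → C ⊕ (Fin (K + 1) × ι) := Sum.map id fun p => (Fin.ofNat (K + 1) p.1, p.2)
  have key : ∀ e : ℕ → ℕ, φ.Realize (Sum.elim Subtype.val fun p : ℕ × ι => b (e p.1) p.2) ↔
      (φ.relabel r).Realize
        (Sum.elim Subtype.val fun p : Fin (K + 1) × ι => b (e p.1) p.2) := by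
    intro e
    rw [Formula.realize_relabel]
    refine realize_congr_freeVar φ ?_
    rintro (x | ⟨i, x⟩) h
    · rfl
    · simp [r, Nat.mod_eq_of_lt (hK i x h)]
  rw [key f, key fun i => i]
  exact sameType_iff.1 (hb (K + 1) (fun i => f i) (fun i => i)
    (fun i j h => hf h) (fun i j h => h)) _

end Indiscernibles

end IndepRel

/-! ### Coloured bipartite graphs: freeness, completeness and closure. -/

namespace Incidence

/-- A bipartite graph with a fixed colouring of its vertices. -/
structure BiGraph (V : Type*) where
  col : V → Bool
  Adj : V → V → Prop
  symm : ∀ {x y}, Adj x y → Adj y x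
  ne : ∀ {x y}, Adj x y → col x ≠ col y

namespace BiGraph

section Basic

variable {V W : Type*} (G : BiGraph V) (H : BiGraph W) (N : Bool → ℕ)

theorem col_eq_not {x y : V} (h : G.Adj x y) : G.col y = !G.col x := by
  have := G.ne h
  cases hx : G.col x <;> cases hy : G.col y <;> simp_all

/-- `P` and `Q` form a forbidden complete bipartite graph, `Q` consisting of vertices of
colour `c`. -/
def Full (c : Bool) (P Q : Finset V) : Prop :=
  (∀ q ∈ Q, G.col q = c) ∧ P.card = N c ∧ Q.card = N (!c) ∧ ∀ p ∈ P, ∀ q ∈ Q, G.Adj q p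

/-- There is no forbidden complete bipartite graph inside `Z`. -/
def FreeOn (Z : Set V) : Prop :=
  ∀ c (P Q : Finset V), ↑P ⊆ Z → ↑Q ⊆ Z → ¬ G.Full N c P Q

/-- There is no forbidden complete bipartite graph. -/
def Free : Prop := ∀ c (P Q : Finset V), ¬ G.Full N c P Q

/-- Every `N c` vertices have all the common neighbours that freeness allows. -/
def Complete : Prop :=
  ∀ c (P : Finset V), P.card = N c → (∀ p ∈ P, G.col p = !c) →
    ∃ Q : Finset V, Q.card = N (!c) - 1 ∧ ∀ q ∈ Q, ∀ p ∈ P, G.Adj q p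

/-- The set `X` contains every vertex `x` with at least `N (col x)` neighbours in `X`. -/
def Closed (X : Set V) : Prop :=
  ∀ x (P : Finset V), ↑P ⊆ X → (∀ p ∈ P, G.Adj x p) → N (G.col x) ≤ P.card → x ∈ X

/-- The smallest closed set containing `X`. -/
def cl (X : Set V) : Set V := ⋂₀ {Z | G.Closed N Z ∧ X ⊆ Z}

/-- `f` is an isomorphism onto an induced subgraph. -/
structure IsEmb {V W : Type*} (G : BiGraph V) (H : BiGraph W) (f : V → W) : Prop where
  inj : Function.Injective f
  col : ∀ x, H.col (f x) = G.col x
  adj : ∀ x y, H.Adj (f x) (f y) ↔ G.Adj x y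

/-- The graph induced on a set of vertices. -/
@[simps] def induce (Z : Set V) : BiGraph Z where
  col x := G.col x
  Adj x y := G.Adj x y
  symm h := G.symm h
  ne h := G.ne h

variable {G H N}

theorem isEmb_val (Z : Set V) : IsEmb (G.induce Z) G Subtype.val :=
  ⟨Subtype.val_injective, fun _ => rfl, fun _ _ => Iff.rfl⟩

theorem IsEmb.comp {U : Type*} {F : BiGraph U} {f : V → W} {g : U → V} (hf : IsEmb G H f)
    (hg : IsEmb F G g) : IsEmb F H (f ∘ g) :=
  ⟨hf.inj.comp hg.inj, fun x => (hf.col _).trans (hg.col x),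
    fun x y => (hf.adj _ _).trans (hg.adj x y)⟩

theorem Full.swap (hN : ∀ c, 0 < N c) {c : Bool} {P Q : Finset V} (h : G.Full N c P Q) :
    G.Full N (!c) Q P := by
  obtain ⟨h1, h2, h3, h4⟩ := h
  obtain ⟨q, hq⟩ := Finset.card_pos.1 (h3 ▸ hN (!c))
  refine ⟨fun p hp => ?_, h3, by simpa using h2, fun q hq p hp => G.symm (h4 p hp q hq)⟩
  rw [G.col_eq_not (h4 p hp q hq), h1 q hq]

theorem Full.map {f : V → W} (hf : IsEmb G H f) {c : Bool} {P Q : Finset V}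
    (h : G.Full N c P Q) : H.Full N c (P.map ⟨f, hf.inj⟩) (Q.map ⟨f, hf.inj⟩) := by
  obtain ⟨h1, h2, h3, h4⟩ := h
  refine ⟨?_, by simpa using h2, by simpa using h3, ?_⟩
  · simp only [Finset.mem_map, Function.Embedding.coeFn_mk]
    rintro _ ⟨q, hq, rfl⟩
    rw [hf.col, h1 q hq]
  · simp only [Finset.mem_map, Function.Embedding.coeFn_mk]
    rintro _ ⟨p, hp, rfl⟩ _ ⟨q, hq, rfl⟩
    exact (hf.adj _ _).2 (h4 p hp q hq)

theorem Free.of_isEmb {f : V → W} (hf : IsEmb G H f) (hH : H.Free N) : G.Free N :=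
  fun _ _ _ h => hH _ _ _ (h.map hf)

theorem exists_map_eq {f : V → W} (hf : Function.Injective f) {P : Finset W}
    (hP : ↑P ⊆ Set.range f) : ∃ P' : Finset V, P'.map ⟨f, hf⟩ = P := by
  classical
  refine ⟨P.preimage f hf.injOn, ?_⟩
  ext x
  simp only [Finset.mem_map, Finset.mem_preimage, Function.Embedding.coeFn_mk]
  constructor
  · rintro ⟨y, hy, rfl⟩
    exact hy
  · intro hx
    obtain ⟨y, rfl⟩ := hP hx
    exact ⟨y, hx, rfl⟩

theorem Free.freeOn_range {f : V → W} (hf : IsEmb G H f) (hG : G.Free N) :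
    H.FreeOn N (Set.range f) := by
  rintro c P Q hP hQ ⟨h1, h2, h3, h4⟩
  obtain ⟨P, rfl⟩ := exists_map_eq hf.inj hP
  obtain ⟨Q, rfl⟩ := exists_map_eq hf.inj hQ
  simp only [Finset.mem_map, Function.Embedding.coeFn_mk, Finset.card_map] at h1 h2 h3 h4
  refine hG c P Q ⟨fun q hq => ?_, h2, h3, fun p hp q hq => ?_⟩
  · rw [← hf.col]
    exact h1 _ ⟨q, hq, rfl⟩
  · rw [← hf.adj]
    exact h4 _ ⟨p, hp, rfl⟩ _ ⟨q, hq, rfl⟩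

theorem FreeOn.induce {Z : Set V} (h : G.FreeOn N Z) : (G.induce Z).Free N := by
  intro c P Q hPQ
  refine h c _ _ ?_ ?_ (hPQ.map (isEmb_val Z)) <;>
  · intro x hx
    simp only [Finset.coe_map, Function.Embedding.coeFn_mk, Set.mem_image] at hx
    obtain ⟨y, -, rfl⟩ := hx
    exact y.2

theorem Closed.sInter {F : Set (Set V)} (h : ∀ X ∈ F, G.Closed N X) : G.Closed N (⋂₀ F) :=
  fun x P hP h1 h2 X hX => h X hX x P (fun _ hp => hP hp X hX) h1 h2

theorem Closed.inter {X Y : Set V} (hX : G.Closed N X) (hY : G.Closed N Y) :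
    G.Closed N (X ∩ Y) := fun x P hP h1 h2 =>
  ⟨hX x P (fun _ hp => (hP hp).1) h1 h2, hY x P (fun _ hp => (hP hp).2) h1 h2⟩

theorem cl_closed (X : Set V) : G.Closed N (G.cl N X) := Closed.sInter fun _ h => h.1

theorem subset_cl (X : Set V) : X ⊆ G.cl N X := fun _ hx _ hZ => hZ.2 hx

theorem cl_subset {X Z : Set V} (hZ : G.Closed N Z) (h : X ⊆ Z) : G.cl N X ⊆ Z :=
  Set.sInter_subset_of_mem ⟨hZ, h⟩

theorem cl_mono {X Y : Set V} (h : X ⊆ Y) : G.cl N X ⊆ G.cl N Y :=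
  cl_subset (cl_closed Y) (h.trans (subset_cl Y))

theorem Closed.cl_eq {X : Set V} (h : G.Closed N X) : G.cl N X = X :=
  (cl_subset h subset_rfl).antisymm (subset_cl X)

/-- A closed set contains each vertex adjacent to `N c` vertices of the set. -/
theorem Closed.card_lt {X : Set V} (h : G.Closed N X) {x : V} (hx : x ∉ X) {P : Finset V}
    (hP : ↑P ⊆ X) (hadj : ∀ p ∈ P, G.Adj x p) : P.card < N (G.col x) := by
  by_contra h'
  exact hx (h x P hP hadj (not_lt.1 h'))

/-- Take a vertex `x` outside the range with `N (col x)` neighbours inside. By completeness of `G`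
these neighbours already have the maximal number `N (!c) - 1` of common neighbours inside the range,
where `c` is the colour of `x`; adding `x` produces a forbidden graph in `H`. -/
theorem Complete.closed_range {f : V → W} (hN : ∀ c, 0 < N c) (hf : IsEmb G H f)
    (hG : G.Complete N) (hH : H.Free N) : H.Closed N (Set.range f) := by
  classical
  intro x P hP hadj hcard
  by_contra hx
  obtain ⟨P', hPP', hP'⟩ := Finset.exists_subset_card_eq hcard
  obtain ⟨R, rfl⟩ := exists_map_eq hf.inj
    ((Finset.coe_subset.2 hPP').trans hP)
  have hR : ∀ r ∈ R, H.Adj x (f r) := fun r hr => hadj _ (hPP' (Finset.mem_map_of_mem _ hr))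
  obtain ⟨Q, hQ1, hQ2⟩ := hG (H.col x) R (by simpa using hP') (fun r hr => by
    rw [← hf.col, H.col_eq_not (hR r hr)])
  obtain ⟨r, hr⟩ := Finset.card_pos.1 ((hN (H.col x)).trans_eq (by simpa using hP'.symm))
  refine hH (H.col x) (R.map ⟨f, hf.inj⟩) (insert x (Q.map ⟨f, hf.inj⟩)) ⟨?_, hP', ?_, ?_⟩
  · simp only [Finset.mem_insert, Finset.mem_map, Function.Embedding.coeFn_mk]
    rintro _ (rfl | ⟨q, hq, rfl⟩)
    · rfl
    · have h1 := H.col_eq_not (hR r hr)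
      have h2 := H.col_eq_not ((hf.adj _ _).2 (hQ2 q hq r hr))
      rw [h1] at h2
      simpa using h2.symm
  · rw [Finset.card_insert_of_notMem, Finset.card_map, hQ1]
    · have := hN (!H.col x)
      omega
    · simp only [Finset.mem_map, Function.Embedding.coeFn_mk]
      rintro ⟨q, -, rfl⟩
      exact hx ⟨q, rfl⟩
  · simp only [Finset.mem_insert, Finset.mem_map, Function.Embedding.coeFn_mk]
    rintro _ ⟨p, hp, rfl⟩ _ (rfl | ⟨q, hq, rfl⟩)
    · exact hR p hp
    · exact (hf.adj _ _).2 (hQ2 q hq p hp)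

/-- The common neighbours supplied by completeness of `G` have enough neighbours in `X` to belong to
it. -/
theorem Complete.induce {X : Set V} (hN : ∀ c, 0 < N c) (hG : G.Complete N)
    (hX : G.Closed N X) : (G.induce X).Complete N := by
  classical
  intro c P hP hcol
  obtain ⟨Q, hQ1, hQ2⟩ := hG c (P.map ⟨_, Subtype.val_injective⟩) (by simpa using hP) (by
    simp only [Finset.mem_map, Function.Embedding.coeFn_mk]
    rintro _ ⟨p, hp, rfl⟩
    exact hcol p hp)
  obtain ⟨r, hr⟩ := Finset.card_pos.1 ((hN c).trans_eq hP.symm)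
  have hQX : ↑Q ⊆ Set.range (Subtype.val : X → V) := by
    intro q hq
    rw [Subtype.range_coe]
    refine hX q (P.map ⟨_, Subtype.val_injective⟩) ?_ (hQ2 q hq) ?_
    · intro x hx
      simp only [Finset.coe_map, Function.Embedding.coeFn_mk, Set.mem_image] at hx
      obtain ⟨y, -, rfl⟩ := hx
      exact y.2
    · have h1 := G.col_eq_not (hQ2 q hq r.1 (Finset.mem_map_of_mem _ hr))
      have h2 : G.col r = !c := hcol r hr
      rw [h2, Bool.not_inj_iff] at h1
      rw [← h1]
      simp [hP]
  obtain ⟨Q, rfl⟩ := exists_map_eq Subtype.val_injective hQX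
  refine ⟨Q, by simpa using hQ1, fun q hq p hp => ?_⟩
  exact hQ2 q.1 (Finset.mem_map_of_mem _ hq) p.1 (Finset.mem_map_of_mem _ hp)

end Basic

/-! ### The free completion of a graph, built from terms. -/

section FreeCompletion

variable {V : Type u} (G : BiGraph V) (N : Bool → ℕ)

/-- Terms that name the vertices of the free completion of `G`: vertices of `G`, and new
neighbours of given `N c` vertices. -/
abbrev Term : Type u :=
  WType (α := V ⊕ (Bool × ℕ)) (Sum.elim (fun _ => Empty) fun p => Fin (N p.1))

variable {N} in
/-- The vertices of `G` as terms. -/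
def base (v : V) : Term (V := V) N := WType.mk (Sum.inl v) (fun e : Empty => e.elim)

variable {N} in
/-- The `i`-th new vertex of colour `c` adjacent to the vertices `P`. -/
def new (c : Bool) (i : ℕ) (P : Fin (N c) → Term (V := V) N) : Term (V := V) N :=
  WType.mk (Sum.inr (c, i)) P

variable {N} in
theorem term_cases (x : Term (V := V) N) : (∃ v, x = base v) ∨ ∃ c i P, x = new c i P := by
  rcases x with ⟨v | ⟨c, i⟩, f⟩
  · left
    refine ⟨v, ?_⟩
    have : f = fun e : Empty => e.elim := funext fun e => e.elim
    rw [this]; rfl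
  · exact Or.inr ⟨c, i, f, rfl⟩

variable {N} in
theorem base_injective : Function.Injective (base : V → Term (V := V) N) := by
  intro v v' h
  have := congrArg (fun x : Term (V := V) N => match x with | ⟨a, _⟩ => a) h
  exact Sum.inl_injective this

variable {N} in
theorem base_ne_new (v : V) (c : Bool) (i : ℕ) (P : Fin (N c) → Term (V := V) N) :
    base v ≠ new c i P := by
  intro h
  have := congrArg (fun x : Term (V := V) N => match x with | ⟨a, _⟩ => a) h
  exact Sum.inl_ne_inr this

variable {N} in
theorem new_index_injective {c : Bool} {i j : ℕ} {P : Fin (N c) → Term (V := V) N}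
    (h : new c i P = new c j P) : i = j := by
  have := congrArg (fun x : Term (V := V) N => match x with | ⟨a, _⟩ => a) h
  exact (Prod.mk.inj (Sum.inr_injective this)).2

/-- The vertices on which a term depends. -/
def preds : Term (V := V) N → Set (Term (V := V) N)
  | ⟨Sum.inl _, _⟩ => ∅
  | ⟨Sum.inr _, P⟩ => Set.range P

/-- The colour of a term. -/
def termCol : Term (V := V) N → Bool
  | ⟨Sum.inl v, _⟩ => G.col v
  | ⟨Sum.inr (c, _), _⟩ => c

@[simp] theorem preds_base (v : V) : preds N (base v) = ∅ := rfl

@[simp] theorem preds_new (c : Bool) (i : ℕ) (P : Fin (N c) → Term (V := V) N) :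
    preds N (new c i P) = Set.range P := rfl

@[simp] theorem termCol_base (v : V) : termCol G N (base v) = G.col v := rfl

@[simp] theorem termCol_new (c : Bool) (i : ℕ) (P : Fin (N c) → Term (V := V) N) :
    termCol G N (new c i P) = c := rfl

/-- The graph on all terms. -/
def termGraph : BiGraph (Term (V := V) N) where
  col := termCol G N
  -- The colours are compared separately because an arbitrary term may depend on terms of its own
  -- colour. In sets satisfying `GoodTerms` dependence always changes the colour.
  Adj x y := termCol G N x ≠ termCol G N y ∧
    ((∃ v v', x = base v ∧ y = base v' ∧ G.Adj v v') ∨ x ∈ preds N y ∨ y ∈ preds N x)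
  symm := by
    rintro x y ⟨h1, h2⟩
    refine ⟨h1.symm, ?_⟩
    rcases h2 with ⟨v, v', h, h', h''⟩ | h | h
    · exact Or.inl ⟨v', v, h', h, G.symm h''⟩
    · exact Or.inr (Or.inr h)
    · exact Or.inr (Or.inl h)
  ne h := h.1

theorem isEmb_base : IsEmb G (termGraph G N) base := by
  refine ⟨base_injective, fun _ => rfl, fun x y => ⟨?_, fun h => ⟨G.ne h, Or.inl ⟨x, y, rfl, rfl, h⟩⟩⟩⟩
  rintro ⟨-, ⟨v, v', h, h', h''⟩ | h | h⟩
  · rwa [base_injective h, base_injective h']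
  · simp at h
  · simp at h

/-- A set of terms that contains `G`, is closed under dependence and has no forbidden
complete bipartite graph. -/
structure GoodTerms (Z : Set (Term (V := V) N)) : Prop where
  base : ∀ v, base v ∈ Z
  new : ∀ c i P, new c i P ∈ Z → Function.Injective P ∧ ∀ j, P j ∈ Z ∧ termCol G N (P j) = !c
  free : (termGraph G N).FreeOn N Z

variable {G N}

/-- All three conditions have finite character, a forbidden graph being finite, so Zorn's lemma
applies above the set of base terms. -/
theorem exists_maximal_goodTerms (hG : G.Free N) :
    ∃ Z : Set (Term (V := V) N), Maximal (GoodTerms G N) Z := by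
  have h0 : GoodTerms G N (Set.range base) := by
    refine ⟨fun v => ⟨v, rfl⟩, ?_, hG.freeOn_range (isEmb_base G N)⟩
    rintro c i P ⟨v, hv⟩
    exact (base_ne_new _ _ _ _ hv).elim
  obtain ⟨Z, -, hZ⟩ := zorn_subset_nonempty {Z | GoodTerms G N Z} (by
    intro F hF hchain hne
    refine ⟨⋃₀ F, ⟨?_, ?_, ?_⟩, fun s hs => Set.subset_sUnion_of_mem hs⟩
    · obtain ⟨Z, hZ⟩ := hne
      exact fun v => ⟨Z, hZ, (hF hZ).base v⟩
    · rintro c i P ⟨Z, hZ, hP⟩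
      have := (hF hZ).new c i P hP
      exact ⟨this.1, fun j => ⟨⟨Z, hZ, (this.2 j).1⟩, (this.2 j).2⟩⟩
    · classical
      intro c P Q hP hQ h
      obtain ⟨Z, hZ, hPZ⟩ := DirectedOn.exists_mem_subset_of_finset_subset_biUnion
        (f := id) hne (hchain.directedOn) (s := P ∪ Q) (by
          rw [show ⋃ i ∈ F, id i = ⋃₀ F from Set.sUnion_eq_biUnion.symm, Finset.coe_union]
          exact Set.union_subset hP hQ)
      rw [Finset.coe_union] at hPZ
      exact (hF hZ).free c P Q (Set.subset_union_left.trans hPZ)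
        (Set.subset_union_right.trans hPZ) h) _ h0
  exact ⟨Z, hZ⟩

/-- Adding a new common neighbour of a set of vertices that has few of them. -/
theorem GoodTerms.insert (hN : ∀ c, 0 < N c) {Z : Set (Term (V := V) N)} (hZ : GoodTerms G N Z)
    {c : Bool} {i : ℕ} {P : Fin (N c) → Term (V := V) N} (hP : Function.Injective P)
    (hPZ : ∀ j, P j ∈ Z ∧ termCol G N (P j) = !c) (hnew : BiGraph.new c i P ∉ Z)
    (hfew : ∀ Q : Finset (Term (V := V) N), ↑Q ⊆ Z → Q.card = N (!c) - 1 →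
      ¬ ∀ q ∈ Q, ∀ j, (termGraph G N).Adj q (P j)) :
    GoodTerms G N (insert (BiGraph.new c i P) Z) := by
  classical
  set x := BiGraph.new c i P with hx
  have hpreds : ∀ y ∈ Z, x ∉ preds N y := by
    intro y hy hxy
    rcases term_cases y with ⟨v, rfl⟩ | ⟨c', i', P', rfl⟩
    · simp at hxy
    · obtain ⟨j, hj⟩ := hxy
      exact hnew (hj ▸ ((hZ.new _ _ _ hy).2 j).1)
  -- No term of `Z` depends on `x`, so the neighbours of `x` are among the entries of `P`. In a
  -- forbidden graph through `x` the opposite side must then be all of `P`, and the other vertices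
  -- on the side of `x` are the `N (!c) - 1` common neighbours excluded by `hfew`.
  have hnbr : ∀ y ∈ Insert.insert x Z, (termGraph G N).Adj x y → y ∈ Set.range P := by
    rintro y (rfl | hy) ⟨h1, h2⟩
    · exact (h1 rfl).elim
    · rcases h2 with ⟨v, v', h, -⟩ | h | h
      · exact (base_ne_new _ _ _ _ h.symm).elim
      · exact (hpreds y hy h).elim
      · exact h
  refine ⟨fun v => Or.inr (hZ.base v), ?_, ?_⟩
  · rintro c' i' P' (h | h)
    · have : (⟨c', i', P'⟩ : Σ c : Bool, ℕ × (Fin (N c) → Term (V := V) N)) = ⟨c, i, P⟩ := by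
        rw [hx] at h
        simp only [BiGraph.new] at h
        injection h with h1 h2
        have h3 := Sum.inr_injective h1
        obtain ⟨rfl, rfl⟩ := Prod.mk.inj h3
        rw [eq_of_heq h2]
      obtain ⟨rfl, h2⟩ := Sigma.mk.inj this
      obtain ⟨rfl, rfl⟩ := Prod.mk.inj (eq_of_heq h2)
      exact ⟨hP, fun j => ⟨Or.inr (hPZ j).1, (hPZ j).2⟩⟩
    · have := hZ.new c' i' P' h
      exact ⟨this.1, fun j => ⟨Or.inr (this.2 j).1, (this.2 j).2⟩⟩
  · have key : ∀ c' (P' Q' : Finset (Term (V := V) N)), ↑P' ⊆ Insert.insert x Z →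
        ↑Q' ⊆ Insert.insert x Z → (termGraph G N).Full N c' P' Q' → x ∉ Q' := by
      rintro c' P' Q' hP' hQ' ⟨h1, h2, h3, h4⟩ hxQ
      obtain rfl : c = c' := h1 x hxQ
      have hsub : P' ⊆ Finset.univ.image P := fun p hp => by
        have := hnbr p (hP' hp) (h4 p hp x hxQ)
        simpa using this
      have heq : P' = Finset.univ.image P := Finset.eq_of_subset_of_card_le hsub (by
        rw [Finset.card_image_of_injective _ hP, h2]; simp)
      refine hfew (Q'.erase x) ?_ ?_ ?_
      · intro q hq
        rw [Finset.coe_erase] at hq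
        exact (hQ' hq.1).resolve_left hq.2
      · rw [Finset.card_erase_of_mem hxQ, h3]
      · intro q hq j
        exact h4 (P j) (by rw [heq]; simp) q (Finset.mem_of_mem_erase hq)
    intro c' P' Q' hP' hQ' h
    have h1 := key c' P' Q' hP' hQ' h
    have h2 := key _ Q' P' hQ' hP' (h.swap hN)
    exact hZ.free c' P' Q' (fun p hp => (hP' hp).resolve_left fun e => h2 (e ▸ hp))
      (fun q hq => (hQ' hq).resolve_left fun e => h1 (e ▸ hq)) h

/-- If some `P` had too few common neighbours, then by maximality every term `new c i P'`, with `P'`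
an enumeration of `P`, would already lie in `Z`. Letting the index `i` vary gives as many common
neighbours as desired. -/
theorem complete_of_maximal (hN : ∀ c, 0 < N c) {Z : Set (Term (V := V) N)}
    (hZ : Maximal (GoodTerms G N) Z) : ((termGraph G N).induce Z).Complete N := by
  classical
  intro c P hP hcol
  by_contra hno
  let e : Fin (N c) ≃ P := (Fintype.equivFinOfCardEq (by simpa using hP)).symm
  let P' : Fin (N c) → Term (V := V) N := fun j => (e j).1.1
  have hP' : Function.Injective P' :=
    Subtype.val_injective.comp (Subtype.val_injective.comp e.injective)
  have hmem : ∀ p ∈ P, ∃ j, P' j = p.1 := fun p hp => ⟨e.symm ⟨p, hp⟩, by simp [P']⟩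
  have hPZ : ∀ j, P' j ∈ Z ∧ termCol G N (P' j) = !c := fun j => ⟨(e j).1.2, hcol _ (e j).2⟩
  have hfew : ∀ Q : Finset (Term (V := V) N), ↑Q ⊆ Z → Q.card = N (!c) - 1 →
      ¬ ∀ q ∈ Q, ∀ j, (termGraph G N).Adj q (P' j) := by
    intro Q hQ hcard hadj
    obtain ⟨R, rfl⟩ := exists_map_eq (Subtype.val_injective : Function.Injective
      (Subtype.val : Z → Term (V := V) N)) (P := Q) (by rwa [Subtype.range_coe])
    refine hno ⟨R, by simpa using hcard, fun q hq p hp => ?_⟩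
    obtain ⟨j, hj⟩ := hmem p hp
    have := hadj q.1 (Finset.mem_map_of_mem _ hq) j
    rw [hj] at this
    exact this
  have hall : ∀ i, new c i P' ∈ Z := by
    intro i
    by_contra hi
    have := hZ.prop.insert hN hP' hPZ hi hfew
    exact hi (hZ.le_of_ge this (Set.subset_insert _ _) (Set.mem_insert _ _))
  refine hfew ((Finset.range (N (!c) - 1)).image fun i => new c i P') ?_ ?_ ?_
  · intro x hx
    simp only [Finset.coe_image, Set.mem_image] at hx
    obtain ⟨i, -, rfl⟩ := hx
    exact hall i
  · rw [Finset.card_image_of_injective _ fun i j h => new_index_injective h, Finset.card_range]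
  · intro q hq j
    simp only [Finset.mem_image] at hq
    obtain ⟨i, -, rfl⟩ := hq
    refine ⟨?_, Or.inr (Or.inr ⟨j, rfl⟩)⟩
    rw [(hPZ j).2, termCol_new]
    simp

/-- The terms all of whose base vertices lie in `S`. -/
inductive TermOver (S : Set V) : Term (V := V) N → Prop
  | base (v : V) (h : v ∈ S) : TermOver S (base v)
  | new (c : Bool) (i : ℕ) (P : Fin (N c) → Term (V := V) N) (h : ∀ j, TermOver S (P j)) :
      TermOver S (new c i P)

theorem TermOver.of_preds {S : Set V} {x y : Term (V := V) N} (h : TermOver S x)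
    (hy : y ∈ preds N x) : TermOver S y := by
  cases h with
  | base v h => simp at hy
  | new c i P h =>
    obtain ⟨j, rfl⟩ := hy
    exact h j

theorem termOver_base {S : Set V} {v : V} : TermOver S (base v : Term (V := V) N) ↔ v ∈ S := by
  refine ⟨fun h => ?_, TermOver.base v⟩
  generalize hx : (BiGraph.base v : Term (V := V) N) = x at h
  cases h with
  | base v' h => rwa [base_injective hx]
  | new c i P h => exact (base_ne_new _ _ _ _ hx).elim

/-- The last clause expresses freeness. For closed `S`, the terms over `S` form a closed set that
meets the image of `V` only in the image of `S`, and a new vertex among them is adjacent only to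
vertices it was built from. This is what later allows closures in the completion to be controlled by
closed sets of the original graph. -/
theorem exists_freeCompletion (hN : ∀ c, 0 < N c) (hG : G.Free N) :
    ∃ (W : Type u) (H : BiGraph W) (i : V → W), IsEmb G H i ∧ H.Free N ∧ H.Complete N ∧
      #W ≤ max #V ℵ₀ ∧ ∀ S, G.Closed N S → ∃ T, H.Closed N T ∧ (∀ v, i v ∈ T ↔ v ∈ S) ∧
        ∀ t ∈ T, (∀ s ∈ S, t ≠ i s) → ∀ v, H.Adj t (i v) → v ∈ S := by
  classical
  obtain ⟨Z, hZ⟩ := exists_maximal_goodTerms hG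
  have hgood := hZ.prop
  refine ⟨Z, (termGraph G N).induce Z, fun v => ⟨base v, hgood.base v⟩, ?_,
    hgood.free.induce, complete_of_maximal hN hZ, ?_, ?_⟩
  · have := isEmb_base G N
    exact ⟨fun v v' h => base_injective (congrArg Subtype.val h), this.col, this.adj⟩
  · have : ∀ a : V ⊕ (Bool × ℕ), Finite (Sum.elim (fun _ => Empty) (fun p => Fin (N p.1)) a) := by
      rintro (v | p)
      · exact inferInstanceAs (Finite Empty)
      · exact inferInstanceAs (Finite (Fin _))
    refine (mk_set_le Z).trans ((WType.cardinalMk_le_max_aleph0_of_finite').trans ?_)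
    refine max_le ?_ (le_max_right _ _)
    rw [mk_sum]
    simp only [lift_uzero]
    have h1 : lift.{u} #(Bool × ℕ) ≤ ℵ₀ := lift_le_aleph0.2 mk_le_aleph0
    exact (add_le_add_right h1 _).trans ((add_le_max _ _).trans (by simp))
  · intro S hS
    refine ⟨{x | TermOver S x.1}, ?_, fun v => termOver_base, ?_⟩
    · rintro ⟨x, hxZ⟩ P hP hadj hcard
      by_contra hx
      have hx : ¬ TermOver S x := hx
      -- If a term over `S` depended on `x`, then `x` itself would be over `S`. So edges from `x` to
      -- `P` either lie in the base graph or go to vertices on which `x` depends.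
      have hsucc : ∀ p ∈ P, x ∉ preds N p.1 := fun p hp h => hx ((hP hp : TermOver S p.1).of_preds h)
      rcases term_cases x with ⟨v, rfl⟩ | ⟨c, i, R, rfl⟩
      · have hP1 : ↑(P.map ⟨_, Subtype.val_injective⟩) ⊆ Set.range (base (N := N) (V := V)) := by
          intro y hy
          simp only [Finset.coe_map, Function.Embedding.coeFn_mk, Set.mem_image] at hy
          obtain ⟨p, hp, rfl⟩ := hy
          rcases (hadj p hp).2 with ⟨v, v', h, h', h''⟩ | h | h
          · exact ⟨v', h'.symm⟩
          · exact (hsucc p hp h).elim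
          · simp at h
        obtain ⟨Q, hQ⟩ := exists_map_eq base_injective hP1
        have hQ' : ∀ q ∈ Q, ∃ p ∈ P, p.1 = base q := by
          intro q hq
          have : base q ∈ P.map ⟨_, Subtype.val_injective⟩ := hQ ▸ Finset.mem_map_of_mem _ hq
          simpa using this
        refine hx (TermOver.base v (hS v Q ?_ ?_ ?_))
        · intro q hq
          obtain ⟨p, hp, h⟩ := hQ' q hq
          have h1 : TermOver S p.1 := hP hp
          rw [h] at h1
          exact termOver_base.1 h1
        · intro q hq
          obtain ⟨p, hp, h⟩ := hQ' q hq
          have h1 : (termGraph G N).Adj (base v) p.1 := hadj p hp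
          rw [h] at h1
          exact ((isEmb_base G N).adj v q).1 h1
        · have h1 := congrArg Finset.card hQ
          simp only [Finset.card_map] at h1
          rw [h1]
          exact hcard
      · have hsub : P.map ⟨_, Subtype.val_injective⟩ ⊆ Finset.univ.image R := by
          intro y hy
          simp only [Finset.mem_map, Function.Embedding.coeFn_mk] at hy
          obtain ⟨p, hp, rfl⟩ := hy
          rcases (hadj p hp).2 with ⟨v, v', h, h', h''⟩ | h | h
          · exact (base_ne_new _ _ _ _ h.symm).elim
          · exact (hsucc p hp h).elim
          · simpa using h
        -- A new vertex depends on exactly `N c` positions, so having `N c` neighbours among its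
        -- predecessors means having all of them: the whole term is over `S`.
        have heq := Finset.eq_of_subset_of_card_le hsub (by
          refine Finset.card_image_le.trans ?_
          have h1 : N c ≤ P.card := hcard
          simpa using h1)
        refine hx (TermOver.new c i R fun j => ?_)
        have h1 : R j ∈ P.map ⟨_, Subtype.val_injective⟩ := by rw [heq]; simp
        simp only [Finset.mem_map, Function.Embedding.coeFn_mk] at h1
        obtain ⟨p, hp, h2⟩ := h1
        rw [← h2]
        exact hP hp
    · rintro ⟨x, hxZ⟩ hx hxS v hadj
      have hx : TermOver S x := hx
      cases hx with
      | base v' h => exact (hxS v' h rfl).elim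
      | new c i P h =>
        rcases hadj.2 with ⟨v, v', h1, -⟩ | h1 | h1
        · exact (base_ne_new _ _ _ _ h1.symm).elim
        · simp at h1
        · obtain ⟨j, hj⟩ := h1
          have := h j
          rw [hj] at this
          exact termOver_base.1 this

end FreeCompletion

end BiGraph

end Incidence

/-! ### Incidence structures as bipartite graphs, and the graph-theoretic content of the axioms. -/

namespace Incidence

open FirstOrder.Language Filter

section Semantics

theorem realize_forAll {β : Type} [Finite β] {V : Type*} [lang.Structure V]
    (φ : lang.Formula β) : V ⊨ forAll φ ↔ ∀ v : β → V, φ.Realize v := by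
  have h : ∀ v : β → V, (Sum.elim (default : Empty → V) v) ∘ (Sum.inr : β → Empty ⊕ β) = v :=
    fun v => rfl
  rw [forAll, Sentence.Realize, Formula.realize_iAlls]
  refine forall_congr' fun v => ?_
  rw [Formula.realize_relabel, ← h v]
  rfl

variable {α : Type*} {V : Type*} [lang.Structure V]

@[simp] theorem realize_pointF (a : α) (v : α → V) : (pointF a).Realize v ↔ IsPoint (v a) := by
  simp [pointF, IsPoint]

@[simp] theorem realize_lineF (a : α) (v : α → V) : (lineF a).Realize v ↔ IsLine (v a) := by
  simp [lineF, IsLine]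

@[simp] theorem realize_incF (a b : α) (v : α → V) :
    (incF a b).Realize v ↔ Inc (v a) (v b) := by
  simp [incF, Inc]

@[simp] theorem realize_eqF (a b : α) (v : α → V) : (eqF a b).Realize v ↔ v a = v b := by
  simp [eqF]

@[simp] theorem realize_literal (p : Prop) (φ : lang.Formula α) (v : α → V) :
    (literal p φ).Realize v ↔ (φ.Realize v ↔ p) := by
  unfold literal
  split_ifs with h <;> simp [h]

@[simp] theorem realize_distinctF {ι : Type} [Finite ι] (f : ι → α) (v : α → V) :
    (distinctF f).Realize v ↔ Function.Injective fun i => v (f i) := by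
  simp only [distinctF, Formula.realize_iInf, Formula.realize_not, realize_eqF, Subtype.forall,
    Prod.forall]
  exact ⟨fun h i j hij => by_contra fun hne => h i j hne hij, fun h i j hne hij => hne (h hij)⟩

theorem realize_diagram {W U : Type} [Finite W] [lang.Structure U] (e : W → U) (v : W → V) :
    (diagram e).Realize v ↔ (∀ x, (IsPoint (v x) ↔ IsPoint (e x)) ∧
      (IsLine (v x) ↔ IsLine (e x))) ∧ ∀ x y, (Inc (v x) (v y) ↔ Inc (e x) (e y)) ∧
        (v x = v y ↔ e x = e y) := by
  simp only [diagram, Formula.realize_inf, Formula.realize_iInf, realize_literal, realize_pointF,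
    realize_lineF, realize_incF, realize_eqF, Prod.forall]

end Semantics

/-- The number of neighbours that determine a vertex up to finitely many choices: `n` lines for a
point, `m` points for a line. -/
def threshold (m n : ℕ) : Bool → ℕ := fun c => if c then n else m

theorem threshold_pos {m n : ℕ} (hm : 1 ≤ m) (hn : 1 ≤ n) (c : Bool) : 0 < threshold m n c := by
  cases c
  · exact hm
  · exact hn

section GraphOf

variable (V : Type*) [lang.Structure V]

/-- The axioms of incidence structures. -/
structure IsIncidence : Prop where
  partition : ∀ x : V, IsPoint x ↔ ¬ IsLine x
  inc : ∀ x y : V, Inc x y → IsPoint x ∧ IsLine y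

variable {V}

theorem isIncidence_iff : (V ⊨ partitionAxiom ∧ V ⊨ incAxiom) ↔ IsIncidence V := by
  simp only [partitionAxiom, incAxiom, realize_forAll, Formula.realize_iff, Formula.realize_not,
    realize_pointF, realize_lineF, Formula.realize_imp, realize_incF, Formula.realize_inf]
  constructor
  · rintro ⟨h1, h2⟩
    exact ⟨fun x => h1 fun _ => x, fun x y => by simpa using h2 ![x, y]⟩
  · rintro ⟨h1, h2⟩
    exact ⟨fun v => h1 _, fun v => h2 _ _⟩

open Classical in
/-- The bipartite graph of an incidence structure; points have colour `true`. -/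
noncomputable def graphOf (h : IsIncidence V) : BiGraph V where
  col x := decide (IsPoint x)
  Adj x y := Inc x y ∨ Inc y x
  symm := Or.symm
  ne := by
    rintro x y (hxy | hxy)
    · have h1 := h.inc _ _ hxy
      have h2 : ¬ IsPoint y := fun hy => (h.partition y).1 hy h1.2
      simp [h1.1, h2]
    · have h1 := h.inc _ _ hxy
      have h2 : ¬ IsPoint x := fun hy => (h.partition x).1 hy h1.2
      simp [h1.1, h2]

theorem graphOf_col_true (h : IsIncidence V) (x : V) :
    (graphOf h).col x = true ↔ IsPoint x := by simp [graphOf]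

theorem graphOf_col_false (h : IsIncidence V) (x : V) :
    (graphOf h).col x = false ↔ IsLine x := by simp [graphOf, h.partition x]

theorem graphOf_inc (h : IsIncidence V) (x y : V) :
    Inc x y ↔ (graphOf h).col x = true ∧ (graphOf h).Adj x y := by
  rw [graphOf_col_true]
  constructor
  · exact fun hxy => ⟨(h.inc _ _ hxy).1, Or.inl hxy⟩
  · rintro ⟨h1, h2 | h2⟩
    · exact h2
    · exact ((h.partition x).1 h1 (h.inc _ _ h2).2).elim

theorem BiGraph.free_iff {V : Type*} {G : BiGraph V} {m n : ℕ} (hm : 1 ≤ m) (hn : 1 ≤ n) :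
    G.Free (threshold m n) ↔ ∀ (f : Fin m → V) (g : Fin n → V), Function.Injective f →
      Function.Injective g → (∀ i, G.col (f i) = true) → ¬ ∀ i j, G.Adj (f i) (g j) := by
  classical
  constructor
  · intro h f g hf hg hcol hadj
    refine h true (Finset.univ.image g) (Finset.univ.image f) ⟨?_, ?_, ?_, ?_⟩
    · simpa using hcol
    · rw [Finset.card_image_of_injective _ hg]; simp [threshold]
    · rw [Finset.card_image_of_injective _ hf]; simp [threshold]
    · simpa using fun j i => hadj i j
  · intro h
    have key : ∀ P Q : Finset V, ¬ G.Full (threshold m n) true P Q := by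
      rintro P Q ⟨h1, h2, h3, h4⟩
      let f : Fin m ≃ Q := (Fintype.equivFinOfCardEq (by simpa [threshold] using h3)).symm
      let g : Fin n ≃ P := (Fintype.equivFinOfCardEq (by simpa [threshold] using h2)).symm
      exact h (fun i => f i) (fun j => g j) (Subtype.val_injective.comp f.injective)
        (Subtype.val_injective.comp g.injective) (fun i => h1 _ (f i).2)
        fun i j => h4 _ (g j).2 _ (f i).2
    rintro (_ | _) P Q hPQ
    · exact key Q P (hPQ.swap (threshold_pos hm hn))
    · exact key P Q hPQ

theorem realize_freeAxiom {m n : ℕ} (hm : 1 ≤ m) (hn : 1 ≤ n) (h : IsIncidence V) :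
    V ⊨ freeAxiom m n ↔ (graphOf h).Free (threshold m n) := by
  let _ := completeStructure m n
  have hp1 : ∀ i : Fin m, IsPoint (Sum.inl i : Fin m ⊕ Fin n) := fun i => ⟨i, rfl⟩
  have hp2 : ∀ j : Fin n, ¬ IsPoint (Sum.inr j : Fin m ⊕ Fin n) := by
    rintro j ⟨i, hi⟩
    exact Sum.inr_ne_inl hi
  have hl1 : ∀ i : Fin m, ¬ IsLine (Sum.inl i : Fin m ⊕ Fin n) := by
    rintro j ⟨i, hi⟩
    exact Sum.inl_ne_inr hi
  have hl2 : ∀ j : Fin n, IsLine (Sum.inr j : Fin m ⊕ Fin n) := fun j => ⟨j, rfl⟩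
  have hi : ∀ x y : Fin m ⊕ Fin n, Inc x y ↔ ∃ i j, x = Sum.inl i ∧ y = Sum.inr j :=
    fun x y => Iff.rfl
  rw [BiGraph.free_iff hm hn, freeAxiom, realize_forAll]
  constructor
  · intro hV f g hf hg hcol hadj
    have hline : ∀ j, IsLine (g j) := fun j => by
      have := (graphOf h).col_eq_not (hadj ⟨0, hm⟩ j)
      rw [hcol] at this
      exact (graphOf_col_false h _).1 this
    have hpoint : ∀ i, IsPoint (f i) := fun i => (graphOf_col_true h _).1 (hcol i)
    have hfl : ∀ i, ¬ IsLine (f i) := fun i => (h.partition _).1 (hpoint i)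
    have hgp : ∀ j, ¬ IsPoint (g j) := fun j hj => (h.partition _).1 hj (hline j)
    refine hV (Sum.elim f g) ((realize_diagram _ _).2 ⟨?_, ?_⟩)
    · rintro (i | j)
      · exact ⟨iff_of_true (hpoint i) (hp1 i), iff_of_false (hfl i) (hl1 i)⟩
      · exact ⟨iff_of_false (hgp j) (hp2 j), iff_of_true (hline j) (hl2 j)⟩
    · rintro (i | i) (j | j)
      · refine ⟨iff_of_false (fun h' => hfl j (h.inc _ _ h').2) ?_, ?_⟩
        · simp [hi]
        · simp [hf.eq_iff]
      · refine ⟨iff_of_true ((graphOf_inc h _ _).2 ⟨hcol i, hadj i j⟩) ?_, ?_⟩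
        · simp [hi]
        · simpa using fun h' : f i = g j => hfl i (h' ▸ hline j)
      · refine ⟨iff_of_false (fun h' => hgp i (h.inc _ _ h').1) ?_, ?_⟩
        · simp [hi]
        · simpa using fun h' : g i = f j => hgp i (h' ▸ hpoint j)
      · refine ⟨iff_of_false (fun h' => hgp i (h.inc _ _ h').1) ?_, ?_⟩
        · simp [hi]
        · simp [hg.eq_iff]
  · intro hV v hv
    obtain ⟨hv1, hv2⟩ := (realize_diagram _ _).1 hv
    refine hV (fun i => v (Sum.inl i)) (fun j => v (Sum.inr j)) ?_ ?_ ?_ ?_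
    · intro i j hij
      simpa using (hv2 _ _).2.1 hij
    · intro i j hij
      simpa using (hv2 _ _).2.1 hij
    · intro i
      exact (graphOf_col_true h _).2 ((hv1 _).1.2 (hp1 i))
    · intro i j
      exact Or.inl ((hv2 _ _).1.2 ((hi _ _).2 ⟨i, j, rfl, rfl⟩))

/-- A bipartite graph as an incidence structure. -/
def BiGraph.relMap {V : Type*} (G : BiGraph V) : ∀ {k : ℕ}, Symb k → (Fin k → V) → Prop
  | _, .point, z => G.col (z 0) = true
  | _, .line, z => G.col (z 0) = false
  | _, .inc, z => G.col (z 0) = true ∧ G.Adj (z 0) (z 1)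

/-- A bipartite graph as an incidence structure. -/
@[reducible] def BiGraph.toStructure {V : Type*} (G : BiGraph V) : lang.Structure V where
  funMap f := nomatch f
  RelMap r := G.relMap r

section ToStructure

variable {V : Type*} (G : BiGraph V)

theorem BiGraph.isIncidence : letI := G.toStructure; IsIncidence V := by
  let _ := G.toStructure
  refine ⟨fun x => ?_, fun x y h => ?_⟩
  · change G.col x = true ↔ ¬ G.col x = false
    simp
  · obtain ⟨h1, h2⟩ := (h : G.col x = true ∧ G.Adj x y)
    exact ⟨h1, (G.col_eq_not h2).trans (by rw [h1]; rfl)⟩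

theorem BiGraph.toStructure_models {m n : ℕ} (hm : 1 ≤ m) (hn : 1 ≤ n)
    (hG : G.Free (threshold m n)) : letI := G.toStructure; V ⊨ Tp m n := by
  let _ := G.toStructure
  have hinc : IsIncidence V := G.isIncidence
  have h3 : V ⊨ freeAxiom m n := by
    rw [realize_freeAxiom hm hn hinc, BiGraph.free_iff hm hn]
    intro f g hf hg hcol hadj
    have hcol' : ∀ i, G.col (f i) = true := fun i => (graphOf_col_true hinc _).1 (hcol i)
    refine (BiGraph.free_iff hm hn).1 hG f g hf hg hcol' fun i j => ?_
    exact ((graphOf_inc hinc _ _).2 ⟨hcol i, hadj i j⟩ : G.col (f i) = true ∧ _).2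
  obtain ⟨h1, h2⟩ := isIncidence_iff.2 hinc
  refine ⟨fun φ hφ => ?_⟩
  rcases hφ with rfl | rfl | rfl
  · exact h1
  · exact h2
  · exact h3

end ToStructure

end GraphOf

section Model

variable {m n : ℕ} {M : Type u} [lang.Structure M]

theorem isIncidence_of_models [M ⊨ T m n] : IsIncidence M := by
  refine isIncidence_iff.1 ⟨?_, ?_⟩ <;>
  refine Theory.realize_sentence_of_mem (T m n) ?_ <;>
  simp [T, Tc, Tp]

theorem free_of_models (hm : 1 ≤ m) (hn : 1 ≤ n) [M ⊨ T m n] (h : IsIncidence M) :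
    (graphOf h).Free (threshold m n) := by
  rw [← realize_freeAxiom hm hn]
  exact Theory.realize_sentence_of_mem (T m n) (by simp [T, Tc, Tp])

theorem complete_of_models [M ⊨ T m n] (h : IsIncidence M) :
    (graphOf h).Complete (threshold m n) := by
  classical
  have h1 : M ⊨ pointsAxiom m n := Theory.realize_sentence_of_mem (T m n) (by simp [T, Tc])
  have h2 : M ⊨ linesAxiom m n := Theory.realize_sentence_of_mem (T m n) (by simp [T, Tc])
  rw [pointsAxiom, realize_forAll] at h1
  rw [linesAxiom, realize_forAll] at h2
  simp only [Formula.realize_imp, Formula.realize_inf, realize_distinctF, Formula.realize_iInf,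
    Formula.realize_iExs, Formula.realize_iAlls, Formula.realize_iff, Formula.realize_iSup,
    realize_pointF, realize_lineF, realize_incF, realize_eqF, Sum.elim_inl, Sum.elim_inr,
    id_eq] at h1 h2
  rintro (_ | _) P hP hcol
  · let f : Fin m ≃ P := (Fintype.equivFinOfCardEq (by simpa [threshold] using hP)).symm
    have hf : Function.Injective fun i => (f i).1 := Subtype.val_injective.comp f.injective
    obtain ⟨g, hg, hg'⟩ := h1 (fun i => (f i).1)
      ⟨hf, fun i => (graphOf_col_true h _).1 (hcol _ (f i).2)⟩
    refine ⟨Finset.univ.image g, ?_, ?_⟩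
    · rw [Finset.card_image_of_injective _ hg]; simp [threshold]
    · intro q hq p hp
      obtain ⟨j, -, rfl⟩ := Finset.mem_image.1 hq
      have := ((hg' fun _ => g j).2 ⟨j, rfl⟩).2 (f.symm ⟨p, hp⟩)
      rw [Equiv.apply_symm_apply] at this
      exact Or.inr this
  · let f : Fin n ≃ P := (Fintype.equivFinOfCardEq (by simpa [threshold] using hP)).symm
    have hf : Function.Injective fun i => (f i).1 := Subtype.val_injective.comp f.injective
    obtain ⟨g, hg, hg'⟩ := h2 (fun i => (f i).1)
      ⟨hf, fun i => (graphOf_col_false h _).1 (hcol _ (f i).2)⟩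
    refine ⟨Finset.univ.image g, ?_, ?_⟩
    · rw [Finset.card_image_of_injective _ hg]; simp [threshold]
    · intro q hq p hp
      obtain ⟨j, -, rfl⟩ := Finset.mem_image.1 hq
      have := ((hg' fun _ => g j).2 ⟨j, rfl⟩).2 (f.symm ⟨p, hp⟩)
      rw [Equiv.apply_symm_apply] at this
      exact Or.inl this

/-- The graph obtained by pulling back along an injection. -/
@[simps] def BiGraph.comap {V W : Type*} (G : BiGraph V) (f : W → V) : BiGraph W where
  col x := G.col (f x)
  Adj x y := G.Adj (f x) (f y)
  symm h := G.symm h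
  ne h := G.ne h

theorem BiGraph.isEmb_comap {V W : Type*} (G : BiGraph V) {f : W → V}
    (hf : Function.Injective f) : BiGraph.IsEmb (G.comap f) G f :=
  ⟨hf, fun _ => rfl, fun _ _ => Iff.rfl⟩

/-- Finite pieces of an extension of a closed set can be realized in a model. -/
theorem exists_finite_extension (hm : 1 ≤ m) (hn : 1 ≤ n) [M ⊨ T m n] (hM : IsIncidence M) {V : Type*}
    (G : BiGraph V) (hG : G.Free (threshold m n)) (X : Set V) (hX : G.Closed (threshold m n) X) (e : V → M)
    (he : BiGraph.IsEmb (G.induce X) (graphOf hM) fun x => e x)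
    (Y : Finset V) :
    ∃ v : V → M, (∀ x ∈ Y, x ∈ X → v x = e x) ∧ ∀ x ∈ Y, ∀ y ∈ Y, (v x = v y ↔ x = y) ∧
      (graphOf hM).col (v x) = G.col x ∧
      ((graphOf hM).Adj (v x) (v y) ↔ G.Adj x y) := by
  classical
  let a := (Y.filter (· ∈ X)).equivFin.symm
  let b := (Y.filter (· ∉ X)).equivFin.symm
  set k := (Y.filter (· ∈ X)).card
  set l := (Y.filter (· ∉ X)).card
  have ha : ∀ i, (a i).1 ∈ Y ∧ (a i).1 ∈ X := fun i => Finset.mem_filter.1 (a i).2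
  have hb : ∀ i, (b i).1 ∈ Y ∧ (b i).1 ∉ X := fun i => Finset.mem_filter.1 (b i).2
  let g : Fin k ⊕ Fin l → V := Sum.elim (fun i => (a i).1) fun i => (b i).1
  have hg : Function.Injective g := by
    rintro (i | i) (j | j) hij
    · exact congrArg _ (a.injective (Subtype.ext hij))
    · have hij' : (a i).1 = (b j).1 := hij
      exact ((hb j).2 (hij' ▸ (ha i).2)).elim
    · have hij' : (b i).1 = (a j).1 := hij
      exact ((hb i).2 (hij' ▸ (ha j).2)).elim
    · exact congrArg _ (b.injective (Subtype.ext hij))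
  let G' := G.comap g
  let _ := G'.toStructure
  have hG'p : ∀ x : Fin k ⊕ Fin l, IsPoint x ↔ G.col (g x) = true := fun x => Iff.rfl
  have hG'l : ∀ x : Fin k ⊕ Fin l, IsLine x ↔ G.col (g x) = false := fun x => Iff.rfl
  have hG'i : ∀ x y : Fin k ⊕ Fin l, Inc x y ↔ G.col (g x) = true ∧ G.Adj (g x) (g y) :=
    fun x y => Iff.rfl
  -- Safety is what closedness of `X` provides: a vertex outside `X` has fewer than `N` neighbours
  -- inside, where `N` is the threshold of its colour.
  have hsafe : IsSafe m n k l G'.toStructure := by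
    have hcount : ∀ (y : Fin l) (R : Set (Fin k)), (∀ x ∈ R, G.Adj (b y) (a x)) →
        R.ncard ≤ threshold m n (G.col (b y)) - 1 := by
      intro y R hR
      have := hX.card_lt (hb y).2 (P := R.toFinite.toFinset.image fun x => (a x).1) (by
        intro x hx
        simp only [Finset.coe_image, Set.mem_image] at hx
        obtain ⟨i, -, rfl⟩ := hx
        exact (ha i).2) (by
        intro p hp
        obtain ⟨i, hi, rfl⟩ := Finset.mem_image.1 hp
        exact hR i (by simpa using hi))
      have hinj : Function.Injective fun x => (a x).1 := Subtype.val_injective.comp a.injective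
      rw [Finset.card_image_of_injective _ hinj, ← Set.ncard_eq_toFinset_card] at this
      omega
    refine ⟨G'.toStructure_models hm hn (hG.of_isEmb (G.isEmb_comap hg)), ?_, ?_⟩
    · intro y hy
      have hy' : G.col (b y) = true := hy
      refine (hcount y _ ?_).trans_eq (by rw [hy']; rfl)
      rintro x ⟨-, hx⟩
      exact ((hG'i _ _).1 hx).2
    · intro y hy
      have hy' : G.col (b y) = false := hy
      refine (hcount y _ ?_).trans_eq (by rw [hy']; rfl)
      rintro x ⟨-, hx⟩
      exact G.symm ((hG'i _ _).1 hx).2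
  have hext : M ⊨ extensionAxiom k l G'.toStructure :=
    Theory.realize_sentence_of_mem (T m n) (Or.inr ⟨k, l, _, hsafe, rfl⟩)
  rw [extensionAxiom, realize_forAll] at hext
  have hcol : ∀ i, (graphOf hM).col (e (a i)) = G.col (a i) := fun i => he.col ⟨_, (ha i).2⟩
  have hdiag : (diagram (Sum.inl : Fin k → Fin k ⊕ Fin l)).Realize fun i => e (a i) := by
    refine (realize_diagram _ _).2 ⟨fun i => ⟨?_, ?_⟩, fun i j => ⟨?_, ?_⟩⟩
    · rw [← graphOf_col_true hM, hcol]
      rfl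
    · rw [← graphOf_col_false hM, hcol]
      rfl
    · rw [graphOf_inc hM, hcol, hG'i]
      exact and_congr Iff.rfl (he.adj ⟨_, (ha i).2⟩ ⟨_, (ha j).2⟩)
    · refine Iff.trans ?_ (Sum.inl_injective.eq_iff (a := i) (b := j)).symm
      constructor
      · intro h
        have := he.inj (a₁ := ⟨_, (ha i).2⟩) (a₂ := ⟨_, (ha j).2⟩) h
        exact a.injective (Subtype.ext (Subtype.mk.inj this))
      · rintro rfl
        rfl
  obtain ⟨y, hy⟩ := Formula.realize_iExs.1 (Formula.realize_imp.1 (hext _) hdiag)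
  obtain ⟨hy1, hy2⟩ := (realize_diagram _ _).1 hy
  let v' : Fin k ⊕ Fin l → M := Sum.elim (fun i => e (a i)) y
  have hsurj : ∀ x ∈ Y, ∃ i, g i = x := by
    intro x hx
    by_cases hxX : x ∈ X
    · exact ⟨Sum.inl (a.symm ⟨x, by simp [hx, hxX]⟩), by simp [g]⟩
    · exact ⟨Sum.inr (b.symm ⟨x, by simp [hx, hxX]⟩), by simp [g]⟩
  -- The value outside `Y` plays no role.
  let v : V → M := fun x => if h : ∃ i, g i = x then v' h.choose else e x
  have hv : ∀ i, v (g i) = v' i := by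
    intro i
    have h : ∃ j, g j = g i := ⟨i, rfl⟩
    simp only [v, dif_pos h]
    rw [hg h.choose_spec]
  have hvcol : ∀ i, (graphOf hM).col (v' i) = G.col (g i) := by
    intro i
    have := (hy1 i).1
    rw [← graphOf_col_true hM] at this
    exact Bool.eq_iff_iff.2 this
  refine ⟨v, ?_, ?_⟩
  · intro x hx hxX
    obtain ⟨i | i, rfl⟩ := hsurj x hx
    · rw [hv]; rfl
    · exact ((hb i).2 hxX).elim
  · intro x hx z hz
    obtain ⟨i, rfl⟩ := hsurj x hx
    obtain ⟨j, rfl⟩ := hsurj z hz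
    rw [hv, hv]
    refine ⟨((hy2 i j).2).trans hg.eq_iff.symm, hvcol i, ?_⟩
    have h1 : ∀ i j, Inc (v' i) (v' j) ↔ Inc i j := fun i j => (hy2 i j).1
    have h2 : ∀ i j, G.Adj (g i) (g j) ↔ Inc i j ∨ Inc j i := by
      intro i j
      rw [hG'i, hG'i]
      constructor
      · intro h
        have := G.col_eq_not h
        cases h' : G.col (g i)
        · exact Or.inr ⟨by rw [this, h']; rfl, G.symm h⟩
        · exact Or.inl ⟨rfl, h⟩
      · rintro (⟨-, h⟩ | ⟨-, h⟩)
        · exact h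
        · exact G.symm h
    rw [h2]
    exact or_congr (h1 i j) (h1 j i)

end Model

end Incidence

/-! ### Amalgamation of copies of a graph with a common part and prescribed partial images. -/

namespace Incidence

namespace BiGraph

theorem IsEmb.mem_of_closed {V W : Type*} {G : BiGraph V} {H : BiGraph W} {N : Bool → ℕ}
    {f : V → W} (hf : IsEmb G H f) {B : Set V} (hB : G.Closed N B) {x : V} {P : Finset W}
    (hP : ∀ p ∈ P, ∃ u ∈ B, f u = p) (hadj : ∀ p ∈ P, H.Adj (f x) p)
    (hcard : N (G.col x) ≤ P.card) : x ∈ B := by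
  obtain ⟨R, rfl⟩ := exists_map_eq hf.inj (P := P) fun p hp => by
    obtain ⟨u, -, hu⟩ := hP p hp
    exact ⟨u, hu⟩
  simp only [Finset.mem_map, Function.Embedding.coeFn_mk, forall_exists_index, and_imp,
    forall_apply_eq_imp_iff₂] at hP hadj
  refine hB x R (fun r hr => ?_) (fun r hr => (hf.adj _ _).1 (hadj r hr)) (by simpa using hcard)
  obtain ⟨u, hu, h⟩ := hP r hr
  rwa [← hf.inj h]

section Amalgam

variable {ι : Type} {E X : Type u} (GE : BiGraph E) (GX : BiGraph X) (N : Bool → ℕ)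
  (A B : Set E)

/-- The vertices of the amalgam of copies of `E` that share `A`, the copies of `B` being
identified with subsets of `X`. -/
abbrev AmalgamCarrier (ι : Type) {E : Type u} (X : Type u) (A B : Set E) : Type u :=
  X ⊕ ({a : E // a ∈ A ∧ a ∉ B} ⊕ (ι × {a : E // a ∉ A ∧ a ∉ B}))

variable {A B} in
open Classical in
/-- The `i`-th copy of `E` in the amalgam. -/
noncomputable def amalgamMap (s : ι → B → X) (i : ι) (x : E) : AmalgamCarrier ι X A B :=
  if hB : x ∈ B then Sum.inl (s i ⟨x, hB⟩)
  else if hA : x ∈ A then Sum.inr (Sum.inl ⟨x, hA, hB⟩) else Sum.inr (Sum.inr (i, ⟨x, hA, hB⟩))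

/-- The hypotheses under which copies of `E` are amalgamated. -/
structure AmalgamData (s : ι → B → X) : Prop where
  freeE : GE.Free N
  freeX : GX.Free N
  closedA : GE.Closed N A
  closedB : GE.Closed N B
  -- An edge from `A ∖ B` to `B ∖ A` would join one shared vertex to the different copies of its
  -- neighbour; several such edges could create a forbidden graph.
  adj : ∀ a ∈ A, ∀ b ∈ B, GE.Adj a b → a ∈ B ∨ b ∈ A
  emb : ∀ i, IsEmb (GE.induce B) GX (s i)
  coincide : ∀ i j x y, i ≠ j → s i x = s j y → x = y ∧ x.1 ∈ A
  const : ∀ i j (x : B), x.1 ∈ A → s i x = s j x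

variable {GE GX N A B} {s : ι → B → X}

theorem amalgamMap_of_mem {i : ι} {x : E} (h : x ∈ B) :
    amalgamMap (A := A) s i x = Sum.inl (s i ⟨x, h⟩) := dif_pos h

theorem amalgamMap_inl {i : ι} {x : E} {u : X} (h : amalgamMap (A := A) s i x = Sum.inl u) :
    ∃ hx : x ∈ B, s i ⟨x, hx⟩ = u := by
  unfold amalgamMap at h
  split_ifs at h with h1 h2
  exact ⟨h1, Sum.inl_injective h⟩

theorem amalgam_cases [Nonempty ι] (y : AmalgamCarrier ι X A B) :
    (∃ u, y = Sum.inl u) ∨ ∃ i x, x ∉ B ∧ y = amalgamMap s i x := by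
  rcases y with u | ⟨a, hA, hB⟩ | ⟨i, a, hA, hB⟩
  · exact Or.inl ⟨u, rfl⟩
  · exact Or.inr ⟨Classical.arbitrary ι, a, hB, by simp [amalgamMap, hA, hB]⟩
  · exact Or.inr ⟨i, a, hB, by simp [amalgamMap, hA, hB]⟩

theorem AmalgamData.eq_of_map_eq (h : AmalgamData GE GX N A B s) {i j : ι} {x y : E}
    (hxy : amalgamMap (A := A) s i x = amalgamMap s j y) : x = y ∧ (i = j ∨ x ∈ A) := by
  by_cases hx : x ∈ B
  · rw [amalgamMap_of_mem hx] at hxy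
    obtain ⟨hy, h1⟩ := amalgamMap_inl hxy.symm
    by_cases hij : i = j
    · subst hij
      exact ⟨(congrArg Subtype.val ((h.emb i).inj h1)).symm, Or.inl rfl⟩
    · have := h.coincide i j _ _ hij h1.symm
      exact ⟨congrArg Subtype.val this.1, Or.inr this.2⟩
  · by_cases hy : y ∈ B
    · rw [amalgamMap_of_mem hy] at hxy
      exact (hx (amalgamMap_inl hxy).1).elim
    · by_cases hxA : x ∈ A <;> by_cases hyA : y ∈ A <;>
        simp [amalgamMap, hx, hy, hxA, hyA] at hxy
      · exact ⟨hxy, Or.inr hxA⟩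
      · exact ⟨hxy.2, Or.inl hxy.1⟩

theorem AmalgamData.map_const (h : AmalgamData GE GX N A B s) {i j : ι} {x : E} (hx : x ∈ A) :
    amalgamMap (A := A) s i x = amalgamMap s j x := by
  by_cases hB : x ∈ B
  · rw [amalgamMap_of_mem hB, amalgamMap_of_mem hB, h.const i j _ hx]
  · simp [amalgamMap, hx, hB]

/-- Adjacency in the amalgam. -/
def AmalgamAdj (GE : BiGraph E) (GX : BiGraph X) (s : ι → B → X)
    (y y' : AmalgamCarrier ι X A B) : Prop :=
  (∃ u u', y = Sum.inl u ∧ y' = Sum.inl u' ∧ GX.Adj u u') ∨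
    ∃ i x x', y = amalgamMap s i x ∧ y' = amalgamMap s i x' ∧ GE.Adj x x'

/-- Colours in the amalgam. -/
def amalgamCol (GE : BiGraph E) (GX : BiGraph X) : AmalgamCarrier ι X A B → Bool
  | Sum.inl u => GX.col u
  | Sum.inr (Sum.inl a) => GE.col a
  | Sum.inr (Sum.inr p) => GE.col p.2

theorem AmalgamData.col_map (h : AmalgamData GE GX N A B s) (i : ι) (x : E) :
    amalgamCol GE GX (amalgamMap (A := A) s i x) = GE.col x := by
  unfold amalgamMap
  split_ifs with h1 h2
  · exact (h.emb i).col _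
  · rfl
  · rfl

/-- The amalgam of copies of `E` over `A`, extending `X`. -/
def amalgam (h : AmalgamData GE GX N A B s) : BiGraph (AmalgamCarrier ι X A B) where
  col := amalgamCol GE GX
  Adj := AmalgamAdj GE GX s
  symm := by
    rintro y y' (⟨u, u', rfl, rfl, h1⟩ | ⟨i, x, x', rfl, rfl, h1⟩)
    · exact Or.inl ⟨u', u, rfl, rfl, GX.symm h1⟩
    · exact Or.inr ⟨i, x', x, rfl, rfl, GE.symm h1⟩
  ne := by
    rintro y y' (⟨u, u', rfl, rfl, h1⟩ | ⟨i, x, x', rfl, rfl, h1⟩)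
    · exact GX.ne h1
    · rw [h.col_map, h.col_map]
      exact GE.ne h1

theorem AmalgamData.isEmb_inl (h : AmalgamData GE GX N A B s) :
    IsEmb GX (amalgam h) Sum.inl := by
  refine ⟨Sum.inl_injective, fun _ => rfl, fun u u' => ⟨?_, fun h1 => Or.inl ⟨u, u', rfl, rfl, h1⟩⟩⟩
  rintro (⟨v, v', h1, h2, h3⟩ | ⟨i, x, x', h1, h2, h3⟩)
  · rwa [Sum.inl_injective h1, Sum.inl_injective h2]
  · obtain ⟨hx, rfl⟩ := amalgamMap_inl h1.symm
    obtain ⟨hx', rfl⟩ := amalgamMap_inl h2.symm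
    exact ((h.emb i).adj _ _).2 h3

theorem AmalgamData.isEmb_map (h : AmalgamData GE GX N A B s) (i : ι) :
    IsEmb GE (amalgam h) (amalgamMap s i) := by
  refine ⟨fun x y hxy => (h.eq_of_map_eq hxy).1, h.col_map i, fun x y =>
    ⟨?_, fun h1 => Or.inr ⟨i, x, y, rfl, rfl, h1⟩⟩⟩
  rintro (⟨v, v', h1, h2, h3⟩ | ⟨j, x', y', h1, h2, h3⟩)
  · obtain ⟨hx, rfl⟩ := amalgamMap_inl h1
    obtain ⟨hx', rfl⟩ := amalgamMap_inl h2
    exact ((h.emb i).adj _ _).1 h3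
  · rwa [(h.eq_of_map_eq h1).1, (h.eq_of_map_eq h2).1]

/-- A forbidden graph cannot lie inside one copy of `E`. If one of its vertices `x` lies in copy `i`
outside `A ∪ B`, then all its neighbours in the forbidden graph lie in that copy. Some vertex on the
side of `x` lies outside the copy, and being adjacent to it forces all these neighbours into `B` or
all into `A`. Since `B` and `A` are closed, `x` lies in one of them. If `x` is in `A ∖ B`, its
neighbours lie in `A`, and comparison with a vertex outside the copy puts them also in `B`, so `x`
is in `B` after all. Hence the forbidden graph lies in `X`, which is free. -/
theorem AmalgamData.free (h : AmalgamData GE GX N A B s) [Nonempty ι] (hN : ∀ c, 0 < N c) :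
    (amalgam h).Free N := by
  have hfree : ∀ i c P Q, (amalgam h).Full N c P Q → (∀ p ∈ P, ∃ u, amalgamMap s i u = p) →
      ¬ ∀ q ∈ Q, ∃ u, amalgamMap s i u = q := fun i c P Q hPQ h1 h2 =>
    h.freeE.freeOn_range (h.isEmb_map i) c P Q h1 h2 hPQ
  have claim1 : ∀ c P Q, (amalgam h).Full N c P Q →
      ∀ i x, amalgamMap s i x ∈ Q → x ∈ A ∨ x ∈ B := by
    intro c P Q hPQ i x hw
    by_contra hx
    push Not at hx
    obtain ⟨hxA, hxB⟩ := hx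
    obtain ⟨h1, h2, h3, h4⟩ := id hPQ
    have hP : ∀ p ∈ P, ∃ u, amalgamMap s i u = p := by
      intro p hp
      rcases h4 p hp _ hw with ⟨u, u', e1, e2, -⟩ | ⟨j, y, y', e1, e2, -⟩
      · exact (hxB (amalgamMap_inl e1).1).elim
      · obtain ⟨rfl, h5⟩ := h.eq_of_map_eq e1
        obtain rfl := h5.resolve_right hxA
        exact ⟨_, e2.symm⟩
    refine hfree i c P Q hPQ hP fun q hq => ?_
    by_contra hqi
    have hcol : GE.col x = c := by rw [← h1 _ hw]; exact (h.col_map i x).symm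
    have hadj : ∀ p ∈ P, (amalgam h).Adj (amalgamMap s i x) p := fun p hp => h4 p hp _ hw
    by_cases hqX : ∃ u, q = Sum.inl u
    · refine hxB ((h.isEmb_map i).mem_of_closed h.closedB (fun p hp => ?_) hadj
        (by rw [h2, hcol]))
      obtain ⟨u, rfl⟩ := hP p hp
      refine ⟨u, ?_, rfl⟩
      rcases h4 _ hp q hq with ⟨v, v', -, e2, -⟩ | ⟨j, y, y', rfl, e2, h5⟩
      · exact (amalgamMap_inl e2).1
      · obtain ⟨rfl, h6⟩ := h.eq_of_map_eq e2
        obtain ⟨v, hv⟩ := hqX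
        have hyB := (amalgamMap_inl hv).1
        rcases h6 with rfl | h6
        · exact (hqi ⟨y, rfl⟩).elim
        · rcases h.adj _ h6 _ hyB (GE.symm h5) with h7 | h7
          · exact h7
          · exact (hqi ⟨y, h.map_const h7⟩).elim
    · refine hxA ((h.isEmb_map i).mem_of_closed h.closedA (fun p hp => ?_) hadj
        (by rw [h2, hcol]))
      obtain ⟨u, rfl⟩ := hP p hp
      refine ⟨u, ?_, rfl⟩
      rcases h4 _ hp q hq with ⟨v, v', e1, -⟩ | ⟨j, y, y', rfl, e2, h5⟩
      · exact (hqX ⟨v, e1⟩).elim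
      · obtain ⟨rfl, rfl | h6⟩ := h.eq_of_map_eq e2
        · exact (hqi ⟨y, rfl⟩).elim
        · exact h6
  have claim2 : ∀ c P Q, (amalgam h).Full N c P Q → ∀ i x, amalgamMap s i x ∈ Q → x ∈ B := by
    intro c P Q hPQ i x hw
    by_contra hxB
    have hxA : x ∈ A := (claim1 c P Q hPQ i x hw).resolve_right hxB
    have hP1 := claim1 _ Q P (hPQ.swap hN)
    obtain ⟨h1, h2, h3, h4⟩ := id hPQ
    have hP : ∀ p ∈ P, ∃ u ∈ A, amalgamMap s i u = p := by
      intro p hp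
      rcases h4 p hp _ hw with ⟨u, u', e1, e2, -⟩ | ⟨j, y, y', e1, rfl, h5⟩
      · exact (hxB (amalgamMap_inl e1).1).elim
      · obtain ⟨rfl, h6⟩ := h.eq_of_map_eq e1
        have hy' : y' ∈ A := by
          rcases hP1 j y' hp with h7 | h7
          · exact h7
          · exact (h.adj _ hxA _ h7 h5).resolve_left hxB
        exact ⟨y', hy', h.map_const hy'⟩
    refine hfree i c P Q hPQ (fun p hp => (hP p hp).imp fun _ h => h.2) fun q hq => ?_
    by_contra hqi
    have hcol : GE.col x = c := by rw [← h1 _ hw]; exact (h.col_map i x).symm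
    refine hxB ((h.isEmb_map i).mem_of_closed h.closedB (fun p hp => ?_)
      (fun p hp => h4 p hp _ hw) (by rw [h2, hcol]))
    obtain ⟨u, hu, rfl⟩ := hP p hp
    refine ⟨u, ?_, rfl⟩
    rcases h4 _ hp q hq with ⟨v, v', -, e2, -⟩ | ⟨j, y, y', rfl, e2, h5⟩
    · exact (amalgamMap_inl e2).1
    · obtain ⟨rfl, -⟩ := h.eq_of_map_eq e2
      have hyA : y ∉ A := fun hy => hqi ⟨y, h.map_const hy⟩
      have hyB : y ∈ B := (claim1 c P Q hPQ j y hq).resolve_left hyA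
      exact (h.adj _ hu _ hyB (GE.symm h5)).resolve_right hyA
  intro c P Q hPQ
  refine h.freeX.freeOn_range h.isEmb_inl c P Q (fun p hp => ?_) (fun q hq => ?_) hPQ
  · rcases amalgam_cases (s := s) p with ⟨u, rfl⟩ | ⟨i, x, hx, rfl⟩
    · exact ⟨u, rfl⟩
    · exact (hx (claim2 _ Q P (hPQ.swap hN) i x hp)).elim
  · rcases amalgam_cases (s := s) q with ⟨u, rfl⟩ | ⟨i, x, hx, rfl⟩
    · exact ⟨u, rfl⟩
    · exact (hx (claim2 _ P Q hPQ i x hq)).elim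

/-- A vertex of a copy outside `B` sees only vertices of its own copy, and those in `X` come from
`B`; closedness of `B` bounds their number. This is the condition for embedding the amalgam over
`X`. -/
theorem AmalgamData.closed_range_inl (h : AmalgamData GE GX N A B s) [Nonempty ι] :
    (amalgam h).Closed N (Set.range Sum.inl) := by
  intro w P hP hadj hcard
  rcases amalgam_cases (s := s) w with ⟨u, rfl⟩ | ⟨i, x, hx, rfl⟩
  · exact ⟨u, rfl⟩
  refine (hx ((h.isEmb_map i).mem_of_closed h.closedB (fun p hp => ?_) hadj ?_)).elim
  · obtain ⟨v, rfl⟩ := hP hp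
    rcases hadj _ hp with ⟨u, u', e1, e2, -⟩ | ⟨j, y, y', e1, e2, h5⟩
    · exact (hx (amalgamMap_inl e1).1).elim
    · obtain ⟨rfl, h6⟩ := h.eq_of_map_eq e1
      have hy' := (amalgamMap_inl e2.symm).1
      refine ⟨y', hy', ?_⟩
      rw [e2]
      rcases h6 with rfl | h6
      · rfl
      · rcases h.adj _ h6 _ hy' h5 with h7 | h7
        · exact (hx h7).elim
        · exact h.map_const h7
  · rw [← h.col_map i x]
    exact hcard

theorem mk_amalgamCarrier_lt [Countable ι] {κ : Cardinal.{u}} (hκ : ℵ₀ < κ) (hE : #E < κ)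
    (hX : #X < κ) : #(AmalgamCarrier ι X A B) < κ := by
  have h1 : ∀ p : E → Prop, #{a // p a} < κ := fun p => (mk_subtype_le p).trans_lt hE
  simp only [AmalgamCarrier, mk_sum, lift_id, mk_prod]
  refine add_lt_of_lt hκ.le hX (add_lt_of_lt hκ.le (h1 _) ?_)
  refine mul_lt_of_lt hκ.le ?_ ?_
  · exact (lift_le_aleph0.2 mk_le_aleph0).trans_lt hκ
  · simpa using h1 _

end Amalgam

end BiGraph

end Incidence


/-! ### Small elementary substructures. -/

namespace IndepRel

open FirstOrder.Language

section LowenheimSkolem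

variable {L : FirstOrder.Language.{u, v}} {N : Type w} [L.Structure N] {κ : Cardinal.{w}}

/-- Small sets lie in small elementary substructures. -/
theorem IsMonster.exists_elementarySubstructure (hM : IsMonster L N κ) {X : Set N} (hX : #X < κ) :
    ∃ S : L.ElementarySubstructure N, X ⊆ S ∧ #S < κ := by
  obtain ⟨μ, hμ⟩ := mem_range_lift_of_le hM.card_language_lt.le
  have hμκ : μ < κ := by
    have := hM.card_language_lt
    rw [← hμ] at this
    exact lift_lt.1 this
  let ν := max (max #X ℵ₀) μ
  have hν : ν < κ := max_lt (max_lt hX hM.uncountable) hμκ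
  by_cases h : ν ≤ #N
  · obtain ⟨S, hS, hS'⟩ := exists_elementarySubstructure_card_eq L X ν
      ((le_max_right _ _).trans (le_max_left _ _))
      (lift_le.2 ((le_max_left _ _).trans (le_max_left _ _)))
      (by rw [← hμ]; exact lift_le.2 (le_max_right _ _)) (lift_le.2 h)
    refine ⟨S, hS, ?_⟩
    rw [lift_id, lift_id] at hS'
    rw [hS']
    exact hν
  · refine ⟨⊤, fun x _ => trivial, ?_⟩
    exact (mk_subtype_le _).trans_lt ((not_le.1 h).trans hν)

/-- The Tarski-Vaught property for tuples. -/
theorem exists_realize_of_elementary (S : L.ElementarySubstructure N) {β : Type*} [Finite β]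
    (φ : L.Formula (S ⊕ β)) (x : β → N) (h : φ.Realize (Sum.elim Subtype.val x)) :
    ∃ y : β → S, φ.Realize (Sum.elim Subtype.val fun i => (y i : N)) := by
  have h1 : (φ.iExs β).Realize (S.subtype ∘ (id : S → S)) :=
    Formula.realize_iExs.2 ⟨x, h⟩
  rw [ElementaryEmbedding.map_formula, Formula.realize_iExs] at h1
  obtain ⟨y, hy⟩ := h1
  refine ⟨y, ?_⟩
  rw [← ElementaryEmbedding.map_formula S.subtype] at hy
  convert hy using 1
  funext i
  rcases i with i | i <;> rfl

end LowenheimSkolem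

end IndepRel

/-! ### Embeddings into the monster model, and types of closed sets. -/

namespace Incidence

open FirstOrder.Language Filter IndepRel BiGraph

/-- A monster model of `T_{m,n}`. -/
structure GenericMonster (m n : ℕ) (M : Type u) [lang.Structure M] (κ : Cardinal.{u}) : Prop where
  one_le_m : 1 ≤ m
  one_le_n : 1 ≤ n
  models : M ⊨ T m n
  monster : IsMonster lang M κ

namespace GenericMonster

variable {m n : ℕ} {M : Type u} [lang.Structure M] {κ : Cardinal.{u}} (S : GenericMonster m n M κ)

theorem isIncidence (S : GenericMonster m n M κ) : IsIncidence M := by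
  have := S.models
  exact isIncidence_of_models (m := m) (n := n)

/-- The incidence graph of the model. -/
noncomputable abbrev graph (S : GenericMonster m n M κ) : BiGraph M := graphOf S.isIncidence

/-- The closure of a set of vertices under the operations given by completeness. -/
noncomputable abbrev closure (S : GenericMonster m n M κ) (X : Set M) : Set M :=
  S.graph.cl (threshold m n) X

/-- The set is closed in the incidence graph. -/
abbrev IsClosed (S : GenericMonster m n M κ) (X : Set M) : Prop :=
  S.graph.Closed (threshold m n) X

theorem threshold_pos (S : GenericMonster m n M κ) : ∀ c, 0 < threshold m n c :=
  Incidence.threshold_pos S.one_le_m S.one_le_n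

theorem free : S.graph.Free (threshold m n) := by
  have := S.models
  exact free_of_models S.one_le_m S.one_le_n S.isIncidence

theorem complete : S.graph.Complete (threshold m n) := by
  have := S.models
  exact complete_of_models S.isIncidence

theorem isEmb_aut (σ : M ≃[lang] M) : IsEmb S.graph S.graph σ := by
  have h1 : ∀ x, IsPoint (σ x) ↔ IsPoint x := fun x => by
    have := realize_aut σ (pointF ()) fun _ => x
    simpa using this
  have h2 : ∀ x y, Inc (σ x) (σ y) ↔ Inc x y := fun x y => by
    have := realize_aut σ (incF (0 : Fin 2) 1) ![x, y]
    simpa using this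
  refine ⟨σ.injective, fun x => ?_, fun x y => or_congr (h2 x y) (h2 y x)⟩
  rw [Bool.eq_iff_iff, graphOf_col_true, graphOf_col_true]
  exact h1 x

theorem closed_image (σ : M ≃[lang] M) {X : Set M} (hX : S.IsClosed X) :
    S.IsClosed (σ '' X) := by
  intro x P hP hadj hcard
  obtain ⟨y, rfl⟩ := σ.surjective x
  refine ⟨y, (S.isEmb_aut σ).mem_of_closed hX (fun p hp => hP hp) hadj ?_, rfl⟩
  rwa [← (S.isEmb_aut σ).col]

theorem nonempty (S : GenericMonster m n M κ) : Nonempty M := by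
  have := S.models
  let G : BiGraph (Fin 0 ⊕ Fin 1) := ⟨fun _ => true, fun _ _ => False, False.elim, False.elim⟩
  have hG : IsSafe m n 0 1 G.toStructure := by
    refine ⟨G.toStructure_models S.one_le_m S.one_le_n ?_, fun y _ => ?_, fun y _ => ?_⟩
    · exact (BiGraph.free_iff S.one_le_m S.one_le_n).2 fun _ _ _ _ _ h =>
        h ⟨0, S.one_le_m⟩ ⟨0, S.one_le_n⟩
    · rw [Set.eq_empty_of_isEmpty {x : Fin 0 | _}, Set.ncard_empty]; exact Nat.zero_le _
    · rw [Set.eq_empty_of_isEmpty {x : Fin 0 | _}, Set.ncard_empty]; exact Nat.zero_le _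
  have hext : M ⊨ extensionAxiom 0 1 G.toStructure :=
    Theory.realize_sentence_of_mem (T m n) (Or.inr ⟨0, 1, _, hG, rfl⟩)
  rw [extensionAxiom, realize_forAll] at hext
  let _ := G.toStructure
  obtain ⟨y, -⟩ := Formula.realize_iExs.1 (Formula.realize_imp.1 (hext fun i => i.elim0)
    ((realize_diagram _ _).2 ⟨fun i => i.elim0, fun i => i.elim0⟩))
  exact ⟨y 0⟩

/-- A small extension of a closed set embeds into the model over this set. -/
theorem exists_emb {V : Type u} (G : BiGraph V) (hG : G.Free (threshold m n)) (hV : #V < κ)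
    (X : Set M) (i : X → V) (hi : IsEmb (S.graph.induce X) G i)
    (hX : G.Closed (threshold m n) (Set.range i)) :
    ∃ j : V → M, IsEmb G S.graph j ∧ ∀ x : X, j (i x) = x := by
  classical
  have := S.models
  have := S.nonempty
  have hXκ : #X < κ := (mk_le_of_injective hi.inj).trans_lt hV
  let e : V → M := fun y => if h : ∃ x, i x = y then h.choose.1 else Classical.arbitrary M
  have he : ∀ x, e (i x) = x := by
    intro x
    have h : ∃ z, i z = i x := ⟨x, rfl⟩
    simp only [e, dif_pos h]
    rw [hi.inj h.choose_spec]
  have he' : IsEmb (G.induce (Set.range i)) S.graph fun x => e x := by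
    refine ⟨?_, ?_, ?_⟩
    · rintro ⟨_, x, rfl⟩ ⟨_, y, rfl⟩ h
      simp only [he] at h
      exact Subtype.ext (congrArg i (Subtype.ext h))
    · rintro ⟨_, x, rfl⟩
      simp only [he]
      exact (hi.col x).symm
    · rintro ⟨_, x, rfl⟩ ⟨_, y, rfl⟩
      simp only [he]
      exact (hi.adj x y).symm
  choose v hv1 hv2 using exists_finite_extension S.one_le_m S.one_le_n S.isIncidence G hG
    (Set.range i) hX e he'
  obtain ⟨b, hb⟩ := S.monster.realize_net (atTop : Filter (Finset V)) hV v
  have hev : ∀ (φ : lang.Formula V) (Y : Finset V), (∀ Z, Y ⊆ Z → φ.Realize (v Z)) →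
      φ.Realize b := fun φ Y h => hb φ (by
    filter_upwards [eventually_ge_atTop Y] with Z hZ
    exact h Z hZ)
  -- The limit `b` only reproduces the type of `X`; an automorphism then carries its copy of `X` to
  -- `X` itself.
  have hst : SameType lang (∅ : Set M) (fun x : X => b (i x)) Subtype.val := by
    refine SameType.symm (sameType_empty_of_imp fun ψ hψ => ?_)
    have := hev (ψ.relabel i) (ψ.freeVarFinset.image i) fun Z hZ => by
      rw [Formula.realize_relabel]
      refine (realize_congr_freeVar ψ fun x hx => ?_).2 hψ
      have := hv1 Z (i x) (hZ (Finset.mem_image_of_mem _ hx)) ⟨x, rfl⟩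
      rw [he] at this
      exact this
    rw [Formula.realize_relabel] at this
    exact this
  obtain ⟨σ, -, hσ⟩ := S.monster.exists_aut
    (by rw [mk_eq_zero]; exact aleph0_pos.trans S.monster.uncountable) hXκ hst
  have hbemb : IsEmb G S.graph b := by
    refine ⟨fun x y hxy => ?_, fun x => ?_, fun x y => ?_⟩
    · by_contra hne
      have := hev (∼(eqF x y)) {x, y} fun Z hZ => by
        rw [Formula.realize_not, realize_eqF,
          (hv2 Z x (hZ (by simp)) y (hZ (by simp))).1]
        exact hne
      rw [Formula.realize_not, realize_eqF] at this
      exact this hxy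
    · have hcol : ∀ Z, {x} ⊆ Z → S.graph.col (v Z x) = G.col x := fun Z hZ =>
        (hv2 Z x (hZ (by simp)) x (hZ (by simp))).2.1
      cases hx : G.col x
      · rw [graphOf_col_false]
        have := hev (lineF x) {x} fun Z hZ => by
          rw [realize_lineF, ← graphOf_col_false S.isIncidence, hcol Z hZ, hx]
        rwa [realize_lineF] at this
      · rw [graphOf_col_true]
        have := hev (pointF x) {x} fun Z hZ => by
          rw [realize_pointF, ← graphOf_col_true S.isIncidence, hcol Z hZ, hx]
        rwa [realize_pointF] at this
    · have hadj : ∀ Z, {x, y} ⊆ Z → (S.graph.Adj (v Z x) (v Z y) ↔ G.Adj x y) := fun Z hZ =>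
        (hv2 Z x (hZ (by simp)) y (hZ (by simp))).2.2
      have hF : ∀ w : V → M, S.graph.Adj (w x) (w y) ↔ (incF x y ⊔ incF y x).Realize w := by
        intro w
        rw [Formula.realize_sup, realize_incF, realize_incF]
        rfl
      rw [hF]
      by_cases h : G.Adj x y
      · exact iff_of_true (hev _ {x, y} fun Z hZ => by rw [← hF, hadj Z hZ]; exact h) h
      · refine iff_of_false ?_ h
        rw [← Formula.realize_not]
        exact hev _ {x, y} fun Z hZ => by
          rw [Formula.realize_not, ← hF, hadj Z hZ]; exact h
  exact ⟨fun y => σ (b y), (S.isEmb_aut σ).comp hbemb, hσ⟩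

theorem closed_range {V : Type*} {G : BiGraph V} {j : V → M} (hj : IsEmb G S.graph j)
    (hG : G.Complete (threshold m n)) : S.IsClosed (Set.range j) :=
  hG.closed_range S.threshold_pos hj S.free

/-- An elementary substructure is closed. -/
theorem closed_of_elementary (E : lang.ElementarySubstructure M) : S.IsClosed (E : Set M) := by
  classical
  intro x P hP hadj hcard
  by_contra hx
  obtain ⟨P', hPP', hP'⟩ := Finset.exists_subset_card_eq hcard
  replace hadj : ∀ p ∈ P', S.graph.Adj x p := fun p hp => hadj p (hPP' hp)
  replace hP : ∀ p ∈ P', p ∈ E := fun p hp => hP (hPP' hp)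
  have hcol : ∀ y, (∀ p ∈ P', S.graph.Adj y p) → S.graph.col y = S.graph.col x := by
    intro y hy
    obtain ⟨p, hp⟩ := Finset.card_pos.1 ((S.threshold_pos (S.graph.col x)).trans_eq hP'.symm)
    have h1 := S.graph.col_eq_not (hadj p hp)
    rw [S.graph.col_eq_not (hy p hp)] at h1
    simpa using h1
  -- By elementarity, since `x` lies outside `E`, one more common neighbour of `P'` can always be
  -- found in `E` beyond those already chosen. Iterating yields a forbidden graph.
  have key : ∀ k, ∃ Q : Finset M, Q.card = k ∧ ↑Q ⊆ (E : Set M) ∧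
      ∀ q ∈ Q, ∀ p ∈ P', S.graph.Adj q p := by
    intro k
    induction k with
    | zero => exact ⟨∅, by simp⟩
    | succ k ih =>
      obtain ⟨Q, hQ1, hQ2, hQ3⟩ := ih
      let φ : lang.Formula (E ⊕ Unit) :=
        (Formula.iInf fun p : P' => incF (Sum.inl ⟨p.1, hP _ p.2⟩) (Sum.inr ()) ⊔
          incF (Sum.inr ()) (Sum.inl ⟨p.1, hP _ p.2⟩)) ⊓
        Formula.iInf fun q : Q => ∼(eqF (Sum.inr ()) (Sum.inl ⟨q.1, hQ2 q.2⟩))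
      have hφ : ∀ y : M, φ.Realize (Sum.elim Subtype.val fun _ => y) ↔
          (∀ p ∈ P', S.graph.Adj y p) ∧ y ∉ Q := by
        intro y
        simp only [φ, Formula.realize_inf, Formula.realize_iInf, Formula.realize_sup,
          realize_incF, Formula.realize_not, realize_eqF, Sum.elim_inl, Sum.elim_inr,
          Subtype.forall]
        refine and_congr (forall₂_congr fun p hp => or_comm) ⟨fun h hy => h y hy rfl, ?_⟩
        rintro h q hq rfl
        exact h hq
      obtain ⟨y, hy⟩ := exists_realize_of_elementary E φ (fun _ => x)
        ((hφ x).2 ⟨hadj, fun h => hx (hQ2 h)⟩)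
      obtain ⟨h1, h2⟩ := (hφ (y ())).1 hy
      refine ⟨insert (y () : M) Q, by rw [Finset.card_insert_of_notMem h2, hQ1], ?_, ?_⟩
      · rw [Finset.coe_insert]
        exact Set.insert_subset (y ()).2 hQ2
      · intro q hq
        rcases Finset.mem_insert.1 hq with rfl | hq
        · exact h1
        · exact hQ3 q hq
  obtain ⟨Q, hQ1, hQ2, hQ3⟩ := key (threshold m n (!S.graph.col x))
  exact S.free (S.graph.col x) P' Q ⟨fun q hq => hcol q (hQ3 q hq), hP', hQ1,
    fun p hp q hq => hQ3 q hq p hp⟩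

/-- Elementary substructures are closed, so the closure lies in a small one. -/
theorem closure_small {X : Set M} (hX : #X < κ) : #(S.closure X) < κ := by
  obtain ⟨E, hE, hE'⟩ := S.monster.exists_elementarySubstructure hX
  exact (mk_le_mk_of_subset (cl_subset (S.closed_of_elementary E) hE)).trans_lt hE'

/-- Isomorphic embeddings of a small graph with closed ranges satisfy the same formulas. -/
theorem realize_iff_of_emb {k : ℕ} {α : Type*} (φ : lang.BoundedFormula α k) :
    ∀ {V : Type u} {G : BiGraph V} {f g : V → M}, #V < κ → IsEmb G S.graph f →
      IsEmb G S.graph g → S.IsClosed (Set.range f) → S.IsClosed (Set.range g) →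
      ∀ (v : α → V) (xs : Fin k → V), φ.Realize (f ∘ v) (f ∘ xs) ↔ φ.Realize (g ∘ v) (g ∘ xs) := by
  have hterm : ∀ {k : ℕ} (t : lang.Term (α ⊕ Fin k)), ∃ i, t = Term.var i := by
    intro k t
    rcases t with i | ⟨f, -⟩
    · exact ⟨i, rfl⟩
    · exact nomatch f
  have hvar : ∀ {k : ℕ} {V : Type u} (f : V → M) (v : α → V) (xs : Fin k → V) (i : α ⊕ Fin k),
      Sum.elim (f ∘ v) (f ∘ xs) i = f (Sum.elim v xs i) := by
    rintro k V f v xs (i | i) <;> rfl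
  induction φ with
  | falsum => exact fun _ _ _ _ _ _ _ => Iff.rfl
  | equal t₁ t₂ =>
    intro V G f g hV hf hg hcf hcg v xs
    obtain ⟨i, rfl⟩ := hterm t₁
    obtain ⟨j, rfl⟩ := hterm t₂
    simp only [BoundedFormula.Realize, Term.realize_var, hvar]
    rw [hf.inj.eq_iff, hg.inj.eq_iff]
  | rel R ts =>
    intro V G f g hV hf hg hcf hcg v xs
    choose i hi using fun j => hterm (ts j)
    have hrel : ∀ f : V → M, BoundedFormula.Realize (BoundedFormula.rel R ts) (f ∘ v) (f ∘ xs) ↔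
        Structure.RelMap R fun j => f (Sum.elim v xs (i j)) := by
      intro f
      simp only [BoundedFormula.Realize]
      have : (fun j => (ts j).realize (Sum.elim (f ∘ v) (f ∘ xs))) =
          fun j => f (Sum.elim v xs (i j)) := by
        funext j
        rw [hi j, Term.realize_var, hvar]
      rw [this]
    have hp : ∀ (x : V), IsPoint (f x) ↔ IsPoint (g x) := fun x => by
      rw [← graphOf_col_true S.isIncidence, ← graphOf_col_true S.isIncidence, hf.col, hg.col]
    have hl : ∀ (x : V), IsLine (f x) ↔ IsLine (g x) := fun x => by
      rw [← graphOf_col_false S.isIncidence, ← graphOf_col_false S.isIncidence, hf.col, hg.col]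
    have hinc : ∀ (x y : V), Inc (f x) (f y) ↔ Inc (g x) (g y) := fun x y => by
      rw [graphOf_inc S.isIncidence, graphOf_inc S.isIncidence, hf.col, hg.col, hf.adj, hg.adj]
    rw [hrel, hrel]
    have h1 : ∀ z : Fin 1 → M, z = ![z 0] := fun z => by
      funext j; fin_cases j; rfl
    have h2 : ∀ z : Fin 2 → M, z = ![z 0, z 1] := fun z => by
      funext j; fin_cases j <;> rfl
    cases R with
    | point => rw [h1 fun j => f _, h1 fun j => g _]; exact hp _
    | line => rw [h1 fun j => f _, h1 fun j => g _]; exact hl _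
    | inc => rw [h2 fun j => f _, h2 fun j => g _]; exact hinc _ _
  | imp φ ψ ih1 ih2 =>
    intro V G f g hV hf hg hcf hcg v xs
    simp only [BoundedFormula.Realize]
    rw [ih1 hV hf hg hcf hcg v xs, ih2 hV hf hg hcf hcg v xs]
  | all φ ih =>
    have key : ∀ {V : Type u} {G : BiGraph V} {f g : V → M}, #V < κ → IsEmb G S.graph f →
        IsEmb G S.graph g → S.IsClosed (Set.range f) → S.IsClosed (Set.range g) →
        ∀ (v : α → V) (xs), φ.all.Realize (f ∘ v) (f ∘ xs) →
          φ.all.Realize (g ∘ v) (g ∘ xs) := by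
      intro V G f g hV hf hg hcf hcg v xs h a
      -- Back-and-forth: the closed set generated by the range of `g` and the witness `a` is
      -- embedded over the range of `f`. The index graph grows from `V` to `X'`, which is why the
      -- induction ranges over all small `V`.
      let X' : Set M := S.closure (Set.range g ∪ {a})
      have hX' : #X' < κ := S.closure_small (S.monster.union_lt (mk_range_le.trans_lt hV)
        S.monster.countable_lt)
      have hgX' : ∀ x, g x ∈ X' := fun x => subset_cl _ (Or.inl ⟨x, rfl⟩)
      have haX' : a ∈ X' := subset_cl _ (Or.inr rfl)
      let G' := S.graph.induce X'
      have hfr : Function.Injective f := hf.inj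
      let r : Set.range f → V := fun x => x.2.choose
      have hr : ∀ x, f (r x) = x := fun x => x.2.choose_spec
      have hrf : ∀ x, r ⟨f x, x, rfl⟩ = x := fun x => hf.inj (hr _)
      obtain ⟨j, hj, hj'⟩ := S.exists_emb G' (S.free.of_isEmb (isEmb_val X')) hX' (Set.range f)
        (fun x => ⟨g (r x), hgX' _⟩) (by
          refine ⟨fun x y hxy => ?_, fun x => ?_, fun x y => ?_⟩
          · have := hg.inj (congrArg Subtype.val hxy)
            exact Subtype.ext (by rw [← hr x, ← hr y, this])
          · change S.graph.col (g (r x)) = S.graph.col x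
            rw [hg.col, ← hf.col, hr]
          · change S.graph.Adj (g (r x)) (g (r y)) ↔ S.graph.Adj x y
            rw [hg.adj, ← hf.adj, hr, hr])
        (by
          rintro ⟨x, hx⟩ P hP hadj hcard
          obtain ⟨y, hy⟩ := hcg x (P.map ⟨_, Subtype.val_injective⟩) (by
            intro p hp
            simp only [Finset.coe_map, Function.Embedding.coeFn_mk, Set.mem_image] at hp
            obtain ⟨q, hq, rfl⟩ := hp
            obtain ⟨z, rfl⟩ := hP hq
            exact ⟨r z, rfl⟩) (by
            intro p hp
            simp only [Finset.mem_map, Function.Embedding.coeFn_mk] at hp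
            obtain ⟨q, hq, rfl⟩ := hp
            exact hadj q hq) (by rw [Finset.card_map]; exact hcard)
          exact ⟨⟨f y, y, rfl⟩, Subtype.ext (by simp only [hrf]; exact hy)⟩)
      have hjf : ∀ x, j ⟨g x, hgX' x⟩ = f x := fun x => by
        have := hj' ⟨f x, x, rfl⟩
        simp only [hrf] at this
        exact this
      have hcj : S.IsClosed (Set.range j) :=
        S.closed_range hj (S.complete.induce S.threshold_pos (cl_closed _))
      have hcv : S.IsClosed (Set.range (Subtype.val : X' → M)) := by
        rw [Subtype.range_coe]
        exact cl_closed _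
      have := ih hX' hj (isEmb_val X') hcj hcv (fun i => ⟨g (v i), hgX' _⟩)
        (Fin.snoc (α := fun _ => X') (fun i => ⟨g (xs i), hgX' _⟩) ⟨a, haX'⟩)
      rw [Fin.comp_snoc, Fin.comp_snoc] at this
      refine this.1 ?_
      have h1 : (j ∘ fun i => (⟨g (v i), hgX' _⟩ : X')) = f ∘ v := funext fun i => hjf _
      have h2 : (j ∘ fun i => (⟨g (xs i), hgX' _⟩ : X')) = f ∘ xs := funext fun i => hjf _
      rw [h1, h2]
      exact h _
    intro V G f g hV hf hg hcf hcg v xs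
    exact ⟨key hV hf hg hcf hcg v xs, key hV hg hf hcg hcf v xs⟩

/-- Isomorphisms between small closed sets extend to automorphisms. -/
theorem exists_aut_of_emb {V : Type u} {G : BiGraph V} {f g : V → M} (hV : #V < κ)
    (hf : IsEmb G S.graph f) (hg : IsEmb G S.graph g) (hcf : S.IsClosed (Set.range f))
    (hcg : S.IsClosed (Set.range g)) : ∃ σ : M ≃[lang] M, ∀ x, σ (f x) = g x := by
  obtain ⟨σ, -, hσ⟩ := S.monster.exists_aut (C := ∅)
    (by rw [mk_eq_zero]; exact aleph0_pos.trans S.monster.uncountable) hV (a := f) (a' := g)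
    (sameType_empty_of_imp fun φ hφ => by
      have := S.realize_iff_of_emb φ hV hf hg hcf hcg id finZeroElim
      rw [Subsingleton.elim (f ∘ finZeroElim) default, Subsingleton.elim (g ∘ finZeroElim) default]
        at this
      exact this.1 hφ)
  exact ⟨σ, hσ⟩

end GenericMonster

end Incidence


/-! ### Independent amalgamation in the monster model, and the description of algebraic closure. -/

namespace Incidence

open FirstOrder.Language Filter IndepRel BiGraph

namespace GenericMonster

variable {m n : ℕ} {M : Type u} [lang.Structure M] {κ : Cardinal.{u}} (S : GenericMonster m n M κ)

theorem closed_induce {Z X : Set M} (hX : S.IsClosed X) :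
    (S.graph.induce Z).Closed (threshold m n) {z | z.1 ∈ X} := by
  intro x P hP hadj hcard
  refine hX x (P.map ⟨_, Subtype.val_injective⟩) ?_ ?_ (by rw [Finset.card_map]; exact hcard)
  · intro p hp
    simp only [Finset.coe_map, Function.Embedding.coeFn_mk, Set.mem_image] at hp
    obtain ⟨q, hq, rfl⟩ := hp
    exact hP hq
  · intro p hp
    simp only [Finset.mem_map, Function.Embedding.coeFn_mk] at hp
    obtain ⟨q, hq, rfl⟩ := hp
    exact hadj q hq

/-- Independent amalgamation of a sequence of conjugates of `Z` over conjugates of `B`, with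
constant part `A`. -/
theorem exists_amalgam {Z A B : Set M} (hZ : S.IsClosed Z) (hZκ : #Z < κ) (hBZ : B ⊆ Z)
    (hA : S.IsClosed A) (hB : S.IsClosed B)
    (hadj : ∀ a ∈ A, ∀ b ∈ B, S.graph.Adj a b → a ∈ B ∨ b ∈ A) (σ : ℕ → (M ≃[lang] M))
    (hco : ∀ i j, ∀ x ∈ B, ∀ y ∈ B, i ≠ j → σ i x = σ j y → x = y ∧ x ∈ A)
    (hconst : ∀ i j, ∀ x ∈ B, x ∈ A → σ i x = σ j x) :
    ∃ τ : ℕ → (M ≃[lang] M), (∀ i, ∀ x ∈ B, τ i x = σ i x) ∧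
      (∀ i j, ∀ x ∈ Z, x ∈ A → τ i x = τ j x) ∧
      ∀ i j, ∀ x ∈ Z, ∀ y ∈ Z, i ≠ j → τ i x = τ j y → x = y ∧ x ∈ A := by
  -- The closed set generated by the prescribed copies of `B`. The amalgam extends it, and the
  -- embedding into the model is chosen over it, so these copies stay where they are.
  let X : Set M := S.closure (⋃ i, σ i '' B)
  have hXκ : #X < κ := by
    refine S.closure_small ?_
    have h1 : (⋃ i, σ i '' B) = Set.range fun p : ℕ × B => σ p.1 p.2 := by
      ext y
      simp
    rw [h1]
    refine mk_range_le.trans_lt ?_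
    rw [mk_prod]
    refine S.monster.mul_lt ((lift_le_aleph0.2 mk_le_aleph0).trans_lt S.monster.uncountable) ?_
    rw [lift_uzero]
    exact (mk_le_mk_of_subset hBZ).trans_lt hZκ
  have hBX : ∀ i, ∀ x ∈ B, σ i x ∈ X := fun i x hx =>
    subset_cl _ (Set.mem_iUnion.2 ⟨i, x, hx, rfl⟩)
  let s : ℕ → {z : Z | z.1 ∈ B} → X := fun i z => ⟨σ i z.1.1, hBX i _ z.2⟩
  have D : AmalgamData (S.graph.induce Z) (S.graph.induce X) (threshold m n) {z : Z | z.1 ∈ A}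
      {z : Z | z.1 ∈ B} s := by
    refine ⟨S.free.of_isEmb (isEmb_val Z), S.free.of_isEmb (isEmb_val X), S.closed_induce hA,
      S.closed_induce hB, fun a ha b hb h => hadj a ha b hb h, fun i => ?_, fun i j x y hij h => ?_,
      fun i j x hx => Subtype.ext (hconst i j x.1 x.2 hx)⟩
    · exact ⟨fun x y h => Subtype.ext (Subtype.ext ((σ i).injective (congrArg Subtype.val h))),
        fun x => (S.isEmb_aut (σ i)).col _, fun x y => (S.isEmb_aut (σ i)).adj _ _⟩
    · obtain ⟨h1, h2⟩ := hco i j x.1 x.2 y.1 y.2 hij (congrArg Subtype.val h)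
      exact ⟨Subtype.ext (Subtype.ext h1), h2⟩
  obtain ⟨j, hj, hj'⟩ := S.exists_emb (amalgam D) (D.free S.threshold_pos)
    (mk_amalgamCarrier_lt S.monster.uncountable hZκ hXκ) X Sum.inl D.isEmb_inl D.closed_range_inl
  have hji : ∀ i, IsEmb (S.graph.induce Z) S.graph (j ∘ amalgamMap s i) := fun i =>
    hj.comp (D.isEmb_map i)
  have hZc := S.complete.induce S.threshold_pos hZ
  have hval : S.IsClosed (Set.range (Subtype.val : Z → M)) := by rwa [Subtype.range_coe]
  choose τ hτ using fun i => S.exists_aut_of_emb hZκ (isEmb_val Z) (hji i) hval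
    (S.closed_range (hji i) hZc)
  refine ⟨τ, fun i x hx => ?_, fun i k x hx hxA => ?_, fun i k x hx y hy hik h => ?_⟩
  · have := hτ i ⟨x, hBZ hx⟩
    rw [Function.comp_apply, amalgamMap_of_mem (show (⟨x, hBZ hx⟩ : Z) ∈ {z : Z | z.1 ∈ B} from hx), hj'] at this
    exact this
  · have h1 := hτ i ⟨x, hx⟩
    have h2 := hτ k ⟨x, hx⟩
    rw [Function.comp_apply, D.map_const (j := k) (show (⟨x, hx⟩ : Z) ∈ {z : Z | z.1 ∈ A} from hxA)] at h1
    exact h1.trans h2.symm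
  · have h1 := hτ i ⟨x, hx⟩
    have h2 := hτ k ⟨y, hy⟩
    obtain ⟨h3, h4⟩ := D.eq_of_map_eq (hj.inj ((h1.symm.trans h).trans h2))
    exact ⟨congrArg Subtype.val h3, h4.resolve_left hik⟩

/-- A non-algebraic vertex has infinitely many conjugates, while finitely many algebraic neighbours
have only finitely many joint positions. By the pigeonhole principle infinitely many conjugates
share the images of these neighbours, so a forbidden graph appears. -/
theorem closed_acl {C : Set M} (hC : #C < κ) : S.IsClosed (acl lang C) := by
  classical
  intro x P hP hadj hcard
  by_contra hx
  obtain ⟨P', hPP', hP'⟩ := Finset.exists_subset_card_eq hcard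
  obtain ⟨σ, hσ, hinj⟩ := S.monster.exists_aut_of_not_mem_acl hC hx
  have hfin : (Set.pi Set.univ fun p : P' => {y | ∃ σ : M ≃[lang] M, (∀ c ∈ C, σ c = c) ∧
      σ p = y}).Finite := Set.Finite.pi fun p => finite_orbit_of_mem_acl (hP (hPP' p.2))
  have := hfin.to_subtype
  obtain ⟨f, hf⟩ := Finite.exists_infinite_fiber fun i =>
    (⟨fun p : P' => σ i p, fun p _ => ⟨σ i, hσ i, rfl⟩⟩ : Set.pi Set.univ fun p : P' =>
      {y | ∃ σ : M ≃[lang] M, (∀ c ∈ C, σ c = c) ∧ σ p = y})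
  obtain ⟨I, hI, hcardI⟩ := (Set.infinite_coe_iff.1 hf).exists_subset_card_eq
    (threshold m n (!S.graph.col x))
  replace hI : ∀ i ∈ I, ∀ p : P', σ i p = f.1 p := fun i hi p =>
    congrFun (congrArg Subtype.val (hI hi)) p
  obtain ⟨i, hi⟩ := Finset.card_pos.1 ((S.threshold_pos (!S.graph.col x)).trans_eq hcardI.symm)
  refine S.free (S.graph.col x) (P'.image (σ i)) (I.image fun i => σ i x) ⟨?_, ?_, ?_, ?_⟩
  · intro q hq
    obtain ⟨j, -, rfl⟩ := Finset.mem_image.1 hq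
    exact (S.isEmb_aut (σ j)).col x
  · rw [Finset.card_image_of_injective _ (σ i).injective, hP']
  · rw [Finset.card_image_of_injective _ hinj, hcardI]
  · intro p hp q hq
    obtain ⟨j, hj, rfl⟩ := Finset.mem_image.1 hq
    obtain ⟨p, hpP, rfl⟩ := Finset.mem_image.1 hp
    rw [hI i hi ⟨p, hpP⟩, ← hI j hj ⟨p, hpP⟩]
    exact ((S.isEmb_aut (σ j)).adj _ _).2 (hadj p (hPP' hpP))

/-- An element outside the closure of `C` can be moved to infinitely many places: amalgamate
infinitely many copies of cl(Cx) over cl(C), both the constant part and the prescribed part being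
cl(C). The other inclusion is `closed_acl`. -/
theorem acl_eq_closure {C : Set M} (hC : #C < κ) : acl lang C = S.closure C := by
  refine Set.Subset.antisymm (fun x hx => ?_) (cl_subset (S.closed_acl hC) (subset_acl C))
  by_contra hxC
  have hCc : S.IsClosed (S.closure C) := cl_closed _
  obtain ⟨τ, h1, -, h3⟩ := S.exists_amalgam (Z := S.closure (C ∪ {x})) (cl_closed _)
    (S.closure_small (S.monster.union_lt hC S.monster.countable_lt))
    (cl_mono Set.subset_union_left) hCc hCc (fun a ha _ _ _ => Or.inl ha)
    (fun _ => Language.Equiv.refl lang M) (fun i j x hx y hy _ h => ⟨h, hx⟩)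
    (fun _ _ _ _ _ => rfl)
  refine not_mem_acl_of_injective τ (fun i c hc => h1 i c (subset_cl _ hc)) (fun i j hij => ?_) hx
  by_contra hne
  have hx' : x ∈ S.closure (C ∪ {x}) := subset_cl _ (Or.inr rfl)
  exact hxC (h3 i j x hx' x hx' hne hij).2

end GenericMonster

end Incidence


/-! ### Sequences of automorphisms all of whose pairs act alike. -/

namespace IndepRel

open FirstOrder.Language

variable {L : FirstOrder.Language.{u, v}} {N : Type w} [L.Structure N] {κ : Cardinal.{w}}

theorem sameType_of_imp {C : Set N} {ι : Type*} {a a' : ι → N}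
    (h : ∀ φ : L.Formula (C ⊕ ι), φ.Realize (Sum.elim Subtype.val a) →
      φ.Realize (Sum.elim Subtype.val a')) : SameType L C a a' := by
  rw [sameType_iff]
  refine fun φ => ⟨h φ, fun h2 => ?_⟩
  by_contra h3
  have := h (∼φ) (by rwa [Formula.realize_not])
  rw [Formula.realize_not] at this
  exact this h2

theorem SameType.mono {C D : Set N} (h : C ⊆ D) {ι : Type*} {a a' : ι → N}
    (ha : SameType L D a a') : SameType L C a a' := by
  rw [sameType_iff] at ha ⊢
  intro φ
  have := ha (φ.relabel (Sum.map (Set.inclusion h) id))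
  rw [Formula.realize_relabel, Formula.realize_relabel, Sum.elim_comp_map, Sum.elim_comp_map]
    at this
  exact this

/-- All pairs from the sequence of automorphisms act in the same way on `S`. -/
def PairHomogeneous (S : Set N) (ρ : ℕ → (N ≃[L] N)) : Prop :=
  ∀ φ : L.Formula (S ⊕ S), ∀ i j k l, i < j → k < l →
    (φ.Realize (Sum.elim (fun x => ρ i x) fun x => ρ j x) ↔
      φ.Realize (Sum.elim (fun x => ρ k x) fun x => ρ l x))

theorem IsMonster.small_empty (hM : IsMonster L N κ) : #(∅ : Set N) < κ := by
  rw [mk_eq_zero]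
  exact aleph0_pos.trans hM.uncountable

theorem PairHomogeneous.comp {S : Set N} {ρ : ℕ → (N ≃[L] N)} (h : PairHomogeneous S ρ)
    (θ : N ≃[L] N) : PairHomogeneous S fun i => θ.comp (ρ i) := by
  intro φ i j k l hij hkl
  have key : ∀ i j, φ.Realize (Sum.elim (fun x : S => θ (ρ i x)) fun x => θ (ρ j x)) ↔
      φ.Realize (Sum.elim (fun x : S => ρ i x) fun x => ρ j x) := by
    intro i j
    rw [← realize_aut θ φ (Sum.elim (fun x : S => ρ i x) fun x : S => ρ j x)]
    have : (fun x => θ (Sum.elim (fun x : S => ρ i x) (fun x : S => ρ j x) x)) =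
        Sum.elim (fun x : S => θ (ρ i x)) fun x : S => θ (ρ j x) := by
      funext x
      rcases x with x | x <;> rfl
    rw [this]
  exact (key i j).trans ((h φ i j k l hij hkl).trans (key k l).symm)

/-- The second clause records what survives the passage to a homogeneous sequence: everything true
of all subsequences of the original one. -/
theorem IsMonster.exists_pairHomogeneous (hM : IsMonster L N κ) {S : Set N} (hS : #S < κ)
    (σ : ℕ → (N ≃[L] N)) : ∃ ρ : ℕ → (N ≃[L] N), PairHomogeneous S ρ ∧
      ∀ φ : L.Formula (ℕ × S),
        (∀ f : ℕ → ℕ, StrictMono f → φ.Realize fun p => σ (f p.1) p.2) →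
        φ.Realize fun p => ρ p.1 p.2 := by
  obtain ⟨w, hw1, hw2⟩ := hM.exists_pair_homogeneous hS fun i (x : S) => σ i x
  have hex : ∀ i, ∃ ρ : N ≃[L] N, ∀ x : S, ρ x = w i x := by
    intro i
    obtain ⟨ρ, -, hρ⟩ := hM.exists_aut hM.small_empty hS (a := (Subtype.val : S → N)) (a' := w i)
      (sameType_empty_of_imp fun φ hφ => by
        have := hw2 (φ.relabel fun s => (i, s)) fun f _ => by
          rw [Formula.realize_relabel]
          exact (realize_aut (σ (f i)) φ _).2 hφ
        rwa [Formula.realize_relabel] at this)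
    exact ⟨ρ, hρ⟩
  choose ρ hρ using hex
  have hρ' : ∀ i, (fun x : S => ρ i x) = w i := fun i => funext (hρ i)
  refine ⟨ρ, fun φ i j k l hij hkl => ?_, fun φ hφ => ?_⟩
  · simp only [hρ']
    exact hw1 φ i j k l hij hkl
  · simp only [hρ]
    exact hw2 φ hφ

/-- One coincidence at i < j spreads to all increasing pairs. Then `y` has the same image under `ρ
1` and `ρ 2`, both being equal to the image of `x` under `ρ 0`; so `y` is constant along the
sequence, and injectivity of `ρ 0` gives x = y. -/
theorem PairHomogeneous.eq_of_map_eq {S : Set N} {ρ : ℕ → (N ≃[L] N)} (h : PairHomogeneous S ρ)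
    {i j : ℕ} (hij : i ≠ j) {x y : N} (hx : x ∈ S) (hy : y ∈ S) (hxy : ρ i x = ρ j y) :
    x = y ∧ ∀ k l, ρ k x = ρ l x := by
  have key : ∀ {x y}, x ∈ S → y ∈ S → ∀ {i j}, i < j → ρ i x = ρ j y →
      ∀ k l, k < l → ρ k x = ρ l y := by
    intro x y hx hy i j hij h1 k l hkl
    have := h (Term.equal (Term.var (Sum.inl ⟨x, hx⟩)) (Term.var (Sum.inr ⟨y, hy⟩))) i j k l hij hkl
    simpa [Formula.realize_equal, h1] using this
  have key2 : ∀ {x y}, x ∈ S → y ∈ S → ∀ {i j}, i < j → ρ i x = ρ j y →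
      x = y ∧ ∀ k l, ρ k x = ρ l x := by
    intro x y hx hy i j hij h1
    have h2 := key hx hy hij h1
    have h3 : ρ 1 y = ρ 2 y := (h2 0 1 one_pos).symm.trans (h2 0 2 two_pos)
    have h4 := key hy hy Nat.one_lt_two h3
    have h5 : x = y := (ρ 0).injective ((h2 0 1 one_pos).trans (h4 0 1 one_pos).symm)
    subst h5
    refine ⟨rfl, fun k l => ?_⟩
    rcases lt_trichotomy k l with hkl | rfl | hkl
    · exact h2 k l hkl
    · rfl
    · exact (h2 l k hkl).symm
  rcases lt_or_gt_of_ne hij with h1 | h1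
  · exact key2 hx hy h1 hxy
  · obtain ⟨rfl, h2⟩ := key2 hy hx h1 hxy.symm
    exact ⟨rfl, h2⟩

end IndepRel

/-! ### Separation, and keeping a set fixed while another one moves. -/

namespace Incidence

open FirstOrder.Language Filter IndepRel BiGraph

namespace GenericMonster

variable {m n : ℕ} {M : Type u} [lang.Structure M] {κ : Cardinal.{u}} (S : GenericMonster m n M κ)

/-- Over `K`, the closure of `A` meets `Z` only in `K` and has no edge to `Z` outside `K`. -/
def Separated (S : GenericMonster m n M κ) (K A Z : Set M) : Prop :=
  (∀ x ∈ S.closure (A ∪ K), x ∈ Z → x ∈ K) ∧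
    ∀ x ∈ S.closure (A ∪ K), ∀ y ∈ Z, S.graph.Adj x y → x ∈ K ∨ y ∈ K

/-- The copies of cl(AZ) are amalgamated with constant part cl(AK), where `K` is the part of `Z`
that the sequence does not move. Separation over `K` gives the conditions on edges and coincidences.
As `K` depends on the sequence, separation is required over all closed sets between `C` and `Z`. -/
theorem exists_aut_fixing {Z A C : Set M} (hZ : S.IsClosed Z) (hZκ : #Z < κ) (hAκ : #A < κ)
    (hCZ : C ⊆ Z) (hind : ∀ K, C ⊆ K → K ⊆ Z → S.IsClosed K → S.Separated K A Z)
    (ρ : ℕ → (M ≃[lang] M)) (hρ : PairHomogeneous Z ρ) (hC : ∀ c ∈ C, ρ 0 c = ρ 1 c) :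
    ∃ τ : ℕ → (M ≃[lang] M), (∀ i, ∀ x ∈ Z, τ i x = ρ i x) ∧ ∀ i j, ∀ a ∈ A, τ i a = τ j a := by
  -- By pair-homogeneity this intersection is the set of points of `Z` on which all `ρ i` agree.
  -- Written in this form it is visibly closed.
  let K : Set M := Z ∩ (fun x => (ρ 0).symm (ρ 1 x)) '' Z
  have hKmem : ∀ x, x ∈ K ↔ x ∈ Z ∧ ρ 0 x = ρ 1 x := by
    intro x
    constructor
    · rintro ⟨hx, y, hy, rfl⟩
      have h1 : ρ 0 ((ρ 0).symm (ρ 1 y)) = ρ 1 y := (ρ 0).apply_symm_apply _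
      obtain ⟨h2, h3⟩ := hρ.eq_of_map_eq zero_ne_one hx hy h1
      exact ⟨hx, h3 0 1⟩
    · rintro ⟨hx, h⟩
      exact ⟨hx, x, hx, by simp only [← h]; exact (ρ 0).symm_apply_apply x⟩
  have hK : S.IsClosed K := by
    refine hZ.inter ?_
    have := S.closed_image ((ρ 0).symm.comp (ρ 1)) hZ
    exact this
  obtain ⟨hs1, hs2⟩ := hind K (fun c hc => (hKmem c).2 ⟨hCZ hc, hC c hc⟩)
    (fun x hx => hx.1) hK
  obtain ⟨τ, h1, h2, -⟩ := S.exists_amalgam (Z := S.closure (A ∪ Z)) (A := S.closure (A ∪ K))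
    (B := Z) (cl_closed _) (S.closure_small (S.monster.union_lt hAκ hZκ))
    (Set.subset_union_right.trans (subset_cl _)) (cl_closed _) hZ
    (fun a ha b hb h => (hs2 a ha b hb h).imp (fun h => h.1) fun h => subset_cl _ (Or.inr h)) ρ
    (fun i j x hx y hy hij h => by
      obtain ⟨h1, h2⟩ := hρ.eq_of_map_eq hij hx hy h
      exact ⟨h1, subset_cl _ (Or.inr ((hKmem x).2 ⟨hx, h2 0 1⟩))⟩)
    (fun i j x hx hxK => by
      rcases eq_or_ne i j with rfl | hij
      · rfl
      · exact (hρ.eq_of_map_eq zero_ne_one hx hx ((hKmem x).1 (hs1 x hxK hx)).2).2 i j)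
  exact ⟨τ, h1, fun i j a ha => h2 i j a (subset_cl _ (Or.inl ha)) (subset_cl _ (Or.inl ha))⟩

end GenericMonster

end Incidence


/-! ### Forking independence implies thorn independence. -/

namespace Incidence

open FirstOrder.Language Filter IndepRel BiGraph

namespace GenericMonster

variable {m n : ℕ} {M : Type u} [lang.Structure M] {κ : Cardinal.{u}} (S : GenericMonster m n M κ)

/-- If `e` is algebraic over F and `a` but not over F, an indiscernible sequence of conjugates of
`b` can fix F and move `e` infinitely often. Dividing independence provides a single `a'` compatible
with all of them, which yields infinitely many conjugates of `e` over F and `a`. The tuple `b` must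
enumerate a closed set, so that F and `e` are among its coordinates. -/
theorem mIndep_of_dividingIndep {ι : Type u} {C B D : Set M} (hι : #ι < κ)
    (hC : #C < κ) (hB : #B < κ) (hCD : C ⊆ D) (hBD : B ⊆ D) (hD : S.IsClosed D) (hDκ : #D < κ)
    {β : Type u} (hβ : #β < κ) (b : β → M) (hDb : D ⊆ Set.range b)
    {a : ι → M} (h : DividingIndep lang C a b) : MIndep lang C (Set.range a) B := by
  intro F hCF hFB
  have hFD : F ⊆ D := by
    rw [S.acl_eq_closure (S.monster.union_lt hB hC)] at hFB
    exact hFB.trans (cl_subset hD (Set.union_subset hBD hCD))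
  have hFκ : #F < κ := (mk_le_mk_of_subset hFD).trans_lt hDκ
  refine Set.Subset.antisymm ?_ (Set.subset_inter (acl_mono Set.subset_union_left)
    (acl_mono Set.subset_union_left))
  rintro e ⟨he1, he2⟩
  by_contra he
  have heD : e ∈ D := by
    rw [S.acl_eq_closure (S.monster.union_lt hFκ hB)] at he2
    exact cl_subset hD (Set.union_subset hFD hBD) he2
  obtain ⟨σ, hσ, hinj⟩ := S.monster.exists_aut_of_not_mem_acl hFκ he
  obtain ⟨e', he'⟩ := hDb heD
  let z : ℕ → β → M := fun i x => σ i (b x)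
  let P : Set M := C ∪ Set.range fun p : ℕ × β => z p.1 p.2
  have hP : #P < κ := by
    refine S.monster.union_lt hC (mk_range_le.trans_lt ?_)
    rw [mk_prod]
    refine S.monster.mul_lt ((lift_le_aleph0.2 mk_le_aleph0).trans_lt S.monster.uncountable) ?_
    rwa [lift_uzero]
  -- The limit keeps both features of `z`: the coordinates in `F` are constant, and those of `e` are
  -- pairwise distinct, since each value is taken by at most one `z i`.
  obtain ⟨w, hw, hw1, hw2⟩ := S.monster.exists_indiscernible hβ P hP z
    fun i s => Or.inr ⟨(i, s), rfl⟩
  have hCP : C ⊆ P := Set.subset_union_left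
  have hind : Indiscernible lang C w := fun k f g hf hg => (hw k f g hf hg).mono hCP
  have htp : ∀ i, SameType lang C (w i) b := fun i => SameType.symm (sameType_of_imp fun φ hφ => by
    have := hw1 (φ.relabel (Sum.map (Set.inclusion hCP) id)) (Eventually.of_forall fun i => by
      rw [Formula.realize_relabel, Sum.elim_comp_map]
      exact (sameType_iff.1 (sameType_of_aut (σ i) (fun c hc => hσ i c (hCF hc))
        fun _ => rfl) φ).1 hφ) i
    rw [Formula.realize_relabel, Sum.elim_comp_map] at this
    exact this)
  obtain ⟨a', ha'⟩ := h w hind htp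
  have hτ : ∀ i, ∃ τ : M ≃[lang] M, (∀ c ∈ C, τ c = c) ∧ (∀ x, τ (a x) = a' x) ∧
      ∀ x, τ (b x) = w i x := by
    intro i
    obtain ⟨τ, h1, h2⟩ := S.monster.exists_aut hC
      (by rw [mk_sum, lift_id, lift_id]; exact S.monster.add_lt hι hβ) (ha' i).symm
    exact ⟨τ, h1, fun x => h2 (Sum.inl x), fun x => h2 (Sum.inr x)⟩
  choose τ hτC hτa hτb using hτ
  have hwF : ∀ i, ∀ x, b x ∈ F → w i x = b x := by
    intro i x hx
    have hxP : b x ∈ P := Or.inr ⟨(0, x), hσ 0 _ hx⟩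
    have := hw1 (eqF (Sum.inl ⟨b x, hxP⟩) (Sum.inr x)) (Eventually.of_forall fun j => by
      rw [realize_eqF]
      exact (hσ j _ hx).symm) i
    rw [realize_eqF] at this
    exact this.symm
  have hwe : Function.Injective fun i => w i e' := by
    refine injective_of_lt fun i j hij heq => ?_
    have := hw2 (∼(eqF (Sum.inl e') (Sum.inr e'))) (fun x => by
      simp only [Formula.realize_not, realize_eqF, Sum.elim_inl, Sum.elim_inr]
      have h1 : {i | x e' = z i e'}.Subsingleton := by
        intro i hi j hj
        refine hinj ?_
        simp only [Set.mem_ofPred_eq, z, he'] at hi hj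
        exact hi.symm.trans hj
      rw [← Nat.cofinite_eq_atTop]
      exact h1.finite.eventually_cofinite_notMem) i j hij
    simp only [Formula.realize_not, realize_eqF, Sum.elim_inl, Sum.elim_inr] at this
    exact this heq
  refine not_mem_acl_of_injective (fun i => (τ 0).symm.comp (τ i)) (fun i c hc => ?_)
    (fun i j hij => ?_) he1
  · rcases hc with hc | ⟨x, rfl⟩
    · obtain ⟨x, rfl⟩ := hDb (hFD hc)
      have h1 : τ i (b x) = τ 0 (b x) := by rw [hτb, hτb, hwF i x hc, hwF 0 x hc]
      change (τ 0).symm (τ i (b x)) = b x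
      rw [h1]
      exact (τ 0).symm_apply_apply _
    · change (τ 0).symm (τ i (a x)) = a x
      rw [hτa, ← hτa 0]
      exact (τ 0).symm_apply_apply _
  · refine hwe ?_
    have := (τ 0).symm.injective hij
    rw [← he'] at this
    rw [hτb, hτb] at this
    exact this

theorem thornIndep_of_forkingIndep (S : GenericMonster m n M κ) {A B C : Set M}
    (hA : #A < κ) (hB : #B < κ) (hC : #C < κ)
    (h : ForkingIndep lang κ C A B) : ThornIndep lang κ C A B := by
  intro B' hB' hBB'
  have hDκ := S.closure_small (S.monster.union_lt hB' hC)
  -- The tuple to be added is the closure of B'C, so that it contains every base allowed in the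
  -- definition of M-independence from B'.
  obtain ⟨a, h1, h2⟩ := h _ hDκ
  rw [Subtype.range_coe, Set.union_comm] at h1
  exact ⟨a, h1, S.mIndep_of_dividingIndep hA hC hB'
    (Set.subset_union_right.trans (subset_cl _)) (Set.subset_union_left.trans (subset_cl _))
    (cl_closed _) hDκ (by rw [mk_sum, lift_id, lift_id]; exact S.monster.add_lt hB hDκ) _
    (fun x hx => ⟨Sum.inr ⟨x, hx⟩, rfl⟩) h2⟩

end GenericMonster

end Incidence


/-! ### Adding pendant vertices and giving a vertex the maximal harmless number of neighbours. -/

namespace Incidence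

open FirstOrder.Language Filter IndepRel BiGraph

namespace BiGraph

variable {V : Type*} (G : BiGraph V) (N : Bool → ℕ)

/-- Add a vertex `i`, only adjacent to `f i`, for each index `i`. -/
def addLeaves {I : Type*} (f : I → V) : BiGraph (V ⊕ I) where
  col := Sum.elim G.col fun i => !G.col (f i)
  Adj x y := (∃ u v, x = Sum.inl u ∧ y = Sum.inl v ∧ G.Adj u v) ∨
    (∃ i, x = Sum.inr i ∧ y = Sum.inl (f i)) ∨ ∃ i, x = Sum.inl (f i) ∧ y = Sum.inr i
  symm := by
    rintro x y (⟨u, v, rfl, rfl, h⟩ | ⟨i, rfl, rfl⟩ | ⟨i, rfl, rfl⟩)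
    · exact Or.inl ⟨v, u, rfl, rfl, G.symm h⟩
    · exact Or.inr (Or.inr ⟨i, rfl, rfl⟩)
    · exact Or.inr (Or.inl ⟨i, rfl, rfl⟩)
  ne := by
    rintro x y (⟨u, v, rfl, rfl, h⟩ | ⟨i, rfl, rfl⟩ | ⟨i, rfl, rfl⟩)
    · exact G.ne h
    · simp
    · simp

variable {G N} {I : Type*} {f : I → V}

theorem isEmb_addLeaves : IsEmb G (G.addLeaves f) Sum.inl := by
  refine ⟨Sum.inl_injective, fun _ => rfl, fun x y => ⟨?_, fun h => Or.inl ⟨x, y, rfl, rfl, h⟩⟩⟩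
  rintro (⟨u, v, h1, h2, h⟩ | ⟨i, h1, -⟩ | ⟨i, -, h1⟩)
  · rwa [Sum.inl_injective h1, Sum.inl_injective h2]
  · cases h1
  · cases h1

theorem addLeaves_adj_inr {i : I} {y : V ⊕ I} (h : (G.addLeaves f).Adj (Sum.inr i) y) :
    y = Sum.inl (f i) := by
  rcases h with ⟨u, v, h1, -⟩ | ⟨i', h1, h2⟩ | ⟨i, h1, -⟩
  · cases h1
  · rw [h2, Sum.inr_injective h1]
  · cases h1

theorem addLeaves_adj_leaf (i : I) : (G.addLeaves f).Adj (Sum.inl (f i)) (Sum.inr i) :=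
  Or.inr (Or.inr ⟨i, rfl, rfl⟩)

/-- A leaf has a single neighbour, but a vertex of a forbidden graph has at least two if the
threshold of its colour is at least two. -/
theorem Free.addLeaves (hG : G.Free N) (hN : ∀ c, 0 < N c) (hf : ∀ i, 2 ≤ N (!G.col (f i))) :
    (G.addLeaves f).Free N := by
  have key : ∀ c P Q, (G.addLeaves f).Full N c P Q → ∀ q ∈ Q, ∃ u, Sum.inl u = q := by
    rintro c P Q ⟨h1, h2, h3, h4⟩ (u | i) hq
    · exact ⟨u, rfl⟩
    · have hP : P ⊆ {Sum.inl (f i)} := fun p hp => by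
        rw [Finset.mem_singleton]
        exact addLeaves_adj_inr (h4 p hp _ hq)
      have := Finset.card_le_card hP
      rw [h2, ← h1 _ hq, Finset.card_singleton] at this
      exact absurd ((hf i).trans this) (by norm_num)
  exact fun c P Q h => hG.freeOn_range isEmb_addLeaves c P Q (key _ Q P (h.swap hN)) (key c P Q h) h

end BiGraph

namespace GenericMonster

variable {m n : ℕ} {M : Type u} [lang.Structure M] {κ : Cardinal.{u}} (S : GenericMonster m n M κ)

theorem closed_image_of_emb {V : Type*} {G : BiGraph V} {j : V → M} (hj : IsEmb G S.graph j)
    (hG : G.Complete (threshold m n)) {T : Set V} (hT : G.Closed (threshold m n) T) :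
    S.IsClosed (j '' T) := by
  intro x P hP hadj hcard
  obtain ⟨y, rfl⟩ := S.closed_range hj hG x P (hP.trans (Set.image_subset_range _ _)) hadj hcard
  refine ⟨y, hj.mem_of_closed hT (fun p hp => hP hp) hadj ?_, rfl⟩
  rwa [hj.col] at hcard

/-- Free completions of small extensions of a closed set can be found in the model. -/
theorem exists_completed_emb {Z : Set M} (hZ : S.IsClosed Z) {V : Type u} {G : BiGraph V}
    (hV : #V < κ) (hG : G.Free (threshold m n)) {f : Z → V} (hf : IsEmb (S.graph.induce Z) G f) :
    ∃ j : V → M, IsEmb G S.graph j ∧ (∀ z, j (f z) = z) ∧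
      ∀ X, G.Closed (threshold m n) X → ∃ T, S.IsClosed T ∧ (∀ v, j v ∈ T ↔ v ∈ X) ∧
        ∀ t ∈ T, (∀ x ∈ X, t ≠ j x) → ∀ v, S.graph.Adj t (j v) → v ∈ X := by
  obtain ⟨W, H, i, hi, hH, hHc, hW, hT⟩ := exists_freeCompletion S.threshold_pos hG
  obtain ⟨j, hj, hj'⟩ := S.exists_emb H hH
    (hW.trans_lt (max_lt hV S.monster.uncountable)) Z (i ∘ f) (hi.comp hf)
    ((S.complete.induce S.threshold_pos hZ).closed_range S.threshold_pos (hi.comp hf) hH)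
  refine ⟨j ∘ i, hj.comp hi, hj', fun X hX => ?_⟩
  obtain ⟨T, h1, h2, h3⟩ := hT X hX
  refine ⟨j '' T, S.closed_image_of_emb hj hHc h1, fun v => ?_, ?_⟩
  · rw [Function.comp_apply, hj.inj.mem_set_image, h2]
  · rintro _ ⟨t, ht, rfl⟩ h4 v h5
    exact h3 t ht (fun x hx h => h4 x hx (congrArg j h)) v ((hj.adj _ _).1 h5)

/-- A vertex outside a closed set can be given the largest number of neighbours that do not
make it algebraic. -/
theorem exists_neighbours {Z K : Set M} (hZ : S.IsClosed Z) (hZκ : #Z < κ) (hK : S.IsClosed K)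
    (hKZ : K ⊆ Z) {l : M} (hl : l ∈ Z) (hlK : l ∉ K)
    (hN : 2 ≤ threshold m n (!S.graph.col l)) :
    ∃ Q P : Finset M, (∀ p ∈ P, p ∈ K ∨ p ∈ Q) ∧ (∀ p ∈ P, S.graph.Adj l p) ∧
      P.card + 1 = threshold m n (S.graph.col l) ∧ l ∉ S.closure (K ∪ Q) := by
  classical
  have hfin : {x ∈ K | S.graph.Adj l x}.Finite := by
    by_contra h
    obtain ⟨P, hP, hP'⟩ := Set.Infinite.exists_subset_card_eq h (threshold m n (S.graph.col l))
    exact hlK (hK l P (fun p hp => (hP hp).1) (fun p hp => (hP hp).2) hP'.ge)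
  let R := hfin.toFinset
  have hR : ∀ x, x ∈ R ↔ x ∈ K ∧ S.graph.Adj l x := fun x => by simp [R]
  have hRcard : R.card < threshold m n (S.graph.col l) := by
    by_contra h
    exact hlK (hK l R (fun p hp => ((hR p).1 hp).1) (fun p hp => ((hR p).1 hp).2) (not_lt.1 h))
  -- The number of neighbours still missing: with those already in `K`, the vertex `l` will have
  -- exactly one neighbour too few to be determined.
  let k := threshold m n (S.graph.col l) - 1 - R.card
  let l' : Z := ⟨l, hl⟩
  let I := ULift.{u} (Fin k)
  let G := (S.graph.induce Z).addLeaves fun _ : I => l'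
  have hV : #(Z ⊕ I) < κ := by
    rw [mk_sum, lift_id, lift_id]
    exact S.monster.add_lt hZκ S.monster.countable_lt
  obtain ⟨j, hj, hj', hT⟩ := S.exists_completed_emb hZ hV
    ((S.free.of_isEmb (isEmb_val Z)).addLeaves (f := fun _ : I => l')
      S.threshold_pos fun _ => hN) isEmb_addLeaves
  -- `K` together with all leaves is closed: `l` has `R.card + k` neighbours there, one below its
  -- threshold, and other vertices of `Z` see no leaf. So `l` stays outside the closure of `K` and
  -- the leaves.
  let X : Set (Z ⊕ I) := {y | Sum.elim (fun z : Z => z.1 ∈ K) (fun _ => True) y}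
  have hX : G.Closed (threshold m n) X := by
    rintro (z | i) P hP hadj hcard
    · by_contra hz
      have h1 : ∀ x ∈ P.toLeft, x.1 ∈ K ∧ S.graph.Adj z x := fun x hx => by
        rw [Finset.mem_toLeft] at hx
        exact ⟨hP hx, (isEmb_addLeaves.adj z x).1 (hadj _ hx)⟩
      have h2 := P.card_toLeft_add_card_toRight
      have h3 : (P.toLeft.map ⟨_, Subtype.val_injective⟩).card = P.toLeft.card :=
        Finset.card_map _
      by_cases hzl : z = l'
      · subst hzl
        have h4 : P.toRight.card ≤ k := (Finset.card_le_univ _).trans (by simp [I])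
        have h5 : (P.toLeft.map ⟨_, Subtype.val_injective⟩) ⊆ R := by
          intro x hx
          obtain ⟨y, hy, rfl⟩ := Finset.mem_map.1 hx
          exact (hR _).2 (h1 y hy)
        have h6 := Finset.card_le_card h5
        change threshold m n (S.graph.col l) ≤ P.card at hcard
        omega
      · refine hz (hK z (P.toLeft.map ⟨_, Subtype.val_injective⟩) ?_ ?_ ?_)
        · intro x hx
          obtain ⟨y, hy, rfl⟩ := Finset.mem_map.1 hx
          exact (h1 y hy).1
        · intro x hx
          obtain ⟨y, hy, rfl⟩ := Finset.mem_map.1 hx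
          exact (h1 y hy).2
        · have h4 : P.toRight = ∅ := by
            refine Finset.eq_empty_of_forall_notMem fun i hi => hzl ?_
            rw [Finset.mem_toRight] at hi
            exact Sum.inl_injective (addLeaves_adj_inr (G.symm (hadj _ hi)))
          rw [h4, Finset.card_empty] at h2
          change threshold m n (S.graph.col z) ≤ P.card at hcard
          omega
    · trivial
  obtain ⟨T, hT1, hT2, -⟩ := hT X hX
  let Q : Finset M := Finset.univ.image fun i : Fin k => j (Sum.inr ⟨i⟩)
  have hQ : ∀ x, x ∈ Q ↔ ∃ i, j (Sum.inr i) = x := fun x => by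
    simp only [Q, Finset.mem_image, Finset.mem_univ, true_and]
    exact ⟨fun ⟨i, hi⟩ => ⟨⟨i⟩, hi⟩, fun ⟨i, hi⟩ => ⟨i.down, hi⟩⟩
  refine ⟨Q, R ∪ Q, fun p hp => ?_, fun p hp => ?_, ?_, fun h => ?_⟩
  · exact (Finset.mem_union.1 hp).imp (fun h => ((hR p).1 h).1) id
  · rcases Finset.mem_union.1 hp with h | h
    · exact ((hR p).1 h).2
    · obtain ⟨i, rfl⟩ := (hQ p).1 h
      have := (hj.adj (Sum.inl l') (Sum.inr i)).2 (Or.inr (Or.inr ⟨i, rfl, rfl⟩))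
      rwa [hj'] at this
  · rw [Finset.card_union_of_disjoint, Finset.card_image_of_injective, Finset.card_univ,
      Fintype.card_fin]
    · omega
    · intro a b hab
      have := hj.inj hab
      exact ULift.up_injective (Sum.inr_injective this)
    · rw [Finset.disjoint_left]
      intro x hx hxQ
      obtain ⟨i, rfl⟩ := (hQ x).1 hxQ
      have h1 := hKZ ((hR _).1 hx).1
      have h2 := hj.inj (hj' ⟨_, h1⟩)
      cases h2
  · have h1 : S.closure (K ∪ Q) ⊆ T := by
      refine cl_subset hT1 (Set.union_subset (fun x hx => ?_) fun x hx => ?_)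
      · have h2 := hj' ⟨x, hKZ hx⟩
        rw [← show j _ = x from h2, hT2]
        exact hx
      · obtain ⟨i, rfl⟩ := (hQ x).1 hx
        rw [hT2]
        trivial
    have h2 := h1 h
    rw [show l = j (Sum.inl l') from (hj' l').symm, hT2] at h2
    exact hlK h2

end GenericMonster

end Incidence


/-! ### Thorn independence implies forking independence. -/

namespace Incidence

open FirstOrder.Language Filter IndepRel BiGraph

namespace GenericMonster

variable {m n : ℕ} {M : Type u} [lang.Structure M] {κ : Cardinal.{u}} (S : GenericMonster m n M κ)

/-- Some small set `Z' ⊇ Z` is such that M-independence from `Z'` implies separation over all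
closed subsets of `Z`. -/
theorem exists_separating {Z : Set M} (hZ : S.IsClosed Z) (hZκ : #Z < κ) :
    ∃ Z' : Set M, #Z' < κ ∧ Z ⊆ Z' ∧ ∀ C A : Set M, #A < κ → MIndep lang C A Z' →
      ∀ K, C ⊆ K → K ⊆ Z → S.IsClosed K → S.Separated K A Z := by
  classical
  -- One finite set of new neighbours for each closed `K` ⊆ `Z` and each vertex of `Z ∖ K`. All of
  -- them are put into `Z'`, so that they may serve in the base.
  have hex : ∀ p : Set Z × Z, ∃ Q : Finset M, S.IsClosed (Subtype.val '' p.1) →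
      p.2.1 ∉ Subtype.val '' p.1 → 2 ≤ threshold m n (!S.graph.col p.2) →
      ∃ P : Finset M, (∀ x ∈ P, x ∈ Subtype.val '' p.1 ∨ x ∈ Q) ∧ (∀ x ∈ P, S.graph.Adj p.2 x) ∧
        P.card + 1 = threshold m n (S.graph.col p.2) ∧
        p.2.1 ∉ S.closure (Subtype.val '' p.1 ∪ Q) := by
    intro p
    by_cases h : S.IsClosed (Subtype.val '' p.1) ∧ p.2.1 ∉ Subtype.val '' p.1 ∧
        2 ≤ threshold m n (!S.graph.col p.2)
    · obtain ⟨Q, P, hQ⟩ := S.exists_neighbours hZ hZκ h.1 (by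
        rintro _ ⟨x, -, rfl⟩
        exact x.2) p.2.2 h.2.1 h.2.2
      exact ⟨Q, fun _ _ _ => ⟨P, hQ⟩⟩
    · exact ⟨∅, fun h1 h2 h3 => (h ⟨h1, h2, h3⟩).elim⟩
  choose Q hQ using hex
  let Z' : Set M := Z ∪ ⋃ p, (Q p : Set M)
  have hZ' : #Z' < κ := by
    refine S.monster.union_lt hZκ (mk_iUnion_le_sum_mk.trans_lt ?_)
    refine (sum_le_sum _ (fun _ => ℵ₀) fun p => ?_).trans_lt ?_
    · exact (Cardinal.lt_aleph0_of_finite _).le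
    · rw [sum_const', mk_prod, lift_id, lift_id, mk_set]
      exact S.monster.mul_lt (S.monster.mul_lt (S.monster.strongLimit.isStrongPrelimit hZκ) hZκ)
        S.monster.uncountable
  refine ⟨Z', hZ', Set.subset_union_left, fun C A hA h K hCK hKZ hK => ?_⟩
  have hCκ : #C < κ := (mk_le_mk_of_subset (hCK.trans hKZ)).trans_lt hZκ
  have hsub : Z' ⊆ acl lang (Z' ∪ C) := Set.subset_union_left.trans (subset_acl _)
  have hKA : ∀ F, C ⊆ F → F ⊆ Z' → ∀ x, x ∈ S.closure (F ∪ A) → x ∈ S.closure (F ∪ Z') →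
      x ∈ S.closure F := by
    intro F hCF hF x hx1 hx2
    have hFκ : #F < κ := (mk_le_mk_of_subset hF).trans_lt hZ'
    have h1 := h F hCF (hF.trans hsub)
    rw [AlgIndep, S.acl_eq_closure (S.monster.union_lt hFκ hA),
      S.acl_eq_closure (S.monster.union_lt hFκ hZ'), S.acl_eq_closure hFκ] at h1
    rw [← h1]
    exact ⟨hx1, hx2⟩
  have hKZ' : K ⊆ Z' := hKZ.trans Set.subset_union_left
  have h1 : ∀ x ∈ S.closure (A ∪ K), x ∈ S.closure (K ∪ Z') → x ∈ K := by
    intro x hx1 hx2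
    rw [Set.union_comm] at hx1
    have := hKA K hCK hKZ' x hx1 hx2
    rwa [show S.closure K = K from hK.cl_eq] at this
  refine ⟨fun x hx hxZ => h1 x hx (subset_cl _ (Or.inr (Or.inl hxZ))), fun x hx y hy hxy => ?_⟩
  by_contra hne
  push Not at hne
  obtain ⟨hxK, hyK⟩ := hne
  have hcol := S.graph.col_eq_not hxy
  by_cases hN : 2 ≤ threshold m n (S.graph.col x)
  · have hpK : Subtype.val '' {z : Z | z.1 ∈ K} = K := by
      ext z
      exact ⟨fun ⟨w, hw, e⟩ => e ▸ hw, fun hz => ⟨⟨z, hKZ hz⟩, hz, rfl⟩⟩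
    have h2 := hQ ({z : Z | z.1 ∈ K}, ⟨y, hy⟩)
    simp only [hpK, hcol, Bool.not_not] at h2
    obtain ⟨P, hP1, hP2, hP3, hP4⟩ := h2 hK hyK hN
    set q := Q ({z : Z | z.1 ∈ K}, ⟨y, hy⟩)
    have hqZ' : (q : Set M) ⊆ Z' := fun z hz =>
      Or.inr (Set.mem_iUnion.2 ⟨({z : Z | z.1 ∈ K}, ⟨y, hy⟩), hz⟩)
    have hxq : x ∉ S.closure (K ∪ q) := fun hxq => hxK (h1 x hx (cl_mono
      (Set.union_subset_union_right K hqZ') hxq))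
    -- Over the base `K ∪ q`, the vertex `y` has N(col y) - 1 neighbours in the base, and `x` is one
    -- more. So `y` is algebraic over the base and `A`, and M-independence puts it in the closure of
    -- the base, which `hP4` forbids.
    refine hP4 (hKA (K ∪ q) (hCK.trans Set.subset_union_left) (Set.union_subset hKZ' hqZ') y ?_
      (subset_cl _ (Or.inr (Or.inl hy))))
    refine cl_closed _ y (insert x P) ?_ ?_ ?_
    · intro z hz
      rcases Finset.mem_insert.1 (Finset.mem_coe.1 hz) with rfl | hz
      · exact cl_mono (by
          rw [Set.union_comm]
          exact Set.union_subset_union_left A Set.subset_union_left) hx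
      · exact subset_cl _ (Or.inl (hP1 z hz))
    · intro z hz
      rcases Finset.mem_insert.1 hz with rfl | hz
      · exact S.graph.symm hxy
      · exact hP2 z hz
    · rw [Finset.card_insert_of_notMem, hP3, hcol]
      exact fun hxP => hxq (subset_cl _ (hP1 x hxP))
  · refine hxK (h1 x hx (subset_cl _ (Or.inr (Or.inl ?_))))
    refine hZ x {y} (by simpa using hy) (by simpa using hxy) ?_
    rw [Finset.card_singleton]
    omega

/-- The indiscernible sequence is extended to conjugates of `Z` and made pair-homogeneous;
`exists_aut_fixing` then gives a common image of `a` for all of them. -/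
theorem dividingIndep_of_separated {ι β : Type u} (hι : #ι < κ) (hβ : #β < κ) {C Z : Set M}
    (hZ : S.IsClosed Z) (hZκ : #Z < κ) (hCZ : C ⊆ Z) {a : ι → M} {b : β → M} (hb : ∀ x, b x ∈ Z)
    (h : ∀ K, C ⊆ K → K ⊆ Z → S.IsClosed K → S.Separated K (Set.range a) Z) :
    DividingIndep lang C a b := by
  have hCκ : #C < κ := (mk_le_mk_of_subset hCZ).trans_lt hZκ
  intro bs hbs htp
  have hσ : ∀ i, ∃ σ : M ≃[lang] M, (∀ c ∈ C, σ c = c) ∧ ∀ x, σ (b x) = bs i x := fun i =>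
    S.monster.exists_aut hCκ hβ (htp i).symm
  choose σ hσC hσb using hσ
  obtain ⟨ρ, hρ, hρ'⟩ := S.monster.exists_pairHomogeneous hZκ σ
  let c : C → Z := Set.inclusion hCZ
  let b' : β → Z := fun x => ⟨b x, hb x⟩
  have hρc : ∀ i, ∀ x ∈ C, ρ i x = ρ 0 x := by
    intro i x hx
    have := hρ' (eqF (i, c ⟨x, hx⟩) (0, c ⟨x, hx⟩)) fun f _ => by
      rw [realize_eqF]
      exact (hσC _ x hx).trans (hσC _ x hx).symm
    rwa [realize_eqF] at this
  -- Indiscernibility of `bs` over `C` makes all its subsequences look like `bs`, so passing to `ρ`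
  -- preserves the joint type of `C` and the images of `b`. The `ρ i` agree on `C` but need not fix
  -- it; the automorphism `θ` repairs this and restores `bs`.
  have htype : SameType lang (∅ : Set M)
      (Sum.elim (fun x : C => ρ 0 x) fun p : ℕ × β => ρ p.1 (b p.2))
      (Sum.elim (fun x : C => x.1) fun p : ℕ × β => bs p.1 p.2) := by
    refine SameType.symm (sameType_empty_of_imp fun φ hφ => ?_)
    have := hρ' (φ.relabel (Sum.elim (fun x => (0, c x)) fun p => (p.1, b' p.2))) fun f hf => by
      rw [Formula.realize_relabel]
      convert (hbs.realize_subsequence φ hf).2 hφ using 1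
      funext x
      rcases x with x | p
      · exact hσC _ x x.2
      · exact hσb _ _
    rw [Formula.realize_relabel] at this
    convert this using 1
    funext x
    rcases x with x | p <;> rfl
  obtain ⟨θ, -, hθ⟩ := S.monster.exists_aut S.monster.small_empty (by
    rw [mk_sum, lift_id, lift_id, mk_prod, lift_uzero]
    exact S.monster.add_lt hCκ (S.monster.mul_lt
      ((lift_le_aleph0.2 mk_le_aleph0).trans_lt S.monster.uncountable) hβ)) htype
  have hθC : ∀ i, ∀ x ∈ C, θ (ρ i x) = x := fun i x hx => by
    rw [hρc i x hx]
    exact hθ (Sum.inl ⟨x, hx⟩)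
  obtain ⟨τ, hτ1, hτ2⟩ := S.exists_aut_fixing hZ hZκ (mk_range_le.trans_lt hι) hCZ h
    (fun i => θ.comp (ρ i)) (hρ.comp θ) fun x hx => (hθC 0 x hx).trans (hθC 1 x hx).symm
  refine ⟨fun x => τ 0 (a x), fun i => SameType.symm (sameType_of_aut (τ i) (fun x hx => ?_) ?_)⟩
  · rw [hτ1 i x (hCZ hx)]
    exact hθC i x hx
  · rintro (x | x)
    · exact hτ2 i 0 _ ⟨x, rfl⟩
    · change τ i (b x) = bs i x
      rw [hτ1 i _ (hb x)]
      exact hθ (Sum.inr (i, x))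

theorem forkingIndep_of_thornIndep (S : GenericMonster m n M κ) {A B C : Set M} (hA : #A < κ)
    (hB : #B < κ) (hC : #C < κ) (h : ThornIndep lang κ C A B) : ForkingIndep lang κ C A B := by
  intro D hD
  let Z : Set M := S.closure (B ∪ C ∪ D)
  have hZ : Z = S.closure (B ∪ C ∪ D) := rfl
  have hBCD := subset_cl (G := S.graph) (N := threshold m n) (B ∪ C ∪ D)
  have hZκ : #Z < κ := S.closure_small (S.monster.union_lt (S.monster.union_lt hB hC) hD)
  -- The extension in the definition of thorn independence is applied to `Z'` rather than to `Z`,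
  -- because separation from `Z` needs the auxiliary neighbours.
  obtain ⟨Z', hZ'κ, hZZ', hsep⟩ := S.exists_separating (cl_closed _) hZκ
  obtain ⟨a, ha, hM⟩ := h Z' hZ'κ (fun x hx => hZZ' (hBCD (Or.inl (Or.inl hx))))
  refine ⟨a, by rwa [Subtype.range_coe, Set.union_comm], ?_⟩
  refine S.dividingIndep_of_separated hA
    (by rw [mk_sum, lift_id, lift_id]; exact S.monster.add_lt hB hD) (cl_closed _) hZκ
    (fun x hx => hBCD (Or.inl (Or.inr hx))) ?_ (hsep C _ (mk_range_le.trans_lt hA) hM)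
  rintro (x | x)
  · exact hBCD (Or.inl (Or.inl x.2))
  · exact hBCD (Or.inr x.2)

end GenericMonster

end Incidence


/-! ### Algebraicity through formulas; representatives and automorphisms of M^eq. -/

namespace IndepRel

open FirstOrder.Language

section Algebraic

variable {L : FirstOrder.Language.{u, v}} {N : Type w} [L.Structure N]

theorem mem_acl_iff {C : Set N} {b : N} : b ∈ acl L C ↔ ∃ φ : L.Formula (C ⊕ Unit),
    φ.Realize (Sum.elim Subtype.val fun _ => b) ∧
      {x : N | φ.Realize (Sum.elim Subtype.val fun _ => x)}.Finite := by
  constructor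
  · rintro ⟨s, hs, hd, hb⟩
    obtain ⟨φ, hφ⟩ := Set.definable_iff_exists_formula_sum.1 hd
    have h : ∀ y, (φ.relabel (Sum.map id fun _ => ())).Realize
        (Sum.elim (Subtype.val : C → N) fun _ : Unit => y) ↔ y ∈ s := fun y => by
      have := Set.ext_iff.1 hφ fun _ => y
      rw [Formula.realize_relabel, Sum.elim_comp_map]
      exact this.symm
    exact ⟨_, (h b).2 hb, hs.subset fun x hx => (h x).1 hx⟩
  · rintro ⟨φ, hφ, hfin⟩
    refine ⟨_, hfin, Set.definable_iff_exists_formula_sum.2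
      ⟨φ.relabel (Sum.map id fun _ => 0), ?_⟩, hφ⟩
    ext x
    simp only [Set.mem_ofPred_eq, Formula.realize_relabel, Sum.elim_comp_map]
    rfl

/-- Existential quantification over infinitely many variables, only finitely many of which
occur. -/
theorem exists_formula_exists [Nonempty N] {α S : Type*} (φ : L.Formula (α ⊕ S)) :
    ∃ ψ : L.Formula α, ∀ a : α → N, ψ.Realize a ↔ ∃ x : S → N, φ.Realize (Sum.elim a x) := by
  classical
  let F := {s : S // Sum.inr s ∈ φ.freeVarFinset}
  have : Finite F := Finite.of_injective
    (fun s : F => (⟨Sum.inr s.1, s.2⟩ : φ.freeVarFinset)) fun s t h =>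
      Subtype.ext (Sum.inr_injective (congrArg Subtype.val h))
  let r : S → Option F := fun s => if h : Sum.inr s ∈ φ.freeVarFinset then some ⟨s, h⟩ else none
  refine ⟨(φ.relabel (Sum.map id r)).iExs (Option F), fun a => ?_⟩
  rw [Formula.realize_iExs]
  simp only [Formula.realize_relabel, Sum.elim_comp_map]
  constructor
  · rintro ⟨z, hz⟩
    exact ⟨z ∘ r, hz⟩
  · rintro ⟨x, hx⟩
    refine ⟨fun o => o.elim (Classical.arbitrary N) fun s => x s, ?_⟩
    refine (realize_congr_freeVar φ ?_).1 hx
    rintro (i | s) hs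
    · rfl
    · simp [r, hs]

/-- If `e` is algebraic over `C` and `b`, this is seen by the type of `b` over `C` and `e`. -/
theorem mem_acl_of_sameType {C A : Set N} {e b b' : N} (he : e ∈ acl L (C ∪ {b})) (hC : C ⊆ A)
    (heA : e ∈ A) (h : SameType L A (fun _ : Unit => b') fun _ => b) :
    e ∈ acl L (C ∪ {b'}) := by
  classical
  obtain ⟨φ, hφ, hfin⟩ := mem_acl_iff.1 he
  let r : ∀ x : ↥(C ∪ {b}), C ⊕ Unit := fun x =>
    if hx : x.1 ∈ C then Sum.inl ⟨x, hx⟩ else Sum.inr ()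
  let χ : L.Formula ((C ⊕ Unit) ⊕ Unit) := φ.relabel (Sum.map r id)
  have hχ : ∀ x, χ.Realize (Sum.elim (Sum.elim Subtype.val fun _ => b) fun _ => x) ↔
      φ.Realize (Sum.elim Subtype.val fun _ => x) := by
    intro x
    rw [Formula.realize_relabel, Sum.elim_comp_map]
    have : (Sum.elim (Subtype.val : C → N) fun _ => b) ∘ r = Subtype.val := by
      funext y
      by_cases hy : y.1 ∈ C
      · simp [r, hy]
      · have h1 : r y = Sum.inr () := dif_neg hy
        rw [Function.comp_apply, h1]
        exact (y.2.resolve_left hy).symm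
    rw [this]
    rfl
  -- One more than the number of solutions over `b`. The formula `θ` says that there are at least
  -- `k` solutions; it fails for `b`, hence for `b'`, which bounds the number of solutions over
  -- `b'`.
  let k := hfin.toFinset.card + 1
  let θ : L.Formula (C ⊕ Unit) := Formula.iExs (Fin k)
    ((Formula.iInf fun p : {p : Fin k × Fin k // p.1 ≠ p.2} =>
        ∼(Term.equal (Term.var (Sum.inr p.1.1)) (Term.var (Sum.inr p.1.2)))) ⊓
      Formula.iInf fun i : Fin k => χ.relabel (Sum.map id fun _ => i))
  have hθ : ∀ a : C ⊕ Unit → N, θ.Realize a ↔ ∃ y : Fin k → N, Function.Injective y ∧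
      ∀ i, χ.Realize (Sum.elim a fun _ => y i) := by
    intro a
    simp only [θ, Formula.realize_iExs, Formula.realize_inf, Formula.realize_iInf,
      Formula.realize_not, Formula.realize_equal, Term.realize_var, Sum.elim_inr,
      Formula.realize_relabel, Sum.elim_comp_map, Subtype.forall, Prod.forall]
    refine exists_congr fun y => and_congr ⟨fun h i j hij => ?_, fun h i j hij h' => hij (h h')⟩
      Iff.rfl
    by_contra hne
    exact h i j hne hij
  have h1 : ∀ ψ : L.Formula (A ⊕ Unit), ψ.Realize (Sum.elim Subtype.val fun _ => b') ↔
      ψ.Realize (Sum.elim Subtype.val fun _ => b) := sameType_iff.1 h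
  have hθb' : ¬ θ.Realize (Sum.elim Subtype.val fun _ => b') := by
    have := h1 (θ.relabel (Sum.map (Set.inclusion hC) id))
    simp only [Formula.realize_relabel, Sum.elim_comp_map] at this
    have h2 : ((Subtype.val : A → N) ∘ Set.inclusion hC) = Subtype.val := rfl
    rw [h2] at this
    refine fun h3 => ?_
    obtain ⟨y, hy, hy'⟩ := (hθ _).1 (this.1 h3)
    have h4 := Finset.card_le_card_of_injOn (s := Finset.univ) (t := hfin.toFinset) y
      (fun i _ => by
        rw [Finset.mem_coe, Set.Finite.mem_toFinset]
        exact (hχ _).1 (hy' i)) hy.injOn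
    rw [Finset.card_univ, Fintype.card_fin] at h4
    omega
  have hχe : χ.Realize (Sum.elim (Sum.elim Subtype.val fun _ => b') fun _ => e) := by
    have := h1 (χ.relabel (Sum.elim (Sum.map (Set.inclusion hC) id) fun _ => Sum.inl ⟨e, heA⟩))
    simp only [Formula.realize_relabel] at this
    have h2 : ∀ c : N, (Sum.elim (Subtype.val : A → N) fun _ : Unit => c) ∘
        (Sum.elim (Sum.map (Set.inclusion hC) id) fun _ : Unit => Sum.inl ⟨e, heA⟩) =
        Sum.elim (Sum.elim Subtype.val fun _ => c) fun _ => e := by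
      intro c
      funext x
      rcases x with (x | x) | x <;> rfl
    rw [h2, h2] at this
    exact this.2 ((hχ e).2 hφ)
  refine mem_acl_iff.2 ⟨χ.relabel (Sum.map (Sum.elim (Set.inclusion Set.subset_union_left)
    fun _ => ⟨b', Or.inr rfl⟩) id), ?_⟩
  have h2 : (Subtype.val : ↥(C ∪ {b'}) → N) ∘ (Sum.elim (Set.inclusion Set.subset_union_left)
      fun _ : Unit => ⟨b', Or.inr rfl⟩) = Sum.elim Subtype.val fun _ => b' := by
    funext x
    rcases x with x | x <;> rfl
  simp only [Formula.realize_relabel, Sum.elim_comp_map, h2]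
  refine ⟨hχe, ?_⟩
  by_contra hinf
  refine hθb' ((hθ _).2 ?_)
  obtain ⟨s, hs, hk⟩ := Set.Infinite.exists_subset_card_eq hinf k
  let f := s.equivFinOfCardEq hk
  exact ⟨fun i => f.symm i, fun i j h => f.symm.injective (Subtype.ext h),
    fun i => hs (f.symm i).2⟩

end Algebraic

section Imaginaries

variable {L : FirstOrder.Language.{u, v}} {M : Type w} [L.Structure M]

/-- The number of coordinates of the tuples that represent the elements of a sort of `M^eq`;
`none` is the home sort. -/
def sortArity : Option (ImagSort L M) → ℕ
  | none => 1
  | some E => E.arity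

/-- The element of a sort of `M^eq` that is represented by a tuple. -/
def cls : ∀ s : Option (ImagSort L M), (Fin (sortArity s) → M) → EqCarrier L M
  | none, x => Sum.inl (x (0 : Fin 1))
  | some E, x => Sum.inr ⟨E, Quotient.mk E.setoid x⟩

/-- The formula that says that two tuples represent the same element of the sort. -/
def eqvFormula : ∀ s : Option (ImagSort L M), L.Formula (Fin (sortArity s) ⊕ Fin (sortArity s))
  | none => Term.equal (Term.var (Sum.inl (0 : Fin 1)))
    (Term.var (Sum.inr (0 : Fin 1)))
  | some E => E.formula

theorem exists_cls (c : EqCarrier L M) : ∃ s x, cls s x = c := by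
  rcases c with a | ⟨E, c⟩
  · exact ⟨none, fun _ => a, rfl⟩
  · obtain ⟨x, rfl⟩ := Quotient.exists_rep c
    exact ⟨some E, x, rfl⟩

theorem realize_eqvFormula (s : Option (ImagSort L M)) (x y : Fin (sortArity s) → M) :
    (eqvFormula s).Realize (Sum.elim x y) ↔ cls s x = cls s y := by
  rcases s with _ | E
  · simp only [eqvFormula, cls, Formula.realize_equal, Term.realize_var]
    exact Sum.inl_injective.eq_iff.symm
  · refine (Quotient.eq (r := E.setoid) (x := x) (y := y)).symm.trans ⟨fun h => ?_, fun h => ?_⟩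
    · exact congrArg (fun c : Quotient E.setoid => (Sum.inr ⟨E, c⟩ : EqCarrier L M)) h
    · have := Sum.inr_injective h
      simpa using this

/-- The map of `M^eq` induced by an automorphism of `M`. -/
def eqMap (σ : M ≃[L] M) : EqCarrier L M → EqCarrier L M
  | Sum.inl a => Sum.inl (σ a)
  | Sum.inr ⟨E, c⟩ => Sum.inr ⟨E, Quotient.map (fun x i => σ (x i)) (fun x y h => by
      change E.formula.Realize _
      have h1 := (realize_aut σ E.formula (Sum.elim x y)).2 h
      convert h1 using 1
      funext i
      rcases i with i | i <;> rfl) c⟩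

theorem eqMap_cls (σ : M ≃[L] M) (s : Option (ImagSort L M)) (x : Fin (sortArity s) → M) :
    eqMap σ (cls s x) = cls s fun i => σ (x i) := by
  rcases s with _ | E <;> rfl

theorem eqRelMap_eqMap (σ : M ≃[L] M) {k : ℕ} (r : EqRelSymb L M k) (z : Fin k → EqCarrier L M)
    (h : eqRelMap L M r z) : eqRelMap L M r fun i => eqMap σ (z i) := by
  have hsnoc : ∀ {k : ℕ} (x : Fin k → EqCarrier L M) (y : EqCarrier L M),
      (fun i => eqMap σ (Fin.snoc (α := fun _ => EqCarrier L M) x y i)) =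
        Fin.snoc (α := fun _ => EqCarrier L M) (fun i => eqMap σ (x i)) (eqMap σ y) :=
    fun x y => Fin.comp_snoc (eqMap σ) x y
  cases r with
  | home =>
    obtain ⟨x, hx⟩ := h
    exact ⟨σ x, (congrArg (eqMap σ) hx).trans rfl⟩
  | imag E =>
    obtain ⟨c, hc⟩ := h
    exact ⟨_, (congrArg (eqMap σ) hc).trans rfl⟩
  | rel R =>
    obtain ⟨x, hx, rfl⟩ := h
    exact ⟨fun i => σ (x i), (σ.map_rel R x).2 hx, rfl⟩
  | graph f =>
    obtain ⟨x, rfl⟩ := h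
    refine ⟨fun i => σ (x i), ?_⟩
    refine (hsnoc _ _).trans ?_
    have := σ.map_fun f x
    change _ = Fin.snoc (α := fun _ => EqCarrier L M) _ (Sum.inl (Structure.funMap f (σ ∘ x)))
    rw [← this]
    rfl
  | proj E =>
    obtain ⟨x, rfl⟩ := h
    exact ⟨fun i => σ (x i), hsnoc _ _⟩

theorem eqMap_comp (σ τ : M ≃[L] M) (c : EqCarrier L M) :
    eqMap σ (eqMap τ c) = eqMap (σ.comp τ) c := by
  obtain ⟨s, x, rfl⟩ := exists_cls c
  rw [eqMap_cls, eqMap_cls, eqMap_cls]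
  rfl

theorem eqMap_of_forall {σ τ : M ≃[L] M} {s : Option (ImagSort L M)} {x : Fin (sortArity s) → M}
    (h : ∀ i, σ (x i) = τ (x i)) : eqMap σ (cls s x) = eqMap τ (cls s x) := by
  rw [eqMap_cls, eqMap_cls]
  exact congrArg _ (funext h)

theorem eqMap_symm_eqMap (σ : M ≃[L] M) (c : EqCarrier L M) : eqMap σ.symm (eqMap σ c) = c := by
  obtain ⟨s, x, rfl⟩ := exists_cls c
  rw [eqMap_cls, eqMap_cls]
  exact congrArg _ (funext fun i => σ.symm_apply_apply _)

theorem eqMap_eqMap_symm (σ : M ≃[L] M) (c : EqCarrier L M) : eqMap σ (eqMap σ.symm c) = c := by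
  obtain ⟨s, x, rfl⟩ := exists_cls c
  rw [eqMap_cls, eqMap_cls]
  exact congrArg _ (funext fun i => σ.apply_symm_apply _)

/-- The automorphism of `M^eq` induced by an automorphism of `M`. -/
def eqAut (σ : M ≃[L] M) : EqCarrier L M ≃[eqLanguage L M] EqCarrier L M where
  toFun := eqMap σ
  invFun := eqMap σ.symm
  left_inv := eqMap_symm_eqMap σ
  right_inv := eqMap_eqMap_symm σ
  map_fun' f := nomatch f
  map_rel' r z := by
    refine ⟨fun h => ?_, eqRelMap_eqMap σ r z⟩
    have := eqRelMap_eqMap σ.symm r _ h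
    simp only [Function.comp_apply, eqMap_symm_eqMap] at this
    exact this

theorem eqAut_apply (σ : M ≃[L] M) (c : EqCarrier L M) : eqAut σ c = eqMap σ c := rfl

end Imaginaries

end IndepRel


/-! ### Relativization to the home sort, and imaginaries represented in a given set. -/

namespace IndepRel

open FirstOrder.Language

section Relativization

variable {L : FirstOrder.Language.{u, v}} {M : Type w} [L.Structure M]

variable (L) in
/-- The elements of the home sort. -/
def toEq (x : M) : EqCarrier L M := Sum.inl x

theorem toEq_injective : Function.Injective (toEq L : M → EqCarrier L M) := Sum.inl_injective

theorem eqMap_toEq (σ : M ≃[L] M) (x : M) : eqMap σ (toEq L x) = toEq L (σ x) := rfl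

variable (L M) in
/-- The symbol for the home sort. -/
def homeSymb : (eqLanguage L M).Relations 1 := EqRelSymb.home

theorem relMap_homeSymb (z : Fin 1 → EqCarrier L M) :
    Structure.RelMap (homeSymb L M) z ↔ ∃ x, z 0 = toEq L x := Iff.rfl

/-- The symbols of a relational language on the home sort. -/
def relSymb {k : ℕ} (R : L.Relations k) : (eqLanguage L M).Relations k := EqRelSymb.rel R

theorem relMap_relSymb {k : ℕ} (R : L.Relations k) (z : Fin k → EqCarrier L M) :
    Structure.RelMap (relSymb R : (eqLanguage L M).Relations k) z ↔
      ∃ x, Structure.RelMap (M := M) R x ∧ z = fun i => toEq L (x i) := Iff.rfl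

/-- The symbol for the graph of the projection to an imaginary sort. -/
def projSymb (E : ImagSort L M) : (eqLanguage L M).Relations (E.arity + 1) := EqRelSymb.proj E

theorem relMap_projSymb (E : ImagSort L M) (z : Fin (E.arity + 1) → EqCarrier L M) :
    Structure.RelMap (projSymb E) z ↔ ∃ x : Fin E.arity → M, z =
      Fin.snoc (α := fun _ => EqCarrier L M) (fun i => toEq L (x i)) (cls (some E) x) := Iff.rfl

/-- The formula that says that `a` is represented by the tuple `x`. -/
def clsFormula {α : Type*} : ∀ (s : Option (ImagSort L M)) (_ : Fin (sortArity s) → α) (_ : α),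
    (eqLanguage L M).Formula α
  | none, x, a => Relations.formula (homeSymb L M) (fun _ => Term.var a) ⊓
      Term.equal (Term.var (x (0 : Fin 1))) (Term.var a)
  | some E, x, a => (projSymb E).formula
      (Fin.snoc (α := fun _ => (eqLanguage L M).Term α) (fun i => Term.var (x i)) (Term.var a))

theorem realize_clsFormula {α : Type*} (s : Option (ImagSort L M)) (v : Fin (sortArity s) → α)
    (a : α) (w : α → EqCarrier L M) :
    (clsFormula s v a).Realize w ↔ ∃ x, (∀ i, w (v i) = toEq L (x i)) ∧ w a = cls s x := by
  rcases s with _ | E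
  · simp only [clsFormula, Formula.realize_inf, Formula.realize_rel, Formula.realize_equal,
      Term.realize_var, relMap_homeSymb]
    constructor
    · rintro ⟨⟨x, hx⟩, h⟩
      refine ⟨fun _ => x, fun i => ?_, hx⟩
      rw [← hx, ← h]
      exact congrArg (fun i => w (v i)) (Subsingleton.elim (α := Fin 1) i 0)
    · rintro ⟨x, h1, h2⟩
      exact ⟨⟨_, h2⟩, (h1 (0 : Fin 1)).trans h2.symm⟩
  · simp only [clsFormula, Formula.realize_rel, relMap_projSymb]
    have h : (fun i => Term.realize w (Fin.snoc (α := fun _ => (eqLanguage L M).Term α)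
        (fun i => Term.var (v i)) (Term.var a) i)) =
        Fin.snoc (α := fun _ => EqCarrier L M) (fun i => w (v i)) (w a) :=
      Fin.comp_snoc (Term.realize w) (fun i => Term.var (v i)) (Term.var a)
    refine exists_congr fun x => ?_
    constructor
    · intro h1
      have h2 := Fin.snoc_inj.1 (h.symm.trans h1)
      exact ⟨fun i => congrFun h2.1 i, h2.2⟩
    · rintro ⟨h1, h2⟩
      exact h.trans (Fin.snoc_inj.2 ⟨funext h1, h2⟩)

variable [L.IsRelational]

variable (M) in
/-- Terms of a relational language as terms of the language of `M^eq`. -/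
def eqTerm {α : Type*} : L.Term α → (eqLanguage L M).Term α
  | Term.var a => Term.var a
  | Term.func f _ => isEmptyElim f

variable (M) in
/-- Relativization of formulas to the home sort. -/
def relativize {α : Type*} : ∀ {k : ℕ}, L.BoundedFormula α k → (eqLanguage L M).BoundedFormula α k
  | _, .falsum => .falsum
  | _, .equal t₁ t₂ => .equal (eqTerm M t₁) (eqTerm M t₂)
  | _, .rel R ts => (relSymb R).boundedFormula fun i => eqTerm M (ts i)
  | _, .imp φ ψ => (relativize φ).imp (relativize ψ)
  | k, .all φ => (((homeSymb L M).boundedFormula fun _ => Term.var (Sum.inr (Fin.last k))).imp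
      (relativize φ)).all

theorem realize_eqTerm {α : Type*} (t : L.Term α) (v : α → M) :
    (eqTerm M t).realize (fun i => toEq L (v i)) = toEq L (t.realize v) := by
  rcases t with a | ⟨f, -⟩
  · rfl
  · exact isEmptyElim f

theorem realize_relativize {α : Type*} {k : ℕ} (φ : L.BoundedFormula α k) (v : α → M)
    (xs : Fin k → M) :
    (relativize M φ).Realize (fun i => toEq L (v i)) (fun i => toEq L (xs i)) ↔
      φ.Realize v xs := by
  have hterm : ∀ {k : ℕ} (xs : Fin k → M) (t : L.Term (α ⊕ Fin k)),
      (eqTerm M t).realize (Sum.elim (fun i => toEq L (v i)) fun i => toEq L (xs i)) =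
        toEq L (t.realize (Sum.elim v xs)) := by
    intro k xs t
    rw [← realize_eqTerm]
    congr 1
    funext i
    rcases i with i | i <;> rfl
  induction φ with
  | falsum => exact Iff.rfl
  | equal t₁ t₂ =>
    simp only [relativize, BoundedFormula.Realize, hterm]
    exact toEq_injective.eq_iff
  | rel R ts =>
    simp only [relativize, BoundedFormula.realize_rel, relMap_relSymb, hterm]
    change _ ↔ Structure.RelMap R fun i => (ts i).realize (Sum.elim v xs)
    constructor
    · rintro ⟨x, hx, h⟩
      convert hx using 1
      funext i
      exact toEq_injective (congrFun h i)
    · intro h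
      exact ⟨_, h, rfl⟩
  | imp φ ψ ih1 ih2 =>
    simp only [relativize, BoundedFormula.realize_imp, ih1, ih2]
  | all φ ih =>
    simp only [relativize, BoundedFormula.realize_all, BoundedFormula.realize_imp,
      BoundedFormula.realize_rel, Term.realize_var, Sum.elim_inr, relMap_homeSymb, Fin.snoc_last]
    have hsnoc : ∀ x, (Fin.snoc (α := fun _ => EqCarrier L M) (fun i => toEq L (xs i)) (toEq L x)) =
        fun i => toEq L (Fin.snoc (α := fun _ => M) xs x i) := fun x =>
      (Fin.comp_snoc (toEq L) xs x).symm
    constructor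
    · intro h x
      have := h (toEq L x) ⟨x, rfl⟩
      rw [hsnoc] at this
      exact (ih _).1 this
    · rintro h _ ⟨x, rfl⟩
      rw [hsnoc]
      exact (ih _).2 (h x)

variable (M) in
/-- Relativization of formulas to the home sort. -/
def relF {α : Type*} (φ : L.Formula α) : (eqLanguage L M).Formula α := relativize M φ

theorem realize_relF {α : Type*} (φ : L.Formula α) (v : α → M) :
    (relF M φ).Realize (fun i => toEq L (v i)) ↔ φ.Realize v := by
  have := realize_relativize φ v finZeroElim
  rw [Subsingleton.elim (fun i => toEq L (finZeroElim i)) default,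
    Subsingleton.elim finZeroElim default] at this
  exact this

theorem toEq_mem_acl {C : Set M} {b : M} (hb : b ∈ acl L C) :
    toEq L b ∈ acl (eqLanguage L M) (toEq L '' C) := by
  obtain ⟨φ, hφ, hfin⟩ := mem_acl_iff.1 hb
  let r : C → ↥(toEq L '' C) := fun c => ⟨toEq L c, c, c.2, rfl⟩
  have hr : ∀ x : M, Sum.elim (Subtype.val : ↥(toEq L '' C) → EqCarrier L M)
      (fun _ : Unit => toEq L x) ∘ Sum.map r id = fun i => toEq L (Sum.elim Subtype.val (fun _ => x) i) := by
    intro x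
    funext i
    rcases i with i | i <;> rfl
  -- A relativized formula says nothing about free variables taking imaginary values, so the home
  -- predicate is added to keep the solution set finite.
  refine mem_acl_iff.2 ⟨(relF M φ).relabel (Sum.map r id) ⊓
    (homeSymb L M).formula fun _ => Term.var (Sum.inr ()), ?_, ?_⟩
  · rw [Formula.realize_inf, Formula.realize_relabel, hr, realize_relF]
    exact ⟨hφ, Formula.realize_rel.2 ⟨b, rfl⟩⟩
  · refine (hfin.image (toEq L)).subset ?_
    rintro y hy
    obtain ⟨h1, h2⟩ := Formula.realize_inf.1 hy
    obtain ⟨x, hx⟩ := Formula.realize_rel.1 h2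
    obtain rfl : y = toEq L x := hx
    rw [Formula.realize_relabel, hr, realize_relF] at h1
    exact ⟨x, h1, rfl⟩

end Relativization

section Span

variable {L : FirstOrder.Language.{u, v}} {M : Type w} [L.Structure M]

variable (L) in
/-- The elements of `M^eq` that are represented by tuples from `S`. -/
def eqSpan (S : Set M) : Set (EqCarrier L M) :=
  {c | ∃ (s : Option (ImagSort L M)) (x : Fin (sortArity s) → S), cls s (fun i => (x i : M)) = c}

/-- An elementary substructure is algebraically closed in `M^eq`. -/
theorem IsMonster.acl_eqSpan {κ : Cardinal.{w}} (hM : IsMonster L M κ) (S : L.ElementarySubstructure M)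
    (hS : #S < κ) {C : Set (EqCarrier L M)} (hC : C ⊆ eqSpan L (S : Set M)) :
    acl (eqLanguage L M) C ⊆ eqSpan L (S : Set M) := by
  classical
  intro e he
  by_contra heS
  obtain ⟨s, x, rfl⟩ := exists_cls e
  let I := S ⊕ ULift.{w} (Fin (sortArity s))
  let a : I → M := Sum.elim Subtype.val fun i => x i.down
  let χ : S → L.Formula (I ⊕ I) := fun c =>
    Term.equal (Term.var (Sum.inl (Sum.inl c))) (Term.var (Sum.inr (Sum.inl c)))
  let χe : L.Formula (I ⊕ I) := ∼((eqvFormula s).relabel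
    (Sum.map (fun i => Sum.inr ⟨i⟩) fun i => Sum.inr ⟨i⟩))
  have hχ : ∀ c (z w : I → M), (χ c).Realize (Sum.elim z w) ↔ z (Sum.inl c) = w (Sum.inl c) := by
    intro c z w
    simp only [χ, Formula.realize_equal, Term.realize_var, Sum.elim_inl, Sum.elim_inr]
  have hχe : ∀ (z w : I → M), χe.Realize (Sum.elim z w) ↔
      cls s (fun i => z (Sum.inr ⟨i⟩)) ≠ cls s (fun i => w (Sum.inr ⟨i⟩)) := by
    intro z w
    rw [Formula.realize_not, Formula.realize_relabel, Sum.elim_comp_map, realize_eqvFormula]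
    rfl
  obtain ⟨σ, hσ⟩ := hM.exists_conjugates (S := I)
    (by rw [mk_sum, lift_id, lift_id]; exact hM.add_lt hS hM.countable_lt) a
    (insert χe (Set.range χ)) (by
    intro φ Ψ₀ hφ hΨ
    -- Since `e` is not represented in `S`, the Tarski-Vaught property yields representatives in `S`
    -- of one new class after another, each tuple satisfying `φ`.
    obtain ⟨f, hf1, hf2⟩ := exists_seq_of_forall_finset_exists
      (fun z : Fin (sortArity s) → S => φ.Realize (Sum.elim Subtype.val fun i => (z i.down : M)))
      (fun z w => cls s (fun i => (z i : M)) ≠ cls s fun i => (w i : M)) (by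
        intro F hF
        obtain ⟨z, hz⟩ := exists_realize_of_elementary S
          (φ.relabel (Sum.map id ULift.down) ⊓ Formula.iInf fun w : F =>
            ∼((eqvFormula s).relabel (Sum.map w.1 id))) x (by
            simp only [Formula.realize_inf, Formula.realize_relabel, Formula.realize_iInf,
              Formula.realize_not, Sum.elim_comp_map, Function.comp_id]
            refine ⟨hφ, fun w h => ?_⟩
            exact heS ⟨s, w.1, (realize_eqvFormula s _ _).1 h⟩)
        simp only [Formula.realize_inf, Formula.realize_relabel, Formula.realize_iInf,
          Formula.realize_not, Sum.elim_comp_map, Function.comp_id] at hz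
        exact ⟨z, hz.1, fun w hw h => hz.2 ⟨w, hw⟩ ((realize_eqvFormula s _ _).2 h)⟩)
    refine ⟨fun i => Sum.elim Subtype.val fun k => (f i k.down : M), hf1, fun i j hij ψ hψ => ?_⟩
    rcases hΨ hψ with rfl | ⟨c, rfl⟩
    · rw [hχe]
      exact hf2 i j hij
    · rw [hχ]
      rfl)
  have hσS : ∀ i, ∀ c ∈ eqSpan L (S : Set M), eqMap (σ 0) c = eqMap (σ i) c := by
    rintro i _ ⟨t, y, rfl⟩
    refine eqMap_of_forall fun k => ?_
    rcases Nat.eq_zero_or_pos i with rfl | hi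
    · rfl
    · exact (hχ _ _ _).1 (hσ 0 i hi _ (Or.inr ⟨y k, rfl⟩))
  refine not_mem_acl_of_injective (fun i => eqAut ((σ 0).symm.comp (σ i))) (fun i c hc => ?_)
    (injective_of_lt fun i j hij h => ?_) he
  · rw [eqAut_apply, ← eqMap_comp, ← hσS i c (hC hc), eqMap_symm_eqMap]
  · simp only [eqAut_apply, ← eqMap_comp] at h
    have h1 := congrArg (eqMap (σ 0)) h
    rw [eqMap_eqMap_symm, eqMap_eqMap_symm, eqMap_cls, eqMap_cls] at h1
    exact (hχe _ _).1 (hσ i j hij _ (Or.inl rfl)) h1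

variable [L.IsRelational] [Nonempty M]

/-- Saturation is only available in `M`, so the conjugates are obtained from representing tuples.
Finite satisfiability comes from M^eq: "some tuple satisfies `φ`, represents the finitely many given
elements of `D`, and represents c" is a formula over `D` that holds of `e`, and hence has infinitely
many solutions c. -/
theorem IsMonster.exists_conjugates_imaginary {κ : Cardinal.{w}} (hM : IsMonster L M κ) {S : Set M} (hS : #S < κ)
    {D : Set (EqCarrier L M)} (hD : D ⊆ eqSpan L S) {e : EqCarrier L M} (he : e ∈ eqSpan L S)
    (heD : e ∉ acl (eqLanguage L M) D) :
    ∃ σ : ℕ → (M ≃[L] M), (∀ i j, i < j → ∀ d ∈ D, eqMap (σ i) d = eqMap (σ j) d) ∧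
      ∀ i j, i < j → eqMap (σ i) e ≠ eqMap (σ j) e := by
  classical
  choose s x hx using fun d : D => hD d.2
  obtain ⟨t, y, rfl⟩ := he
  let χ : D → L.Formula (S ⊕ S) := fun d => (eqvFormula (s d)).relabel (Sum.map (x d) (x d))
  let χe : L.Formula (S ⊕ S) := ∼((eqvFormula t).relabel (Sum.map y y))
  have hχ : ∀ d (z w : S → M), (χ d).Realize (Sum.elim z w) ↔
      cls (s d) (fun i => z (x d i)) = cls (s d) (fun i => w (x d i)) := by
    intro d z w
    rw [Formula.realize_relabel, Sum.elim_comp_map, realize_eqvFormula]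
    rfl
  have hχe : ∀ (z w : S → M), χe.Realize (Sum.elim z w) ↔
      cls t (fun i => z (y i)) ≠ cls t (fun i => w (y i)) := by
    intro z w
    rw [Formula.realize_not, Formula.realize_relabel, Sum.elim_comp_map, realize_eqvFormula]
    rfl
  obtain ⟨σ, hσ⟩ := hM.exists_conjugates hS (Subtype.val : S → M) (insert χe (Set.range χ)) (by
    intro φ Ψ₀ hφ hΨ
    let g : {ψ // ψ ∈ Ψ₀ ∧ ψ ∈ Set.range χ} → D := fun ψ => ψ.2.2.choose
    have hg : ∀ ψ, χ (g ψ) = ψ.1 := fun ψ => ψ.2.2.choose_spec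
    have : Finite {ψ // ψ ∈ Ψ₀ ∧ ψ ∈ Set.range χ} :=
      Finite.of_injective (fun ψ => (⟨ψ.1, ψ.2.1⟩ : Ψ₀)) fun a b h =>
        Subtype.ext (congrArg (fun z : Ψ₀ => z.1) h)
    let Φ : (eqLanguage L M).Formula ((D ⊕ Unit) ⊕ S) :=
      ((relF M φ).relabel Sum.inr ⊓ Formula.iInf fun i : (relF M φ).freeVarFinset =>
        (homeSymb L M).formula fun _ => Term.var (Sum.inr i.1)) ⊓
      (clsFormula t (fun i => Sum.inr (y i)) (Sum.inl (Sum.inr ())) ⊓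
        Formula.iInf fun ψ => clsFormula (s (g ψ)) (fun i => Sum.inr (x (g ψ) i))
          (Sum.inl (Sum.inl (g ψ))))
    have : Nonempty (EqCarrier L M) := ⟨toEq L (Classical.arbitrary M)⟩
    obtain ⟨θ, hθ⟩ := exists_formula_exists (N := EqCarrier L M) Φ
    have hinf : {c | θ.Realize (Sum.elim (Subtype.val : D → EqCarrier L M) fun _ => c)}.Infinite := by
      intro hfin
      refine heD (mem_acl_iff.2 ⟨θ, (hθ _).2 ⟨fun a => toEq L a.1, ?_⟩, hfin⟩)
      simp only [Φ, Formula.realize_inf, Formula.realize_relabel, Formula.realize_iInf,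
        Formula.realize_rel, realize_clsFormula, Sum.elim_inr, Sum.elim_inl, Term.realize_var,
        relMap_homeSymb]
      exact ⟨⟨(realize_relF φ _).2 hφ, fun i => ⟨_, rfl⟩⟩, ⟨_, fun _ => rfl, rfl⟩,
        fun ψ => ⟨_, fun _ => rfl, (hx _).symm⟩⟩
    have hpt : ∀ c, θ.Realize (Sum.elim (Subtype.val : D → EqCarrier L M) fun _ => c) →
        ∃ z : S → M, φ.Realize z ∧ cls t (fun i => z (y i)) = c ∧
          ∀ ψ, cls (s (g ψ)) (fun i => z (x (g ψ) i)) = g ψ := by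
      intro c hc
      obtain ⟨z, hz⟩ := (hθ _).1 hc
      simp only [Φ, Formula.realize_inf, Formula.realize_relabel, Formula.realize_iInf,
        Formula.realize_rel, realize_clsFormula, Sum.elim_inr, Sum.elim_inl, Term.realize_var,
        relMap_homeSymb] at hz
      obtain ⟨⟨h1, h2⟩, ⟨a, h3, h4⟩, h5⟩ := hz
      -- Only the finitely many coordinates that occur in `Φ` are known to lie in the home sort; the
      -- others get an arbitrary value.
      let z' : S → M := fun i => if h : ∃ b, z i = toEq L b then h.choose else Classical.arbitrary M
      have hz' : ∀ i b, z i = toEq L b → z' i = b := fun i b hb => by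
        have h : ∃ b, z i = toEq L b := ⟨b, hb⟩
        simp only [z', dif_pos h]
        exact toEq_injective (h.choose_spec.symm.trans hb)
      refine ⟨z', ?_, ?_, fun ψ => ?_⟩
      · rw [← realize_relF]
        refine (realize_congr_freeVar (relF M φ) fun i hi => ?_).1 h1
        obtain ⟨b, hb⟩ := h2 ⟨i, hi⟩
        rw [hz' i b hb]
        exact hb
      · rw [h4]
        exact congrArg _ (funext fun i => hz' _ _ (h3 i))
      · obtain ⟨b, h6, h7⟩ := h5 ψ
        rw [h7]
        exact congrArg _ (funext fun i => hz' _ _ (h6 i))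
    have := hinf.to_subtype
    let f := Infinite.natEmbedding
      {c | θ.Realize (Sum.elim (Subtype.val : D → EqCarrier L M) fun _ => c)}
    choose z hz1 hz2 hz3 using fun i => hpt _ (f i).2
    refine ⟨z, hz1, fun i j hij ψ hψ => ?_⟩
    rcases hΨ hψ with rfl | h
    · rw [hχe, hz2, hz2]
      exact fun h => hij.ne (f.injective (Subtype.ext h))
    · have h1 := hg ⟨ψ, hψ, h⟩
      rw [show ψ = χ _ from h1.symm, hχ, hz3, hz3])
  refine ⟨σ, fun i j hij d hd => ?_, fun i j hij => ?_⟩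
  · have := (hχ _ _ _).1 (hσ i j hij _ (Or.inr ⟨⟨d, hd⟩, rfl⟩))
    rw [← eqMap_cls, ← eqMap_cls, hx] at this
    exact this
  · rw [eqMap_cls, eqMap_cls]
    exact (hχe _ _).1 (hσ i j hij _ (Or.inl rfl))

end Span

end IndepRel


/-! ### M-independence in M^eq from separation over real closed sets. -/

namespace Incidence

open FirstOrder.Language Filter IndepRel BiGraph

instance : lang.IsRelational := fun _ => inferInstanceAs (IsEmpty Empty)

namespace GenericMonster

variable {m n : ℕ} {M : Type u} [lang.Structure M] {κ : Cardinal.{u}} (S : GenericMonster m n M κ)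

/-- Separation over closed subsets of an elementary substructure implies M-independence in the
expansion by imaginaries. -/
theorem mIndep_imaginary (E : lang.ElementarySubstructure M) (hE : #E < κ) {A : Set M}
    (hA : #A < κ) (hsep : ∀ K ⊆ (E : Set M), S.IsClosed K → S.Separated K A E)
    {B : Set (EqCarrier lang M)} (hB : B ⊆ eqSpan lang (E : Set M)) :
    MIndep (eqLanguage lang M) ∅ (toEq lang '' A) B := by
  have := S.nonempty
  intro D _ hDB
  have hD : D ⊆ eqSpan lang (E : Set M) := by
    rw [Set.union_empty] at hDB
    exact hDB.trans (S.monster.acl_eqSpan E hE hB)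
  refine Set.Subset.antisymm ?_ (Set.subset_inter (acl_mono Set.subset_union_left)
    (acl_mono Set.subset_union_left))
  rintro e ⟨he1, he2⟩
  by_contra heD
  have he := S.monster.acl_eqSpan E hE (Set.union_subset hD hB) he2
  -- As in the proof for dividing independence: a sequence constant on `D` and moving `e`, made
  -- pair-homogeneous on `E`, is modified outside `E` so that it is constant on `A`. Then `e` has
  -- infinitely many conjugates over `D` and `A`.
  obtain ⟨σ, hσ1, hσ2⟩ := S.monster.exists_conjugates_imaginary hE hD he heD
  obtain ⟨ρ, hρ, hρ'⟩ := S.monster.exists_pairHomogeneous hE σ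
  obtain ⟨τ, hτ1, hτ2⟩ := S.exists_aut_fixing (C := ∅) (S.closed_of_elementary E) hE hA
    (Set.empty_subset _) (fun K _ => hsep K) ρ hρ fun c hc => hc.elim
  have hτρ : ∀ i, ∀ c ∈ eqSpan lang (E : Set M), eqMap (τ i) c = eqMap (ρ i) c := by
    rintro i _ ⟨t, y, rfl⟩
    exact eqMap_of_forall fun k => hτ1 i _ (y k).2
  have hφ : ∀ (t : Option (ImagSort lang M)) (y : Fin (sortArity t) → (E : Set M)) (i j : ℕ)
      (η : ℕ → (M ≃[lang] M)), ((eqvFormula t).relabel (Sum.elim (fun k => (i, y k))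
        fun k => (j, y k))).Realize (fun p : ℕ × (E : Set M) => η p.1 p.2) ↔
      eqMap (η i) (cls t fun k => y k) = eqMap (η j) (cls t fun k => y k) := by
    intro t y i j η
    rw [Formula.realize_relabel, Sum.comp_elim, realize_eqvFormula, eqMap_cls, eqMap_cls]
    rfl
  have hD' : ∀ i j, i < j → ∀ d ∈ D, eqMap (ρ i) d = eqMap (ρ j) d := by
    intro i j hij d hd
    obtain ⟨t, y, rfl⟩ := hD hd
    exact (hφ t y i j ρ).1 (hρ' _ fun f hf =>
      (hφ t y i j fun i => σ (f i)).2 (hσ1 _ _ (hf hij) _ hd))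
  have he' : ∀ i j, i < j → eqMap (ρ i) e ≠ eqMap (ρ j) e := by
    intro i j hij
    obtain ⟨t, y, rfl⟩ := he
    have := hρ' (∼((eqvFormula t).relabel (Sum.elim (fun k => (i, y k)) fun k => (j, y k))))
      fun f hf => by
        rw [Formula.realize_not]
        exact fun h => hσ2 _ _ (hf hij) ((hφ t y i j fun i => σ (f i)).1 h)
    rw [Formula.realize_not, hφ] at this
    exact this
  refine not_mem_acl_of_injective (fun i => eqAut ((τ 0).symm.comp (τ i))) (fun i c hc => ?_)
    (injective_of_lt fun i j hij h => ?_) he1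
  · have h1 : eqMap (τ i) c = eqMap (τ 0) c := by
      rcases hc with hc | ⟨a, ha, rfl⟩
      · rcases Nat.eq_zero_or_pos i with rfl | hi
        · rfl
        · rw [hτρ i c (hD hc), hτρ 0 c (hD hc), hD' 0 i hi c hc]
      · rw [eqMap_toEq, eqMap_toEq, hτ2 i 0 a ha]
    rw [eqAut_apply, ← eqMap_comp, h1, eqMap_symm_eqMap]
  · simp only [eqAut_apply, ← eqMap_comp] at h
    have h1 := congrArg (eqMap (τ 0)) h
    rw [eqMap_eqMap_symm, eqMap_eqMap_symm, hτρ i e he, hτρ j e he] at h1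
    exact he' i j hij h1

/-- A set whose closure neither contains `b` nor has a neighbour of `b` can be moved over `b`
to a position that is separated from a closed set containing `b`. -/
theorem exists_separated {A Z : Set M} (hZ : S.IsClosed Z) (hZκ : #Z < κ) (hA : #A < κ) {b : M}
    (hbZ : b ∈ Z) (hm : 2 ≤ m) (hn : 2 ≤ n) (hbA : b ∉ S.closure A)
    (hnbr : ∀ x ∈ S.closure A, ¬ S.graph.Adj b x) :
    ∃ σ : M ≃[lang] M, σ b = b ∧ ∀ K ⊆ Z, S.IsClosed K → S.Separated K (σ '' A) Z := by
  have hN : ∀ c, 2 ≤ threshold m n c := by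
    intro c
    cases c
    · exact hm
    · exact hn
  -- This uses that both thresholds are at least two; it makes `{b}` an admissible base for the
  -- amalgam.
  have hb : S.IsClosed {b} := by
    intro x P hP _ hcard
    have h1 : P ⊆ {b} := fun p hp => Finset.mem_singleton.2 (hP hp)
    have h2 := (hN _).trans (hcard.trans (Finset.card_le_card h1))
    simp at h2
  let Y : Set M := S.closure (A ∪ {b})
  have hY : S.IsClosed Y := cl_closed _
  have hYκ : #Y < κ := S.closure_small (S.monster.union_lt hA S.monster.countable_lt)
  have hbY : b ∈ Y := subset_cl _ (Or.inr rfl)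
  have hAY : S.closure A ⊆ Y := cl_mono Set.subset_union_left
  let B : Set Y := {y | y.1 ∈ ({b} : Set M)}
  let s : Unit → B → Z := fun _ y => ⟨y.1.1, by
    have : y.1.1 = b := y.2
    rwa [this]⟩
  -- One copy of cl(Ab) is glued to `Z` along `{b}` only; the copy of `A` found there is the new
  -- position of `A`.
  have D : AmalgamData (S.graph.induce Y) (S.graph.induce Z) (threshold m n) B B s := by
    refine ⟨S.free.of_isEmb (isEmb_val Y), S.free.of_isEmb (isEmb_val Z), S.closed_induce hb,
      S.closed_induce hb, fun a ha _ _ _ => Or.inl ha, fun i => ?_,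
      fun i j x y hij => (hij (Subsingleton.elim i j)).elim, fun i j x hx => rfl⟩
    exact ⟨fun x y h => Subtype.ext (Subtype.ext (congrArg (fun z : Z => z.1) h)), fun _ => rfl,
      fun _ _ => Iff.rfl⟩
  obtain ⟨j, hj, hjZ, hT⟩ := S.exists_completed_emb hZ
    (mk_amalgamCarrier_lt S.monster.uncountable hYκ hZκ) (D.free S.threshold_pos) D.isEmb_inl
  let f : Y → AmalgamCarrier Unit Z B B := amalgamMap s ()
  have hf : IsEmb (S.graph.induce Y) (amalgam D) f := D.isEmb_map ()
  have hfb : ∀ (x : Y) (z : Z), f x = Sum.inl z → x.1 = b ∧ z.1 = b := by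
    intro x z h
    obtain ⟨h1, h2⟩ := amalgamMap_inl h
    refine ⟨h1, ?_⟩
    rw [← h2]
    exact h1
  have hfb' : f ⟨b, hbY⟩ = Sum.inl ⟨b, hbZ⟩ := amalgamMap_of_mem (s := s) (i := ())
    (show (⟨b, hbY⟩ : Y) ∈ B from rfl)
  obtain ⟨σ, hσ⟩ := S.exists_aut_of_emb hYκ (isEmb_val Y) (hj.comp hf)
    (by rwa [Subtype.range_coe]) (S.closed_range (hj.comp hf)
      (S.complete.induce S.threshold_pos hY))
  refine ⟨σ, ?_, fun K hKZ hK => ?_⟩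
  · have h1 := hσ ⟨b, hbY⟩
    rw [Function.comp_apply, hfb', hjZ] at h1
    exact h1
  -- The part of cl(Ab) to be adjoined to `K`. If `b` is in `K`, it is everything. Otherwise it is
  -- just cl(A), which by hypothesis contains neither `b` nor a neighbour of `b`.
  obtain ⟨A', hA'c, hAA', hbA', hA'⟩ : ∃ A' : Set Y,
      (S.graph.induce Y).Closed (threshold m n) A' ∧ (∀ x : Y, x.1 ∈ A → x ∈ A') ∧
      (∀ x ∈ A', x.1 = b → b ∈ K) ∧
      (∀ x ∈ A', S.graph.Adj b x.1 → b ∈ K) ∧ (b ∈ K → ∀ x : Y, x.1 = b → x ∈ A') := by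
    by_cases hbK : b ∈ K
    · exact ⟨Set.univ, fun _ _ _ _ _ => trivial, fun _ _ => trivial, fun _ _ _ => hbK,
        fun _ _ _ => hbK, fun _ _ _ => trivial⟩
    · refine ⟨{y | y.1 ∈ S.closure A}, S.closed_induce (cl_closed _),
        fun x hx => subset_cl _ hx, fun x hx h => ?_, fun x hx h => (hnbr _ hx h).elim,
        fun h => (hbK h).elim⟩
      have h1 : x.1 ∈ S.closure A := hx
      rw [h] at h1
      exact (hbA h1).elim
  obtain ⟨hA', hbK'⟩ := hA'
  let X : Set (AmalgamCarrier Unit Z B B) := Sum.inl '' {z : Z | z.1 ∈ K} ∪ f '' A'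
  have hXinl : ∀ z : Z, Sum.inl z ∈ X → z.1 ∈ K := by
    rintro z (⟨z', hz', h⟩ | ⟨x, hx, h⟩)
    · rw [← Sum.inl_injective h]
      exact hz'
    · obtain ⟨h1, h2⟩ := hfb x z h
      rw [h2]
      exact hbA' x hx h1
  have hXf : ∀ x : Y, f x ∈ X → x ∈ A' := by
    rintro x (⟨z, hz, h⟩ | ⟨x', hx', h⟩)
    · obtain ⟨h1, h2⟩ := hfb x z h.symm
      refine hbK' ?_ x h1
      rw [← h2]
      exact hz
    · rwa [← hf.inj h]
  have hadj : ∀ (z : Z) y, (amalgam D).Adj (Sum.inl z) y → (∃ z', y = Sum.inl z') ∨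
      z.1 = b ∧ ∃ x : Y, y = f x ∧ S.graph.Adj b x.1 := by
    rintro z y (⟨u, u', -, h2, -⟩ | ⟨i, x, x', h1, h2, h3⟩)
    · exact Or.inl ⟨u', h2⟩
    · obtain ⟨h4, h5⟩ := hfb x z h1.symm
      refine Or.inr ⟨h5, x', h2, ?_⟩
      have h6 : S.graph.Adj x.1 x'.1 := h3
      rwa [h4] at h6
  -- Apart from `b`, no vertex has neighbours on both sides of the amalgam, so closedness is checked
  -- on each side separately. If `b` is not in `K`, the choice of `A'` leaves `b` no neighbours in
  -- `X` on the second side.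
  have hX : (amalgam D).Closed (threshold m n) X := by
    intro y P hP hPadj hcard
    rcases amalgam_cases (s := s) y with ⟨u, rfl⟩ | ⟨⟨⟩, x, hx, rfl⟩
    · by_cases hub : u.1 = b ∧ b ∈ K
      · exact Or.inl ⟨u, (by rw [hub.1]; exact hub.2 : u.1 ∈ K), rfl⟩
      refine Or.inl ⟨u, D.isEmb_inl.mem_of_closed (S.closed_induce hK) (fun p hp => ?_) hPadj hcard,
        rfl⟩
      rcases hadj u p (hPadj p hp) with ⟨z, rfl⟩ | ⟨h1, x, rfl, h2⟩
      · exact ⟨z, hXinl z (hP hp), rfl⟩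
      · exact (hub ⟨h1, hA' x (hXf x (hP hp)) h2⟩).elim
    · refine Or.inr ⟨x, hf.mem_of_closed hA'c (fun p hp => ?_) hPadj ?_, rfl⟩
      · rcases hPadj p hp with ⟨u, u', h1, -⟩ | ⟨⟨⟩, x1, x', h1, h2, -⟩
        · exact (hx (amalgamMap_inl h1).1).elim
        · refine ⟨x', hXf x' ?_, h2.symm⟩
          rw [show f x' = p from h2.symm]
          exact hP hp
      · rw [← hf.col]
        exact hcard
  obtain ⟨T, hTc, hT1, hT2⟩ := hT X hX
  have hcl : S.closure (σ '' A ∪ K) ⊆ T := by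
    refine cl_subset hTc (Set.union_subset ?_ fun x hx => ?_)
    · rintro _ ⟨a, ha, rfl⟩
      have h1 := hσ ⟨a, hAY (subset_cl _ ha)⟩
      change σ a = j (f _) at h1
      rw [h1, hT1]
      exact Or.inr ⟨_, hAA' _ ha, rfl⟩
    · rw [← show j (Sum.inl ⟨x, hKZ hx⟩) = x from hjZ ⟨x, hKZ hx⟩, hT1]
      exact Or.inl ⟨_, hx, rfl⟩
  have hTZ : ∀ z ∈ T, z ∈ Z → z ∈ K := by
    intro z hz hzZ
    rw [← show j (Sum.inl ⟨z, hzZ⟩) = z from hjZ ⟨z, hzZ⟩, hT1] at hz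
    exact hXinl _ hz
  refine ⟨fun x hx hxZ => hTZ x (hcl hx) hxZ, fun x hx y hy hxy => ?_⟩
  have hjy : j (Sum.inl ⟨y, hy⟩) = y := hjZ ⟨y, hy⟩
  by_cases hxX : ∃ v ∈ X, x = j v
  · obtain ⟨v, hv, rfl⟩ := hxX
    rw [← hjy, hj.adj] at hxy
    rcases hadj _ _ ((amalgam D).symm hxy) with ⟨z, rfl⟩ | ⟨h1, x, rfl, h2⟩
    · refine Or.inl ?_
      rw [show j (Sum.inl z) = z from hjZ z]
      exact hXinl z hv
    · refine Or.inr ?_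
      change y = b at h1
      rw [h1]
      exact hA' x (hXf x hv) h2
  · push Not at hxX
    rw [← hjy] at hxy
    exact Or.inr (hXinl _ (hT2 x (hcl hx) hxX _ hxy))

end GenericMonster

end Incidence


/-! ### A configuration in which algebraicity passes from b to e, but not back. -/

namespace Incidence

open FirstOrder.Language Filter IndepRel BiGraph

/-- The vertices of a hexagon with sides `s`, `s`, `u` and corners `b`, `x`, `x`, with one more
point `e` on the side `u`. -/
inductive Hexagon : Type u
  | b
  | e
  | u
  | x (k : Bool)
  | s (k : Bool)

namespace Hexagon

/-- Incidence of a point and a line of the hexagon. -/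
def inc : Hexagon → Hexagon → Prop
  | b, s _ => True
  | x k, s l => k = l
  | x _, u => True
  | e, u => True
  | _, _ => False

/-- The hexagon as a bipartite graph. -/
def graph : BiGraph Hexagon.{u} where
  col
    | u => false
    | s _ => false
    | _ => true
  Adj p q := inc p q ∨ inc q p
  symm h := h.symm
  ne := by
    intro p q h
    cases p <;> cases q <;> simp [inc] at h ⊢

/-- The absence of 4-cycles: the hexagon with the additional point is K_{2,2}-free, hence free for
all thresholds that are at least two. -/
theorem eq_of_adj {p p' q q' : Hexagon.{u}} (h1 : graph.Adj p q) (h2 : graph.Adj p q')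
    (h3 : graph.Adj p' q) (h4 : graph.Adj p' q') (hp : p ≠ p') : q = q' := by
  have key : ∀ {p p' q q' : Hexagon.{u}}, inc p q → inc p q' → inc p' q → inc p' q' → p ≠ p' →
      q = q' := by
    intro p p' q q' h1 h2 h3 h4 hp
    cases p <;> cases q <;> simp only [inc] at h1 <;> cases q' <;> simp only [inc] at h2 <;>
      first | rfl | (cases p' <;> simp only [inc] at h3 h4 <;> simp_all)
  have hasymm : ∀ {p q r : Hexagon.{u}}, inc p q → ¬ inc r p := by
    intro p q r h1
    cases p <;> cases q <;> simp only [inc] at h1 <;> cases r <;> exact id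
  rcases (h1 : _ ∨ _) with h1 | h1
  · exact key h1 (h2.resolve_right (hasymm h1)) (h3.resolve_right fun h => hasymm h h1)
      (h4.resolve_right fun h => hasymm h (h2.resolve_right (hasymm h1))) hp
  · have h2' := h2.resolve_left fun h => hasymm h h1
    by_contra hq
    exact hp (key h1 (h3.resolve_left (hasymm h1)) h2' (h4.resolve_left (hasymm h2')) hq)

/-- The number of further vertices through which a vertex of the hexagon is determined. -/
def degree (m n : ℕ) : Hexagon → ℕ
  | b => 0
  | e => n - 1
  | u => m - 2
  | x _ => n - 1
  | s _ => m - 1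

theorem free {N : Bool → ℕ} (hN : ∀ c, 2 ≤ N c) : graph.Free N := by
  rintro c P Q ⟨h1, h2, h3, h4⟩
  obtain ⟨p, hp, p', hp', hne⟩ := Finset.one_lt_card.1 (show 1 < P.card from h2 ▸ hN c)
  obtain ⟨q, hq, q', hq', hne'⟩ := Finset.one_lt_card.1 (show 1 < Q.card from h3 ▸ hN _)
  exact hne (eq_of_adj (h4 p hp q hq) (h4 p' hp' q hq) (h4 p hp q' hq') (h4 p' hp' q' hq') hne')

end Hexagon

namespace GenericMonster

variable {m n : ℕ} {M : Type u} [lang.Structure M] {κ : Cardinal.{u}} (S : GenericMonster m n M κ)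

/-- There are `D`, `e`, `b` such that `e` is algebraic over `D` and `b`, although it is not
algebraic over `D`, and `b` has no neighbour in the closure of `D` and `e`. -/
theorem exists_configuration (hm : 2 ≤ m) (hn : 2 ≤ n) : ∃ (D : Set M) (e b : M),
    #D < κ ∧ e ∉ S.closure D ∧ e ∈ S.closure (D ∪ {b}) ∧ b ∉ S.closure (D ∪ {e}) ∧
      ∀ x ∈ S.closure (D ∪ {e}), ¬ S.graph.Adj b x := by
  classical
  have hN : ∀ c, 2 ≤ threshold m n c := by
    intro c
    cases c
    · exact hm
    · exact hn
  let d := Hexagon.degree.{u} m n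
  let I : Type u := Σ w : Hexagon.{u}, Fin (d w)
  let G : BiGraph (Hexagon.{u} ⊕ I) := Hexagon.graph.addLeaves Sigma.fst
  have hG : G.Free (threshold m n) :=
    (Hexagon.free hN).addLeaves S.threshold_pos fun _ => hN _
  -- The leaves alone determine no vertex of the hexagon. The line `u` has even room for one more
  -- neighbour, so adding `e` does not determine it either.
  have hd : ∀ w : Hexagon.{u}, d w < threshold m n (Hexagon.graph.col w) ∧
      (w = .u → d w + 1 < threshold m n (Hexagon.graph.col w)) := by
    rintro (_ | _ | _ | _ | _) <;>
      simp only [d, Hexagon.degree, Hexagon.graph, threshold] <;> simp <;> omega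
  have hright : ∀ (w : Hexagon.{u}) (P : Finset (Hexagon.{u} ⊕ I)),
      (∀ p ∈ P, G.Adj (Sum.inl w) p) → P.toRight.card ≤ d w := by
    intro w P hP
    have h1 : P.toRight ⊆ Finset.univ.map ⟨Sigma.mk w, sigma_mk_injective⟩ := by
      rintro ⟨v, i⟩ hv
      rw [Finset.mem_toRight] at hv
      have h2 : Sum.inl w = Sum.inl v := addLeaves_adj_inr (G.symm (hP _ hv))
      obtain rfl := Sum.inl_injective h2
      simp
    have h2 := Finset.card_le_card h1
    rwa [Finset.card_map, Finset.card_univ, Fintype.card_fin] at h2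
  let X : Set (Hexagon.{u} ⊕ I) := Set.range Sum.inr
  have hX : G.Closed (threshold m n) X := by
    rintro (w | i) P hP hadj hcard
    · have h1 := hright w P hadj
      have h2 := P.card_toLeft_add_card_toRight
      have h3 : P.toLeft = ∅ := by
        refine Finset.eq_empty_of_forall_notMem fun v hv => ?_
        rw [Finset.mem_toLeft] at hv
        obtain ⟨i, hi⟩ := hP hv
        cases hi
      rw [h3, Finset.card_empty] at h2
      have h4 := (hd w).1
      change threshold m n (Hexagon.graph.col w) ≤ _ at hcard
      omega
    · exact ⟨i, rfl⟩
  -- Apart from leaves, `u` is the only neighbour of `e`, and `e` with the m - 2 leaves at `u` is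
  -- one short of the m points needed. So nothing propagates from `e` towards `b`.
  have hX' : G.Closed (threshold m n) (X ∪ {Sum.inl .e}) := by
    rintro (w | i) P hP hadj hcard
    · by_contra hw
      have h1 := hright w P hadj
      have h2 := P.card_toLeft_add_card_toRight
      have h3 : P.toLeft ⊆ {Hexagon.e} := by
        intro v hv
        rw [Finset.mem_toLeft] at hv
        rcases hP hv with ⟨i, hi⟩ | h
        · cases hi
        · exact Finset.mem_singleton.2 (Sum.inl_injective h)
      have h4 := Finset.card_le_card h3
      rw [Finset.card_singleton] at h4
      have h5 := hd w
      change threshold m n (Hexagon.graph.col w) ≤ _ at hcard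
      by_cases hwu : w = .u
      · have := h5.2 hwu
        omega
      · have h6 : P.toLeft = ∅ := by
          refine Finset.eq_empty_of_forall_notMem fun v hv => hwu ?_
          obtain rfl := Finset.mem_singleton.1 (h3 hv)
          rw [Finset.mem_toLeft] at hv
          have h7 : Hexagon.graph.Adj w .e := (isEmb_addLeaves.adj _ _).1 (hadj _ hv)
          cases w <;> simp [Hexagon.graph, Hexagon.inc] at h7 ⊢
        rw [h6, Finset.card_empty] at h2
        omega
    · exact Or.inl ⟨i, rfl⟩
  have hV : #(Hexagon.{u} ⊕ I) < κ := by
    have : Finite Hexagon.{u} := Finite.of_surjective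
      (fun o : Option (Option (Option (Bool ⊕ Bool))) => match o with
        | none => (.b : Hexagon.{u})
        | some none => .e
        | some (some none) => .u
        | some (some (some (Sum.inl k))) => .x k
        | some (some (some (Sum.inr k))) => .s k) (by
      rintro (_ | _ | _ | k | k)
      · exact ⟨none, rfl⟩
      · exact ⟨some none, rfl⟩
      · exact ⟨some (some none), rfl⟩
      · exact ⟨some (some (some (Sum.inl k))), rfl⟩
      · exact ⟨some (some (some (Sum.inr k))), rfl⟩)
    exact S.monster.countable_lt
  have hempty : S.IsClosed ∅ := by
    intro x P hP _ hcard
    have h1 : P = ∅ := by simpa using hP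
    rw [h1, Finset.card_empty] at hcard
    have := S.threshold_pos (S.graph.col x)
    omega
  obtain ⟨j, hj, -, hT⟩ := S.exists_completed_emb hempty hV hG (f := fun z => z.2.elim)
    ⟨fun z => z.2.elim, fun z => z.2.elim, fun z => z.2.elim⟩
  let D : Set M := j '' X
  have hDe : D ∪ {j (Sum.inl .e)} = j '' (X ∪ {Sum.inl .e}) := by
    rw [Set.image_union, Set.image_singleton]
  obtain ⟨T, hT1, hT2, -⟩ := hT X hX
  obtain ⟨T', hT1', hT2', hT3'⟩ := hT _ hX'
  have hDT : S.closure D ⊆ T := cl_subset hT1 (by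
    rintro _ ⟨x, hx, rfl⟩
    exact (hT2 x).2 hx)
  have hDT' : S.closure (D ∪ {j (Sum.inl .e)}) ⊆ T' := cl_subset hT1' (by
    rw [hDe]
    rintro _ ⟨x, hx, rfl⟩
    exact (hT2' x).2 hx)
  refine ⟨D, j (Sum.inl .e), j (Sum.inl .b), (mk_image_le.trans (mk_set_le X)).trans_lt hV,
    fun h => ?_, ?_, fun h => ?_, fun x hx hbx => ?_⟩
  · obtain ⟨i, hi⟩ := (hT2 _).1 (hDT h)
    cases hi
  · let Cl := S.closure (D ∪ {j (Sum.inl .b)})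
    have hb : j (Sum.inl .b) ∈ Cl := subset_cl _ (Or.inr rfl)
    -- Propagation from `b`: with the help of leaves, `b` gives both lines `s`, each of these gives
    -- its corner `x`, the two corners together give `u`, and `u` gives `e`.
    have step : ∀ (w : Hexagon.{u}) (F : Finset Hexagon.{u}),
        (∀ v ∈ F, Hexagon.graph.Adj w v ∧ j (Sum.inl v) ∈ Cl) →
        threshold m n (Hexagon.graph.col w) ≤ F.card + d w → j (Sum.inl w) ∈ Cl := by
      intro w F hF hcard
      let P : Finset (Hexagon.{u} ⊕ I) :=
        F.disjSum (Finset.univ.map ⟨Sigma.mk w, sigma_mk_injective⟩)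
      have hP : P.card = F.card + d w := by
        rw [Finset.card_disjSum, Finset.card_map, Finset.card_univ, Fintype.card_fin]
      have hPmem : ∀ p ∈ P, G.Adj (Sum.inl w) p ∧ j p ∈ Cl := by
        intro p hp
        rcases Finset.mem_disjSum.1 hp with ⟨v, hv, rfl⟩ | ⟨i, hi, rfl⟩
        · exact ⟨(isEmb_addLeaves.adj _ _).2 (hF v hv).1, (hF v hv).2⟩
        · obtain ⟨k, -, rfl⟩ := Finset.mem_map.1 hi
          exact ⟨addLeaves_adj_leaf (f := Sigma.fst) (⟨w, k⟩ : I),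
            subset_cl _ (Or.inl ⟨_, ⟨_, rfl⟩, rfl⟩)⟩
      refine cl_closed _ _ (P.map ⟨j, hj.inj⟩) ?_ ?_ ?_
      · intro q hq
        obtain ⟨p, hp, rfl⟩ := Finset.mem_map.1 (Finset.mem_coe.1 hq)
        exact (hPmem p hp).2
      · intro q hq
        obtain ⟨p, hp, rfl⟩ := Finset.mem_map.1 hq
        exact (hj.adj _ _).2 (hPmem p hp).1
      · rw [Finset.card_map, hP, hj.col]
        exact hcard
    have hs : ∀ k, j (Sum.inl (.s k)) ∈ Cl := fun k => step _ {.b} (by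
      simp only [Finset.mem_singleton, forall_eq]
      exact ⟨Or.inr trivial, hb⟩) (by
      simp only [Finset.card_singleton, d, Hexagon.degree, Hexagon.graph, threshold]
      simp
      omega)
    have hx : ∀ k, j (Sum.inl (.x k)) ∈ Cl := fun k => step _ {.s k} (by
      simp only [Finset.mem_singleton, forall_eq]
      exact ⟨Or.inl rfl, hs k⟩) (by
      simp only [Finset.card_singleton, d, Hexagon.degree, Hexagon.graph, threshold]
      simp
      omega)
    have hu : j (Sum.inl .u) ∈ Cl := step _ {.x false, .x true} (by
      simp only [Finset.mem_insert, Finset.mem_singleton, forall_eq_or_imp, forall_eq]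
      exact ⟨⟨Or.inr trivial, hx _⟩, Or.inr trivial, hx _⟩) (by
      rw [Finset.card_pair (by simp)]
      simp only [d, Hexagon.degree, Hexagon.graph, threshold]
      simp
      omega)
    exact step _ {.u} (by
      simp only [Finset.mem_singleton, forall_eq]
      exact ⟨Or.inl trivial, hu⟩) (by
      simp only [Finset.card_singleton, d, Hexagon.degree, Hexagon.graph, threshold]
      simp
      omega)
  · rcases (hT2' _).1 (hDT' h) with ⟨i, hi⟩ | h
    · cases hi
    · cases Sum.inl_injective h
  · by_cases hxX : ∃ v ∈ X ∪ {Sum.inl .e}, x = j v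
    · obtain ⟨v, hv, rfl⟩ := hxX
      have h1 : G.Adj (Sum.inl .b) v := (hj.adj _ _).1 hbx
      rcases hv with ⟨⟨w, i⟩, rfl⟩ | rfl
      · have h2 : Sum.inl .b = Sum.inl w := addLeaves_adj_inr (G.symm h1)
        obtain rfl := Sum.inl_injective h2
        exact i.elim0
      · have h2 : Hexagon.graph.Adj .b .e := (isEmb_addLeaves.adj _ _).1 h1
        simp [Hexagon.graph, Hexagon.inc] at h2
    · push Not at hxX
      rcases hT3' x (hDT' hx) hxX _ (S.graph.symm hbx) with ⟨i, hi⟩ | h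
      · cases hi
      · cases Sum.inl_injective h

end GenericMonster

end Incidence


/-! ### Failure of symmetry of thorn independence in M^eq. -/

namespace IndepRel

open FirstOrder.Language

theorem SameType.comp {L : FirstOrder.Language.{u, v}} {N : Type w} [L.Structure N] {C : Set N}
    {ι ι' : Type*} {a a' : ι → N} (h : SameType L C a a') (f : ι' → ι) :
    SameType L C (a ∘ f) (a' ∘ f) := fun φ => by
  have := h (φ.relabel f)
  rwa [Formula.realize_relabel, Formula.realize_relabel] at this

end IndepRel

namespace Incidence

open FirstOrder.Language Filter IndepRel BiGraph

namespace GenericMonster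

variable {m n : ℕ} {M : Type u} [lang.Structure M] {κ : Cardinal.{u}} (S : GenericMonster m n M κ)

theorem exists_small_span (S : GenericMonster m n M κ) {B : Set (EqCarrier lang M)}
    (hB : #B < κ) : ∃ X : Set M, #X < κ ∧ B ⊆ eqSpan lang X := by
  choose s x hx using fun b : B => exists_cls b.1
  let X : Set M := ⋃ b, Set.range (x b)
  refine ⟨X, mk_iUnion_le_sum_mk.trans_lt ?_, fun b hb => ⟨s ⟨b, hb⟩, fun i =>
    ⟨x ⟨b, hb⟩ i, Set.mem_iUnion.2 ⟨⟨b, hb⟩, i, rfl⟩⟩, hx ⟨b, hb⟩⟩⟩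
  refine (sum_le_sum _ (fun _ => ℵ₀) fun b => mk_le_aleph0).trans_lt ?_
  rw [sum_const']
  exact S.monster.mul_lt hB S.monster.uncountable

theorem eqSpan_mono {X Y : Set M} (h : X ⊆ Y) : eqSpan lang X ⊆ eqSpan lang Y := by
  rintro _ ⟨s, x, rfl⟩
  exact ⟨s, fun i => ⟨x i, h (x i).2⟩, rfl⟩

/-- A small set of imaginaries is represented in a small elementary substructure that may be chosen
to contain `b`. Moving `A` over `b` to a position separated from this substructure gives
M-independence. -/
theorem thornIndep_imaginary (hm : 2 ≤ m) (hn : 2 ≤ n) {A : Set M} (hA : #A < κ) {b : M}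
    (hbA : b ∉ S.closure A) (hnbr : ∀ x ∈ S.closure A, ¬ S.graph.Adj b x) :
    ThornIndep (eqLanguage lang M) κ ∅ (toEq lang '' A) {toEq lang b} := by
  intro B hB hbB
  obtain ⟨X, hX, hBX⟩ := S.exists_small_span hB
  obtain ⟨E, hE, hEκ⟩ := S.monster.exists_elementarySubstructure
    (S.monster.union_lt hX (S.monster.countable_lt (α := ({b} : Set M))))
  obtain ⟨σ, hσb, hσ⟩ := S.exists_separated (S.closed_of_elementary E) hEκ hA
    (hE (Or.inr rfl)) hm hn hbA hnbr
  refine ⟨fun x => eqMap σ x, SameType.symm (sameType_of_aut (eqAut σ) ?_ fun _ => rfl), ?_⟩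
  · rintro c (rfl | hc)
    · rw [eqAut_apply, eqMap_toEq, hσb]
    · exact hc.elim
  · have h1 : (Set.range fun x : ↥(toEq lang '' A) => eqMap σ x) = toEq lang '' (σ '' A) := by
      ext y
      constructor
      · rintro ⟨⟨_, a, ha, rfl⟩, rfl⟩
        exact ⟨σ a, ⟨a, ha, rfl⟩, rfl⟩
      · rintro ⟨_, ⟨a, ha, rfl⟩, rfl⟩
        exact ⟨⟨_, a, ha, rfl⟩, rfl⟩
    rw [h1]
    exact S.mIndep_imaginary E hEκ (mk_image_le.trans_lt hA) hσ
      (hBX.trans (eqSpan_mono (Set.subset_union_left.trans hE)))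

/-- With A = De, the set `A` is thorn independent from `b` over ∅. In the other direction, any `b'`
with the type of `b` over `A` still has `e` in acl(Db'), while `e` belongs to `A` and is not
algebraic over D; so base D violates M-independence. -/
theorem not_thornSymmetric (S : GenericMonster m n M κ) (hm : 2 ≤ m) (hn : 2 ≤ n) :
    ¬ ThornSymmetric (eqLanguage lang M) (EqCarrier lang M) κ := by
  intro hsymm
  obtain ⟨D, e, b, hD, heD, heDb, hb, hnbr⟩ := S.exists_configuration hm hn
  have hA : #↥(D ∪ {e}) < κ := S.monster.union_lt hD S.monster.countable_lt
  have hthorn := S.thornIndep_imaginary hm hn hA hb hnbr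
  let A : Set (EqCarrier lang M) := toEq lang '' (D ∪ {e})
  have hAκ : #A < κ := mk_image_le.trans_lt hA
  -- No enlargement of `A` is needed to refute thorn independence of `b`.
  obtain ⟨b', hb', hM⟩ := hsymm A {toEq lang b} ∅ hAκ
    (by rw [mk_singleton]; exact one_lt_aleph0.trans S.monster.uncountable)
    (by rw [mk_eq_zero]; exact aleph0_pos.trans S.monster.uncountable) hthorn A hAκ subset_rfl
  have hDA : toEq lang '' D ⊆ A := Set.image_mono Set.subset_union_left
  have heA : toEq lang e ∈ A := ⟨e, Or.inr rfl, rfl⟩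
  have h1 : AlgIndep _ _ _ _ := hM (toEq lang '' D) (Set.empty_subset _)
    ((hDA.trans Set.subset_union_left).trans (subset_acl _))
  have h2 : toEq lang e ∈ acl (eqLanguage lang M) (toEq lang '' D) := by
    rw [← h1]
    refine ⟨?_, subset_acl _ (Or.inr heA)⟩
    have h3 : toEq lang e ∈ acl (eqLanguage lang M) (toEq lang '' D ∪ {toEq lang b}) := by
      rw [← Set.image_singleton, ← Set.image_union]
      refine toEq_mem_acl ?_
      rwa [S.acl_eq_closure (S.monster.union_lt hD S.monster.countable_lt)]
    rw [Set.union_empty] at hb'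
    refine acl_mono (Set.union_subset_union_right _ ?_) (mem_acl_of_sameType h3 hDA heA
      (hb'.comp fun _ : Unit => ⟨toEq lang b, rfl⟩))
    rintro _ rfl
    exact ⟨_, rfl⟩
  rw [← S.acl_eq_closure hD] at heD
  obtain ⟨σ, hσ, hinj⟩ := S.monster.exists_aut_of_not_mem_acl hD heD
  refine not_mem_acl_of_injective (fun i => eqAut (σ i)) ?_ (fun i j h => hinj ?_) h2
  · rintro i _ ⟨x, hx, rfl⟩
    rw [eqAut_apply, eqMap_toEq, hσ i x hx]
  · exact toEq_injective h

end GenericMonster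

end Incidence

theorem mainTheorem12 (m n : ℕ) (hm : 1 ≤ m) (hn : 1 ≤ n)
    (M : Type u) [Incidence.lang.Structure M] [M ⊨ Incidence.T m n]
    (κ : Cardinal.{u}) (hM : IndepRel.IsMonster Incidence.lang M κ) :
    (∀ A B C : Set M, #A < κ → #B < κ → #C < κ →
      (IndepRel.ForkingIndep Incidence.lang κ C A B ↔
        IndepRel.ThornIndep Incidence.lang κ C A B)) ∧
    (2 ≤ m → 2 ≤ n →
      ¬ IndepRel.ThornSymmetric (IndepRel.eqLanguage Incidence.lang M)
          (IndepRel.EqCarrier Incidence.lang M) κ) := by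
  have S : Incidence.GenericMonster m n M κ := ⟨hm, hn, inferInstance, hM⟩
  exact ⟨fun A B C hA hB hC => ⟨S.thornIndep_of_forkingIndep hA hB hC,
    S.forkingIndep_of_thornIndep hA hB hC⟩, S.not_thornSymmetric⟩
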